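/- **Smoothing operators for flat functions.** Let $m\in\mathbb N_0$. For $r>0$ let $\overline B_r\subset\mathbb R^m$ be the closed ball of radius $r$ around $0$, and let $$C^\infty_0(\overline B_r)=\{f\in C^\infty(\overline B_r;\mathbb C)\mid D^af(0)=0\ \ \forall a\in\mathbb N_0^m\},\qquad \|f\|_{n,k,r}=\sup_{0\ne x\in\overline B_r}\ \sup_{|a|\le n}|x|^{-k}|D^af(x)|,$$ for $n,k\in\mathbb N_0$; these norms are finite. Let $\mathcal S_0(\mathbb R^m)$ be the space of complex-valued Schwartz functions all of whose derivatives vanish at $0$, and set $\|g\|_{n,k}=\sup_{x\ne0}\sup_{|a|\le n,\,l\le k}|x|^{-l}|D^ag(x)|$. An *extension operator* is a $\mathbb C$-linear map $\epsilon:C^\infty_0(\overline B_1)\to\mathcal S_0(\mathbb R^m)$ with $\epsilon(f)|_{\overline B_1}=f$, mapping real-valued functions to real-valued functions, such that all $\epsilon(f)$ are supported in one common ball and for all $n,k$ there is a constant $C$ with $\|\epsilon(f)\|_{n,k}\le C\|f\|_{n,k,1}$ for all $f$. Let $\chi,\psi\in C^\infty(\mathbb R)$ be real-valued, with $\chi(u)=1$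 for $u\le1$, $\chi$ decreasing on $(1,2)$, $\chi(u)=0$ for $u\ge2$, and with $\psi(u)=0$ for $u\le1$, $\psi(u)=1$ for $u\ge2$. Extension operators and functions $\chi,\psi$ with these properties exist. For any choice of $\epsilon,\chi,\psi$ define operators as follows. Let $\rho(x)=x/|x|^2$, with pullback $\rho^*$ (extended by $0$ at the origin). Let $K$ be the function with Fourier transform $\hat K(\xi)=(2\pi)^{-m/2}\prod_{i=1}^m\chi(|\xi_i|)$ (unitary normalization), let $K_t(x)=t^mK(tx)$ and $\tilde S_t(h)=K_t*h$, and let $m_c(x)=cx$. For $t,s,r>0$ put $$S_{t,1}(f)=\rho^*\big(\tilde S_t(\rho^*\epsilon(f))\big|_{\{|y|\ge1\}}\big),\qquad S_{t,r}=m_{1/r}^*\circ S_{t,1}\circ m_r^*,$$ $$T_{s,1}(f)(x)=\psi(s|x|)f(x),\qquad T_{s,r}=m_{1/r}^*\circ T_{s,1}\circ m_r^*,\qquad S_{t,s,r}=T_{s,r}\circ S_{t,r}.$$ Then for all $t,s,r>0$ this defines a linear operator $S_{t,s,r}:C^\infty_0(\overline B_r)\to C^\infty_0(\overline B_r)$,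 which maps real-valued functions to real-valued functions. Moreover, for all $j,k,l,n\in\mathbb N_0$ there is a constant $C=C(j,k,n,l,r)>0$, depending continuously on $r>0$ (and on $m,\epsilon,\chi,\psi$, but not on $t,s,f$), such that for all $r>0$, $f\in C^\infty_0(\overline B_r)$, $s>0$ and $t\ge1$ $$\|S_{t,s,r}(f)\|_{n+l,k+j,r}\le C\,s^j\,t^l\,\|f\|_{n,k+2l,r},$$ $$\|(S_{t,s,r}-\mathrm{id})(f)\|_{n,k+2l,r}\le C\,\big(t^{-l}\|f\|_{n+l,k,r}+s^{-j}\|f\|_{n,k+2l+j,r}\big).$$ -/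

import Mathlib

open scoped ContDiff SchwartzMap ENNReal

noncomputable section

namespace FlatSmoothing

/-- The Euclidean space `ℝ^m`. -/
abbrev E (m : ℕ) : Type := EuclideanSpace ℝ (Fin m)

/-- Radii of balls: the positive real numbers. -/
abbrev Radius : Type := Set.Ioi (0 : ℝ)

/-- The radius `1`. -/
def unitRadius : Radius := ⟨1, Set.mem_Ioi.2 one_pos⟩

/-- The closed ball of radius `r` around the origin. -/
abbrev cball (m : ℕ) (r : Radius) : Set (E m) := Metric.closedBall 0 (r : ℝ)

/-- The partial derivative `∂_{v 0} ⋯ ∂_{v (i-1)} f` of order `i` at `x`, of a function `f` on `s`.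
The operators `D^a` with `a` a multi-index, `|a| = i`, are exactly those given by words
`v : Fin i → Fin m` (partial derivatives commute). -/
def pderiv {m : ℕ} (s : Set (E m)) (f : E m → ℂ) {i : ℕ} (v : Fin i → Fin m) (x : E m) : ℂ :=
  iteratedFDerivWithin ℝ i f s x (fun q => EuclideanSpace.single (v q) (1 : ℝ))

theorem uniqueDiffOn_cball (m : ℕ) (r : Radius) : UniqueDiffOn ℝ (cball m r) := by
  apply uniqueDiffOn_convex (convex_closedBall _ _)
  exact ⟨0, Metric.ball_subset_interior_closedBall (Metric.mem_ball_self r.2)⟩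

theorem zero_mem_cball (m : ℕ) (r : Radius) : (0 : E m) ∈ cball m r :=
  Metric.mem_closedBall_self (le_of_lt r.2)

/-- The space of complex valued smooth functions on the closed ball of radius `r` that are flat
at the origin.  A function on the closed ball is represented by its extension by zero to `ℝ^m`;
smoothness and derivatives are taken within the closed ball, so they see only the values on it. -/
def FlatFun (m : ℕ) (r : Radius) : Submodule ℂ (E m → ℂ) where
  carrier := {f | ContDiffOn ℝ ∞ f (cball m r) ∧
    (∀ (i : ℕ) (v : Fin i → Fin m), pderiv (cball m r) f v 0 = 0) ∧
    ∀ x, x ∉ cball m r → f x = 0}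
  zero_mem' := by
    refine ⟨contDiffOn_const, fun i v => ?_, fun x _ => rfl⟩
    simp [pderiv]
  add_mem' := by
    rintro f g ⟨hf, hf', hf''⟩ ⟨hg, hg', hg''⟩
    refine ⟨hf.add hg, fun i v => ?_, fun x hx => by simp [hf'' x hx, hg'' x hx]⟩
    have h := hf' i v
    have h' := hg' i v
    unfold pderiv at *
    rw [iteratedFDerivWithin_add_apply
      ((hf 0 (zero_mem_cball m r)).of_le (by exact_mod_cast le_top))
      ((hg 0 (zero_mem_cball m r)).of_le (by exact_mod_cast le_top))
      (uniqueDiffOn_cball m r) (zero_mem_cball m r)]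
    simp [h, h']
  smul_mem' := by
    rintro c f ⟨hf, hf', hf''⟩
    refine ⟨hf.const_smul c, fun i v => ?_, fun x hx => by simp [hf'' x hx]⟩
    have h := hf' i v
    unfold pderiv at *
    rw [iteratedFDerivWithin_const_smul_apply
      ((hf 0 (zero_mem_cball m r)).of_le (by exact_mod_cast le_top))
      (uniqueDiffOn_cball m r) (zero_mem_cball m r)]
    simp [h]

/-- The weighted norm `sup_{x ∈ B̄_r} sup_{|a| ≤ n} |x|^{-k} |D^a f(x)|` for functions on the
closed ball.  The origin, where for a flat `f` the continuous extension of
`|x|^{-k} |D^a f(x)|` has the value `0`, is left out of the supremum. -/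
def flatNorm {m : ℕ} (n k : ℕ) (r : Radius) (f : E m → ℂ) : ℝ≥0∞ :=
  ⨆ x ∈ cball m r \ {0}, ⨆ i ∈ Set.Iic n, ⨆ v : Fin i → Fin m,
    ‖pderiv (cball m r) f v x‖ₑ / ‖x‖ₑ ^ k

/-- The space of Schwartz functions on `ℝ^m` that are flat at the origin. -/
def FlatSchwartz (m : ℕ) : Submodule ℂ 𝓢(E m, ℂ) where
  carrier := {f | ∀ (i : ℕ) (v : Fin i → Fin m), pderiv Set.univ f v 0 = 0}
  zero_mem' := by
    intro i v
    have : ((0 : 𝓢(E m, ℂ)) : E m → ℂ) = 0 := rfl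
    simp [pderiv, this]
  add_mem' := by
    intro f g hf hg i v
    have h := hf i v
    have h' := hg i v
    have e : ((f + g : 𝓢(E m, ℂ)) : E m → ℂ) = (f : E m → ℂ) + g := rfl
    unfold pderiv at *
    rw [e, iteratedFDerivWithin_add_apply (f.smooth i).contDiffAt.contDiffWithinAt
      (g.smooth i).contDiffAt.contDiffWithinAt uniqueDiffOn_univ (Set.mem_univ _)]
    simp [h, h']
  smul_mem' := by
    intro c f hf i v
    have h := hf i v
    have e : ((c • f : 𝓢(E m, ℂ)) : E m → ℂ) = c • (f : E m → ℂ) := rfl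
    unfold pderiv at *
    rw [e, iteratedFDerivWithin_const_smul_apply (f.smooth i).contDiffAt.contDiffWithinAt
      uniqueDiffOn_univ (Set.mem_univ _)]
    simp [h]

/-- The norm `sup_{x ≠ 0} sup_{|a| ≤ n, l ≤ k} |x|^{-l} |D^a f(x)|` for functions on `ℝ^m`. -/
def globalFlatNorm {m : ℕ} (n k : ℕ) (f : E m → ℂ) : ℝ≥0∞ :=
  ⨆ x ∈ ({0}ᶜ : Set (E m)), ⨆ i ∈ Set.Iic n, ⨆ v : Fin i → Fin m, ⨆ l ∈ Set.Iic k,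
    ‖pderiv Set.univ f v x‖ₑ / ‖x‖ₑ ^ l

/-- A linear extension operator from flat functions on the closed unit ball to flat Schwartz
functions, with supports in a common ball, bounded for all the weighted norms, and mapping
real valued functions to real valued functions. -/
structure IsFlatExtension {m : ℕ} (ε : FlatFun m unitRadius →ₗ[ℂ] FlatSchwartz m) : Prop where
  extends_ball : ∀ (f : FlatFun m unitRadius), ∀ x ∈ cball m unitRadius,
    (ε f : 𝓢(E m, ℂ)) x = (f : E m → ℂ) x
  supported : ∃ R : ℝ, ∀ (f : FlatFun m unitRadius) (x : E m), R < ‖x‖ →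
    (ε f : 𝓢(E m, ℂ)) x = 0
  bounded : ∀ n k : ℕ, ∃ C : ℝ, ∀ f : FlatFun m unitRadius,
    globalFlatNorm n k (ε f : 𝓢(E m, ℂ)) ≤
      ENNReal.ofReal C * flatNorm n k unitRadius (f : E m → ℂ)
  real_valued : ∀ f : FlatFun m unitRadius, (∀ x, ((f : E m → ℂ) x).im = 0) →
    ∀ x, ((ε f : 𝓢(E m, ℂ)) x).im = 0

/-- The inversion `x ↦ x / |x|^2` in the unit sphere, for `x ≠ 0`. -/
def inversion {m : ℕ} (x : E m) : E m := (‖x‖ ^ 2)⁻¹ • x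

/-- Pull back along the inversion, extended by `0` at the origin. -/
def pullInversion {m : ℕ} (g : E m → ℂ) (x : E m) : ℂ :=
  if x = 0 then 0 else g (inversion x)

/-- The cutoff functions entering Nash's kernel. -/
structure IsNashCutoff (χ : ℝ → ℝ) : Prop where
  smooth : ContDiff ℝ ∞ χ
  eq_one : ∀ u ≤ 1, χ u = 1
  anti : AntitoneOn χ (Set.Ioo 1 2)
  eq_zero : ∀ u, 2 ≤ u → χ u = 0

/-- The cutoff functions entering the smoothing in the weights. -/
structure IsWeightCutoff (ψ : ℝ → ℝ) : Prop where
  smooth : ContDiff ℝ ∞ ψ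
  eq_zero : ∀ u ≤ 1, ψ u = 0
  eq_one : ∀ u, 2 ≤ u → ψ u = 1

/-- The Fourier transform (with the unitary normalization) of Nash's kernel. -/
def nashSymbol (m : ℕ) (χ : ℝ → ℝ) (ξ : E m) : ℂ :=
  (((1 / Real.sqrt (2 * Real.pi)) ^ m * ∏ i, χ |ξ i| : ℝ) : ℂ)

/-- Nash's kernel `K`, the inverse Fourier transform (with the unitary normalization) of
`nashSymbol`. -/
def nashKernel (m : ℕ) (χ : ℝ → ℝ) (x : E m) : ℂ :=
  (((1 / Real.sqrt (2 * Real.pi)) ^ m : ℝ) : ℂ) *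
    ∫ ξ : E m, nashSymbol m χ ξ * Complex.exp (Complex.I * ((inner ℝ x ξ : ℝ) : ℂ))

/-- Nash's smoothing `K_t * h` with `K_t(x) = t^m K(t x)`. -/
def nashSmoothing (m : ℕ) (χ : ℝ → ℝ) (t : ℝ) (h : E m → ℂ) (x : E m) : ℂ :=
  ∫ y : E m, ((t ^ m : ℝ) : ℂ) * nashKernel m χ (t • (x - y)) * h y

/-- Pull back along the multiplication by `c`. -/
def pullDilation {m : ℕ} (c : ℝ) (f : E m → ℂ) (x : E m) : ℂ := f (c • x)

/-- Pull back along the multiplication by `r`, from flat functions on the ball of radius `r`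
to flat functions on the unit ball. -/
def toUnitBall {m : ℕ} (r : Radius) (f : FlatFun m r) : FlatFun m unitRadius :=
  ⟨pullDilation (r : ℝ) (f : E m → ℂ), by
    have hr : (0 : ℝ) < r := r.2
    obtain ⟨hf, hf', hf''⟩ := f.2
    have hpre : ∀ x : E m, (r : ℝ) • x ∈ cball m r ↔ x ∈ cball m unitRadius := by
      intro x
      simp only [mem_closedBall_zero_iff, norm_smul, Real.norm_eq_abs, abs_of_pos hr, unitRadius]
      exact mul_le_iff_le_one_right hr
    let g : E m ≃L[ℝ] E m := ContinuousLinearEquiv.smulLeft (Units.mk0 (r : ℝ) hr.ne')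
    have hg : ∀ x, g x = (r : ℝ) • x := fun x => rfl
    have hset : g ⁻¹' cball m r = cball m unitRadius := by
      ext x
      rw [Set.mem_preimage, hg, hpre]
    have hcomp : pullDilation (r : ℝ) (f : E m → ℂ) = (f : E m → ℂ) ∘ g := rfl
    refine ⟨?_, fun i v => ?_, fun x hx => hf'' _ (fun h => hx ((hpre x).1 h))⟩
    · rw [hcomp, ← hset]
      exact hf.comp g.contDiff.contDiffOn (fun x hx => hx)
    · have hz : iteratedFDerivWithin ℝ i (f : E m → ℂ) (cball m r) 0 = 0 := by
        ext w
        have hw : ∀ q, w q = ∑ p, (w q).ofLp p • EuclideanSpace.single p (1 : ℝ) := by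
          intro q
          ext p
          simp [Finset.sum_apply, Pi.single_apply]
        rw [show w = fun q => ∑ p, (w q).ofLp p • EuclideanSpace.single p (1 : ℝ) from funext hw,
          ContinuousMultilinearMap.map_sum]
        refine Finset.sum_eq_zero fun c _ => ?_
        rw [ContinuousMultilinearMap.map_smul_univ]
        have := hf' i c
        unfold pderiv at this
        simp [this]
      unfold pderiv
      rw [hcomp, ← hset, g.iteratedFDerivWithin_comp_right _ (uniqueDiffOn_cball m r)
        (by rw [hg, smul_zero]; exact zero_mem_cball m r), hg, smul_zero, hz]
      simp⟩

/-- Smoothing in the derivatives on the unit ball: extend to `ℝ^m`, pull back along the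
inversion, apply Nash's smoothing, restrict to the complement of the open unit ball, and pull
back along the inversion to the closed unit ball. -/
def derivSmoothingUnit {m : ℕ} (ε : FlatFun m unitRadius →ₗ[ℂ] FlatSchwartz m) (χ : ℝ → ℝ)
    (t : ℝ) (f : FlatFun m unitRadius) : E m → ℂ :=
  (cball m unitRadius).indicator
    (pullInversion (nashSmoothing m χ t (pullInversion (ε f : 𝓢(E m, ℂ)))))

/-- Smoothing in the derivatives on the ball of radius `r`. -/
def derivSmoothing {m : ℕ} (ε : FlatFun m unitRadius →ₗ[ℂ] FlatSchwartz m) (χ : ℝ → ℝ)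
    (t : ℝ) (r : Radius) (f : FlatFun m r) : E m → ℂ :=
  pullDilation (r : ℝ)⁻¹ (derivSmoothingUnit ε χ t (toUnitBall r f))

/-- Smoothing in the weights on the unit ball. -/
def weightSmoothingUnit {m : ℕ} (ψ : ℝ → ℝ) (s : ℝ) (g : E m → ℂ) (x : E m) : ℂ :=
  (ψ (s * ‖x‖) : ℂ) * g x

/-- Smoothing in the weights on the ball of radius `r`. -/
def weightSmoothing {m : ℕ} (ψ : ℝ → ℝ) (s : ℝ) (r : Radius) (g : E m → ℂ) : E m → ℂ :=
  pullDilation (r : ℝ)⁻¹ (weightSmoothingUnit ψ s (pullDilation (r : ℝ) g))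

/-- The combined smoothing: smoothing in the derivatives with parameter `t`, followed by
smoothing in the weights with parameter `s`. -/
def combinedSmoothing {m : ℕ} (ε : FlatFun m unitRadius →ₗ[ℂ] FlatSchwartz m) (χ ψ : ℝ → ℝ)
    (t s : ℝ) (r : Radius) (f : FlatFun m r) : E m → ℂ :=
  weightSmoothing ψ s r (derivSmoothing ε χ t r f)

end FlatSmoothing

end

open FlatSmoothing

open scoped ContDiff SchwartzMap ENNReal

noncomputable section

namespace FlatSmoothing

/-! The inversion turns flatness at the origin into decay at infinity, so smoothing flat functions
becomes Nash's smoothing of rapidly decreasing functions, with estimates in polynomial weights.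

The norms correspond as follows. A flat function is the integral of its derivatives from the origin,
so a bound `A * ‖x‖ ^ k` on derivatives of order `n` improves to `A * ‖x‖ ^ (k + n - b)` in order
`b`. Differentiating through the inversion then shows that the norm with indices `n, k` controls `(1
+ ‖y‖) ^ (k + n + a) * ‖D^a h(y)‖` for `a ≤ n`, where `h` is the pull back of the extension, and
conversely such bounds return to the origin (`exists_weighted_pullInversion_le`,
`exists_pullInversion_weighted_le`). One further derivative at infinity thus comes with one further
power of the weight. This is why `l` derivatives are exchanged for `2 * l` weights.

At infinity two facts about the kernel suffice. Its derivatives have finite weighted `L¹` norms, so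
`l` derivatives can be put on it at the cost `t ^ l` (`exists_weighted_conv_le`). Its Fourier
transform is constant near `0`, so its mass is one and all higher moments vanish. Subtracting the
Taylor polynomial under the integral gives the error `t ^ (-l)`
(`exists_weighted_iteratedFDeriv_conv_sub_le`).

The factor `ψ (s * ‖x‖)` vanishes for `s * ‖x‖ ≤ 1`, so it is bounded by a multiple of `(s * ‖x‖) ^
j`. Its difference from `1` is bounded by a multiple of `(s * ‖x‖) ^ (-j)`. The same holds for
derivatives of order `c` multiplied by `‖x‖ ^ c`, uniformly in `s`. With `θ = ψ (s * ‖x‖)`, the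
error of the combined operator is `θ * (S_t f - f) - (1 - θ) * f`, which yields the two terms of the
second estimate. Dilations transfer everything to radius `r`.

The existence of an extension operator is Seeley's theorem for the ball: outside, take `∑ a_j f(R_j
x)`, where `R_j` moves `x` inwards with speed `2 ^ j` and stops at the origin. Matching all
derivatives on the sphere amounts to `∑ a_j 2 ^ (j p)` being `1` for `p = 0` and `0` otherwise. Such
coefficients come from an entire series with zeros at `2, 4, 8, …`. Flatness at the origin makes the
stopping harmless. -/

/-- The vectors of the standard basis of `ℝ^m` selected by a word. -/
abbrev basisWord {m i : ℕ} (v : Fin i → Fin m) : Fin i → E m :=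
  fun q => EuclideanSpace.single (v q) (1 : ℝ)

/-! ### Operator norms of derivatives versus partial derivatives; the weighted norms as real
inequalities -/

theorem multilinear_apply_eq_sum {m i : ℕ} (L : (E m) [×i]→L[ℝ] ℂ) (w : Fin i → E m) :
    L w = ∑ c : Fin i → Fin m, (∏ q, (w q).ofLp (c q)) • L (basisWord c) := by
  have hw : ∀ q, w q = ∑ p, (w q).ofLp p • EuclideanSpace.single p (1 : ℝ) := by
    intro q
    ext p
    simp [Finset.sum_apply, Pi.single_apply]
  conv_lhs =>
    rw [show w = fun q => ∑ p, (w q).ofLp p • EuclideanSpace.single p (1 : ℝ) from funext hw,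
      ContinuousMultilinearMap.map_sum]
  refine Finset.sum_congr rfl fun c _ => ?_
  rw [ContinuousMultilinearMap.map_smul_univ]

/-- Expanding every argument in the standard basis gives `m ^ i` words, each with coefficients
bounded by the norms of the arguments. It allows estimates to be made on partial derivatives or on
full derivatives, as convenient. -/
theorem norm_multilinear_le_of_basis {m i : ℕ} (L : (E m) [×i]→L[ℝ] ℂ) {B : ℝ} (hB : 0 ≤ B)
    (h : ∀ c : Fin i → Fin m, ‖L (basisWord c)‖ ≤ B) : ‖L‖ ≤ m ^ i * B := by
  refine ContinuousMultilinearMap.opNorm_le_bound (by positivity) fun w => ?_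
  rw [multilinear_apply_eq_sum]
  refine (norm_sum_le _ _).trans ?_
  have : ∀ c ∈ (Finset.univ : Finset (Fin i → Fin m)),
      ‖(∏ q, (w q).ofLp (c q)) • L (basisWord c)‖ ≤ B * ∏ q, ‖w q‖ := by
    intro c _
    rw [norm_smul, norm_prod, mul_comm]
    exact mul_le_mul (h c) (Finset.prod_le_prod (fun _ _ => norm_nonneg _)
      fun q _ => PiLp.norm_apply_le (w q) (c q)) (by positivity) hB
  refine (Finset.sum_le_sum this).trans (le_of_eq ?_)
  simp [Finset.card_univ]
  ring

theorem norm_multilinear_basis_le {m i : ℕ} (L : (E m) [×i]→L[ℝ] ℂ) (c : Fin i → Fin m) :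
    ‖L (basisWord c)‖ ≤ ‖L‖ := by
  refine (L.le_opNorm _).trans (le_of_eq ?_)
  simp

theorem multilinear_eq_zero_of_basis {m i : ℕ} (L : (E m) [×i]→L[ℝ] ℂ)
    (h : ∀ c : Fin i → Fin m, L (basisWord c) = 0) : L = 0 := by
  have := norm_multilinear_le_of_basis L le_rfl (fun c => by rw [h c, norm_zero])
  rw [mul_zero] at this
  exact norm_le_zero_iff.1 this

theorem enorm_div_pow_le_ofReal {V : Type*} [NormedAddCommGroup V] {m : ℕ} {a : V} {x : E m}
    {k : ℕ} {A : ℝ} (hx : x ≠ 0) (h : ‖a‖ ≤ A * ‖x‖ ^ k) : ‖a‖ₑ / ‖x‖ₑ ^ k ≤ ENNReal.ofReal A := by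
  have hx' : 0 < ‖x‖ := norm_pos_iff.2 hx
  rw [← ofReal_norm, ← ofReal_norm, ← ENNReal.ofReal_pow hx'.le,
    ← ENNReal.ofReal_div_of_pos (by positivity)]
  exact ENNReal.ofReal_le_ofReal (by rwa [div_le_iff₀ (by positivity)])

theorem norm_le_of_enorm_div_pow_le {V : Type*} [NormedAddCommGroup V] {m : ℕ} {a : V} {x : E m}
    {k : ℕ} {A : ℝ} (hA : 0 ≤ A) (hx : x ≠ 0) (h : ‖a‖ₑ / ‖x‖ₑ ^ k ≤ ENNReal.ofReal A) :
    ‖a‖ ≤ A * ‖x‖ ^ k := by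
  have hx' : 0 < ‖x‖ := norm_pos_iff.2 hx
  rw [← ofReal_norm, ← ofReal_norm, ← ENNReal.ofReal_pow hx'.le,
    ← ENNReal.ofReal_div_of_pos (by positivity), ENNReal.ofReal_le_ofReal_iff hA,
    div_le_iff₀ (by positivity)] at h
  exact h

theorem flatNorm_le_ofReal {m n k : ℕ} {r : Radius} {f : E m → ℂ} {A : ℝ}
    (h : ∀ x ∈ cball m r, x ≠ 0 → ∀ i ≤ n,
      ‖iteratedFDerivWithin ℝ i f (cball m r) x‖ ≤ A * ‖x‖ ^ k) :
    flatNorm n k r f ≤ ENNReal.ofReal A := by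
  refine iSup₂_le fun x hx => iSup₂_le fun i hi => iSup_le fun v => ?_
  exact enorm_div_pow_le_ofReal hx.2 ((norm_multilinear_basis_le _ _).trans (h x hx.1 hx.2 i hi))

theorem norm_pderiv_le_of_flatNorm_le {m n k : ℕ} {r : Radius} {f : E m → ℂ} {A : ℝ}
    (hA : 0 ≤ A) (h : flatNorm n k r f ≤ ENNReal.ofReal A) {x : E m} (hx : x ∈ cball m r)
    (hx0 : x ≠ 0) {i : ℕ} (hi : i ≤ n) (v : Fin i → Fin m) :
    ‖pderiv (cball m r) f v x‖ ≤ A * ‖x‖ ^ k := by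
  refine norm_le_of_enorm_div_pow_le hA hx0 (le_trans ?_ h)
  unfold flatNorm
  refine le_trans ?_ (le_iSup₂ (f := fun (x : E m) (_ : x ∈ cball m r \ {0}) =>
    ⨆ i ∈ Set.Iic n, ⨆ v : Fin i → Fin m, ‖pderiv (cball m r) f v x‖ₑ / ‖x‖ₑ ^ k) x ⟨hx, hx0⟩)
  refine le_trans ?_ (le_iSup₂ (f := fun (i : ℕ) (_ : i ∈ Set.Iic n) =>
    ⨆ v : Fin i → Fin m, ‖pderiv (cball m r) f v x‖ₑ / ‖x‖ₑ ^ k) i hi)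
  exact le_iSup (fun v : Fin i → Fin m => ‖pderiv (cball m r) f v x‖ₑ / ‖x‖ₑ ^ k) v

theorem norm_iteratedFDerivWithin_le_of_flatNorm_le {m n k : ℕ} {r : Radius} {f : E m → ℂ} {A : ℝ}
    (hA : 0 ≤ A) (h : flatNorm n k r f ≤ ENNReal.ofReal A) {x : E m} (hx : x ∈ cball m r)
    (hx0 : x ≠ 0) {i : ℕ} (hi : i ≤ n) :
    ‖iteratedFDerivWithin ℝ i f (cball m r) x‖ ≤ m ^ i * (A * ‖x‖ ^ k) :=
  norm_multilinear_le_of_basis _ (by positivity)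
    fun v => norm_pderiv_le_of_flatNorm_le hA h hx hx0 hi v

theorem globalFlatNorm_le_ofReal {m n k : ℕ} {f : E m → ℂ} {A : ℝ}
    (h : ∀ x ≠ 0, ∀ i ≤ n, ∀ l ≤ k, ‖iteratedFDeriv ℝ i f x‖ ≤ A * ‖x‖ ^ l) :
    globalFlatNorm n k f ≤ ENNReal.ofReal A := by
  refine iSup₂_le fun x hx => iSup₂_le fun i hi => iSup_le fun v => iSup₂_le fun l hl => ?_
  refine enorm_div_pow_le_ofReal hx ((norm_multilinear_basis_le _ _).trans ?_)
  rw [iteratedFDerivWithin_univ]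
  exact h x hx i hi l hl

theorem norm_iteratedFDeriv_le_of_globalFlatNorm_le {m n k : ℕ} {f : E m → ℂ} {A : ℝ}
    (hA : 0 ≤ A) (h : globalFlatNorm n k f ≤ ENNReal.ofReal A) {x : E m}
    (hx0 : x ≠ 0) {i l : ℕ} (hi : i ≤ n) (hl : l ≤ k) :
    ‖iteratedFDeriv ℝ i f x‖ ≤ m ^ i * (A * ‖x‖ ^ l) := by
  refine norm_multilinear_le_of_basis _ (by positivity) fun v => ?_
  refine norm_le_of_enorm_div_pow_le hA hx0 (le_trans ?_ h)
  have e : iteratedFDeriv ℝ i f x (basisWord v) = pderiv Set.univ f v x := by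
    simp [pderiv, iteratedFDerivWithin_univ]
  rw [e]
  unfold globalFlatNorm
  refine le_trans ?_ (le_iSup₂ (f := fun (x : E m) (_ : x ∈ ({0}ᶜ : Set (E m))) =>
    ⨆ i ∈ Set.Iic n, ⨆ v : Fin i → Fin m, ⨆ l ∈ Set.Iic k,
      ‖pderiv Set.univ f v x‖ₑ / ‖x‖ₑ ^ l) x hx0)
  refine le_trans ?_ (le_iSup₂ (f := fun (i : ℕ) (_ : i ∈ Set.Iic n) =>
    ⨆ v : Fin i → Fin m, ⨆ l ∈ Set.Iic k, ‖pderiv Set.univ f v x‖ₑ / ‖x‖ₑ ^ l) i hi)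
  refine le_trans ?_ (le_iSup (fun v : Fin i → Fin m =>
    ⨆ l ∈ Set.Iic k, ‖pderiv Set.univ f v x‖ₑ / ‖x‖ₑ ^ l) v)
  exact le_iSup₂ (f := fun (l : ℕ) (_ : l ∈ Set.Iic k) =>
    ‖pderiv Set.univ f v x‖ₑ / ‖x‖ₑ ^ l) l hl

/-! ### Smooth functions flat at the origin -/

/-- Smooth functions all of whose derivatives vanish at the origin. -/
structure FlatSmooth {m : ℕ} (G : E m → ℂ) : Prop where
  smooth : ContDiff ℝ ∞ G
  flat : ∀ i, iteratedFDeriv ℝ i G 0 = 0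

theorem FlatSmooth.of_flatSchwartz {m : ℕ} (g : FlatSchwartz m) :
    FlatSmooth ((g : 𝓢(E m, ℂ)) : E m → ℂ) := by
  refine ⟨(g : 𝓢(E m, ℂ)).smooth ⊤, fun i => multilinear_eq_zero_of_basis _ fun v => ?_⟩
  have := g.2 i v
  rwa [pderiv, iteratedFDerivWithin_univ] at this

theorem iteratedFDerivWithin_eq_of_eqOn {m : ℕ} {r : Radius} {f G : E m → ℂ}
    (hG : ContDiff ℝ ∞ G) (h : Set.EqOn f G (cball m r)) {x : E m} (hx : x ∈ cball m r) (i : ℕ) :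
    iteratedFDerivWithin ℝ i f (cball m r) x = iteratedFDeriv ℝ i G x := by
  rw [iteratedFDerivWithin_congr h hx, iteratedFDerivWithin_eq_iteratedFDeriv
    (uniqueDiffOn_cball m r) (hG.contDiffAt.of_le (by exact_mod_cast le_top)) hx]

theorem FlatSmooth.indicator_mem {m : ℕ} {G : E m → ℂ} (hG : FlatSmooth G) (r : Radius) :
    (cball m r).indicator G ∈ FlatFun m r := by
  have he : Set.EqOn ((cball m r).indicator G) G (cball m r) := fun x hx =>
    Set.indicator_of_mem hx _
  refine ⟨hG.smooth.contDiffOn.congr he, fun i v => ?_, fun x hx => Set.indicator_of_notMem hx _⟩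
  rw [pderiv, iteratedFDerivWithin_eq_of_eqOn hG.smooth he (zero_mem_cball m r), hG.flat]
  rfl

/-- Mean value inequality on the ball of radius `‖x‖`: the lower derivative vanishes at the origin,
so integrating from there gains one power of `‖x‖`. -/
theorem FlatSmooth.norm_iteratedFDeriv_le_mul {m : ℕ} {G : E m → ℂ} (hG : FlatSmooth G) {R A : ℝ}
    (hA : 0 ≤ A) {i k : ℕ} (h : ∀ x : E m, ‖x‖ ≤ R → ‖iteratedFDeriv ℝ (i + 1) G x‖ ≤ A * ‖x‖ ^ k)
    {x : E m} (hx : ‖x‖ ≤ R) : ‖iteratedFDeriv ℝ i G x‖ ≤ A * ‖x‖ ^ (k + 1) := by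
  have hd : Differentiable ℝ (iteratedFDeriv ℝ i G) :=
    hG.smooth.differentiable_iteratedFDeriv (by exact_mod_cast WithTop.coe_lt_top _)
  have := (convex_closedBall (0 : E m) ‖x‖).norm_image_sub_le_of_norm_fderiv_le
    (f := iteratedFDeriv ℝ i G) (C := A * ‖x‖ ^ k) (x := 0) (y := x) (𝕜 := ℝ)
    (fun y _ => hd y) (fun y hy => ?_) (by simp) (by simp)
  · rw [hG.flat, sub_zero, sub_zero] at this
    rwa [pow_succ, ← mul_assoc]
  · rw [norm_fderiv_iteratedFDeriv]
    have hy' : ‖y‖ ≤ ‖x‖ := by simpa using hy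
    refine (h y (hy'.trans hx)).trans ?_
    gcongr

/-- Bounds for the highest derivative of a flat function yield bounds for the lower ones. -/
theorem FlatSmooth.norm_iteratedFDeriv_le {m : ℕ} {G : E m → ℂ} (hG : FlatSmooth G) {R A : ℝ}
    (hA : 0 ≤ A) {n k : ℕ} (h : ∀ x : E m, ‖x‖ ≤ R → ‖iteratedFDeriv ℝ n G x‖ ≤ A * ‖x‖ ^ k)
    {b : ℕ} (hb : b ≤ n) {x : E m} (hx : ‖x‖ ≤ R) :
    ‖iteratedFDeriv ℝ b G x‖ ≤ A * ‖x‖ ^ (k + (n - b)) := by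
  obtain ⟨d, rfl⟩ := Nat.exists_eq_add_of_le hb
  rw [Nat.add_sub_cancel_left]
  clear hb
  induction d generalizing k with
  | zero => simpa using h x hx
  | succ d ih =>
    have := ih (k := k + 1) (fun y hy => hG.norm_iteratedFDeriv_le_mul hA h hy)
    rwa [show k + (d + 1) = k + 1 + d by ring]

/-- A flat smooth function is bounded by every power of the distance from the origin. -/
theorem FlatSmooth.exists_norm_le {m : ℕ} {G : E m → ℂ} (hG : FlatSmooth G) (R : ℝ) (n k : ℕ) :
    ∃ A : ℝ, 0 ≤ A ∧ ∀ i ≤ n, ∀ x : E m, ‖x‖ ≤ R → ‖iteratedFDeriv ℝ i G x‖ ≤ A * ‖x‖ ^ k := by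
  have key : ∀ i, ∃ A : ℝ, 0 ≤ A ∧ ∀ x : E m, ‖x‖ ≤ R → ‖iteratedFDeriv ℝ i G x‖ ≤ A * ‖x‖ ^ k := by
    intro i
    -- Compactness bounds `k` further derivatives without weight; integrating them from the origin
    -- produces the factor `‖x‖ ^ k`.
    have hc : Continuous (iteratedFDeriv ℝ (i + k) G) :=
      hG.smooth.continuous_iteratedFDeriv (by exact_mod_cast le_top)
    obtain ⟨A, hA⟩ := (isCompact_closedBall (0 : E m) R).exists_bound_of_continuousOn hc.continuousOn
    refine ⟨max A 0, le_max_right _ _, fun x hx => ?_⟩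
    have := hG.norm_iteratedFDeriv_le (R := R) (le_max_right A 0) (n := i + k) (k := 0) (b := i)
      (fun y hy => by simpa using Or.inl (hA y (by simpa using hy))) (by omega) hx
    simpa using this
  choose A hA hA' using key
  refine ⟨∑ i ∈ Finset.range (n + 1), A i, Finset.sum_nonneg fun i _ => hA i, fun i hi x hx => ?_⟩
  refine (hA' i x hx).trans ?_
  gcongr
  exact Finset.single_le_sum (f := A) (fun i _ => hA i) (by simp; omega)

/-- A function which is smooth off the origin, with all derivatives vanishing to second order
at the origin, is smooth and flat. -/
theorem FlatSmooth.of_norm_le {m : ℕ} {F : E m → ℂ} (h0 : F 0 = 0)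
    (hs : ContDiffOn ℝ ∞ F {0}ᶜ)
    (hb : ∀ i, ∃ C : ℝ, ∀ x : E m, x ≠ 0 → ‖x‖ ≤ 1 → ‖iteratedFDeriv ℝ i F x‖ ≤ C * ‖x‖ ^ 2) :
    FlatSmooth F := by
  have hopen : IsOpen ({0}ᶜ : Set (E m)) := isOpen_compl_singleton
  -- Since `‖x‖ ^ 2` is `o(x)`, each derivative that vanishes at the origin is differentiable there
  -- with derivative zero. Hence the next one vanishes too, and the induction continues.
  have step : ∀ i, iteratedFDeriv ℝ i F 0 = 0 →
      HasFDerivAt (iteratedFDeriv ℝ i F) (0 : E m →L[ℝ] _) 0 := by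
    intro i hz
    obtain ⟨C, hC⟩ := hb i
    rw [hasFDerivAt_iff_isLittleO]
    have h1 : (fun x : E m => iteratedFDeriv ℝ i F x - iteratedFDeriv ℝ i F 0 -
        (0 : E m →L[ℝ] (E m) [×i]→L[ℝ] ℂ) (x - 0)) =O[nhds 0] fun x : E m => ‖x‖ ^ 2 := by
      refine Asymptotics.IsBigO.of_bound C ?_
      filter_upwards [Metric.closedBall_mem_nhds (0 : E m) one_pos] with x hx
      by_cases hx0 : x = 0
      · subst hx0; simp
      · simpa [hz] using hC x hx0 (by simpa using hx)
    have h2 : (fun x : E m => ‖x‖ ^ 2) =o[nhds 0] fun x : E m => x - 0 := by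
      have := Asymptotics.isLittleO_norm_pow_id (E' := E m) (n := 2) (by norm_num)
      simpa using this
    exact h1.trans_isLittleO h2
  have hd : ∀ i, iteratedFDeriv ℝ i F 0 = 0 := by
    intro i
    induction i with
    | zero =>
      ext v
      simp [h0]
    | succ i ih =>
      have := norm_fderiv_iteratedFDeriv (𝕜 := ℝ) (f := F) (n := i) (x := 0)
      rw [(step i ih).fderiv] at this
      exact norm_eq_zero.1 (this.symm.trans ContinuousLinearMap.opNorm_zero)
  refine ⟨contDiff_of_differentiable_iteratedFDeriv fun i _ x => ?_, hd⟩
  by_cases hx : x = 0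
  · rw [hx]
    exact (step i (hd i)).differentiableAt
  · exact (hs.contDiffAt (hopen.mem_nhds hx)).differentiableAt_iteratedFDeriv
      (by exact_mod_cast WithTop.coe_lt_top _)

/-! ### Dilations -/

/-- The dilation by `c`, as a continuous linear equivalence. -/
def dilationEquiv (m : ℕ) {c : ℝ} (hc : c ≠ 0) : E m ≃L[ℝ] E m :=
  ContinuousLinearEquiv.smulLeft (Units.mk0 c hc)

theorem dilationEquiv_apply {m : ℕ} {c : ℝ} (hc : c ≠ 0) (x : E m) :
    dilationEquiv m hc x = c • x := rfl

theorem smul_mem_cball_iff {m : ℕ} {c : ℝ} (hc : 0 < c) {r r' : Radius} (h : c * r' = r)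
    (x : E m) : c • x ∈ cball m r ↔ x ∈ cball m r' := by
  simp only [mem_closedBall_zero_iff, norm_smul, Real.norm_eq_abs, abs_of_pos hc, ← h]
  exact mul_le_mul_iff_right₀ hc

theorem pderiv_pullDilation {m : ℕ} {c : ℝ} (hc : 0 < c) {r r' : Radius} (h : c * r' = r)
    (f : E m → ℂ) {i : ℕ} (v : Fin i → Fin m) {x : E m} (hx : x ∈ cball m r') :
    pderiv (cball m r') (pullDilation c f) v x = (c : ℂ) ^ i * pderiv (cball m r) f v (c • x) := by
  have hset : dilationEquiv m hc.ne' ⁻¹' cball m r = cball m r' := by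
    ext x
    rw [Set.mem_preimage, dilationEquiv_apply, smul_mem_cball_iff hc h]
  have hcomp : pullDilation c f = f ∘ dilationEquiv m hc.ne' := rfl
  unfold pderiv
  rw [hcomp, ← hset, (dilationEquiv m hc.ne').iteratedFDerivWithin_comp_right _
    (uniqueDiffOn_cball m r) (by rwa [dilationEquiv_apply, smul_mem_cball_iff hc h])]
  rw [ContinuousMultilinearMap.compContinuousLinearMap_apply]
  have : (fun q => ((dilationEquiv m hc.ne' : E m ≃L[ℝ] E m) : E m →L[ℝ] E m)
      (EuclideanSpace.single (v q) (1 : ℝ))) =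
      fun q => c • EuclideanSpace.single (v q) (1 : ℝ) := rfl
  rw [this, ContinuousMultilinearMap.map_smul_univ]
  simp [dilationEquiv_apply]

/-- Pull back along a dilation, between spaces of flat functions on balls. -/
def dilate (m : ℕ) {c : ℝ} (hc : 0 < c) {r r' : Radius} (h : c * r' = r) :
    FlatFun m r →ₗ[ℂ] FlatFun m r' where
  toFun f := ⟨pullDilation c (f : E m → ℂ), by
    obtain ⟨hf, hf', hf''⟩ := f.2
    refine ⟨?_, fun i v => ?_, fun x hx => hf'' _ fun hx' => hx ((smul_mem_cball_iff hc h x).1 hx')⟩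
    · exact hf.comp (contDiff_const_smul c).contDiffOn fun x hx => (smul_mem_cball_iff hc h x).2 hx
    · rw [pderiv_pullDilation hc h _ _ (zero_mem_cball m r'), smul_zero, hf', mul_zero]⟩
  map_add' f g := rfl
  map_smul' a f := rfl

/-- The chain rule contributes `c ^ i` and the weight `c ^ k`. Replacing `c` by `max 1 c` makes the
factor uniform in `i ≤ n` while keeping it continuous in `c`. -/
theorem flatNorm_pullDilation_le {m : ℕ} {c : ℝ} (hc : 0 < c) {r r' : Radius} (h : c * r' = r)
    (f : E m → ℂ) {n k : ℕ} {A : ℝ} (hA : 0 ≤ A) (hf : flatNorm n k r f ≤ ENNReal.ofReal A) :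
    flatNorm n k r' (pullDilation c f) ≤ ENNReal.ofReal (max 1 c ^ (n + k) * A) := by
  refine iSup₂_le fun x hx => iSup₂_le fun i hi => iSup_le fun v => ?_
  refine enorm_div_pow_le_ofReal hx.2 ?_
  rw [pderiv_pullDilation hc h _ _ hx.1, norm_mul, norm_pow, Complex.norm_real, Real.norm_eq_abs,
    abs_of_pos hc]
  have h1 := norm_pderiv_le_of_flatNorm_le hA hf ((smul_mem_cball_iff hc h x).2 hx.1)
    (smul_ne_zero hc.ne' hx.2) hi v
  rw [norm_smul, Real.norm_eq_abs, abs_of_pos hc, mul_pow] at h1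
  have h2 : c ^ i ≤ max 1 c ^ n := (pow_le_pow_left₀ hc.le (le_max_right 1 c) i).trans
    (pow_le_pow_right₀ (le_max_left 1 c) hi)
  have h3 : c ^ k ≤ max 1 c ^ k := pow_le_pow_left₀ hc.le (le_max_right 1 c) k
  calc _ ≤ c ^ i * (A * (c ^ k * ‖x‖ ^ k)) := by gcongr
    _ ≤ max 1 c ^ n * (A * (max 1 c ^ k * ‖x‖ ^ k)) := by gcongr
    _ = _ := by rw [pow_add]; ring

theorem norm_iteratedFDeriv_comp_smul_le {m : ℕ} {V : Type*} [NormedAddCommGroup V]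
    [NormedSpace ℝ V] (G : E m → V) {c : ℝ} (hc : 0 < c) (i : ℕ) (x : E m) :
    ‖iteratedFDeriv ℝ i (fun z => G (c • z)) x‖ ≤ c ^ i * ‖iteratedFDeriv ℝ i G (c • x)‖ := by
  have : (fun z => G (c • z)) = G ∘ dilationEquiv m hc.ne' := rfl
  rw [this, ← iteratedFDerivWithin_univ, ← Set.preimage_univ (f := dilationEquiv m hc.ne'),
    (dilationEquiv m hc.ne').iteratedFDerivWithin_comp_right _ uniqueDiffOn_univ (Set.mem_univ _),
    iteratedFDerivWithin_univ, dilationEquiv_apply]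
  refine (ContinuousMultilinearMap.norm_compContinuousLinearMap_le _ _).trans ?_
  rw [mul_comm, Finset.prod_const, Finset.card_univ, Fintype.card_fin]
  gcongr
  refine ContinuousLinearMap.opNorm_le_bound _ hc.le fun z => ?_
  change ‖c • z‖ ≤ _
  rw [norm_smul, Real.norm_eq_abs, abs_of_pos hc]

/-! ### The inversion exchanges flatness at the origin and decay at infinity -/

section Inversion

variable {m : ℕ}

theorem norm_inversion (x : E m) : ‖inversion x‖ = ‖x‖⁻¹ := by
  rw [inversion, norm_smul, norm_inv, norm_pow, norm_norm]
  by_cases h : ‖x‖ = 0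
  · simp [h]
  · field_simp

theorem inversion_ne_zero {x : E m} (hx : x ≠ 0) : inversion x ≠ 0 := by
  rw [← norm_pos_iff, norm_inversion]
  exact inv_pos.2 (norm_pos_iff.2 hx)

theorem inversion_inversion {x : E m} (hx : x ≠ 0) : inversion (inversion x) = x := by
  have : ‖x‖ ≠ 0 := norm_ne_zero_iff.2 hx
  rw [inversion, norm_inversion, inversion, smul_smul]
  field_simp
  simp

theorem inversion_smul (c : ℝ) (x : E m) : inversion (c • x) = c⁻¹ • inversion x := by
  simp only [inversion, norm_smul, smul_smul, Real.norm_eq_abs, mul_pow, sq_abs]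
  congr 1
  by_cases hc : c = 0
  · simp [hc]
  · field_simp

theorem contDiffOn_inversion : ContDiffOn ℝ ∞ (inversion (m := m)) {0}ᶜ := by
  refine ContDiffOn.smul (ContDiffOn.inv (contDiff_norm_sq ℝ).contDiffOn fun x hx => ?_)
    contDiffOn_id
  exact pow_ne_zero 2 (norm_ne_zero_iff.2 hx)

theorem pullInversion_of_ne {g : E m → ℂ} {x : E m} (hx : x ≠ 0) :
    pullInversion g x = g (inversion x) := if_neg hx

theorem pullInversion_pullInversion {g : E m → ℂ} {x : E m} (hx : x ≠ 0) :
    pullInversion (pullInversion g) x = g x := by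
  rw [pullInversion_of_ne hx, pullInversion_of_ne (inversion_ne_zero hx), inversion_inversion hx]

theorem contDiffOn_pullInversion {G : E m → ℂ} (hG : ContDiff ℝ ∞ G) :
    ContDiffOn ℝ ∞ (pullInversion G) {0}ᶜ :=
  (hG.comp_contDiffOn contDiffOn_inversion).congr fun _ hx => pullInversion_of_ne hx

/-- The inversion is homogeneous of degree `-1`, so its derivatives are determined by their values
on the compact unit sphere. The normalization `1 ≤ C` lets `C` be bounded by its powers later. -/
theorem exists_norm_iteratedFDeriv_inversion_le (m n : ℕ) :
    ∃ C : ℝ, 1 ≤ C ∧ ∀ i ≤ n, ∀ y : E m, y ≠ 0 →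
      ‖iteratedFDeriv ℝ i inversion y‖ ≤ C * ‖y‖⁻¹ ^ (i + 1) := by
  have hopen : IsOpen ({0}ᶜ : Set (E m)) := isOpen_compl_singleton
  have key : ∀ i, ∃ C : ℝ, 0 ≤ C ∧ ∀ y : E m, y ≠ 0 →
      ‖iteratedFDeriv ℝ i inversion y‖ ≤ C * ‖y‖⁻¹ ^ (i + 1) := by
    intro i
    have hsub : Metric.sphere (0 : E m) 1 ⊆ {0}ᶜ := fun x hx h => by
      rw [Set.mem_singleton_iff] at h
      simp [h] at hx
    have hc : ContinuousOn (iteratedFDeriv ℝ i (inversion (m := m))) (Metric.sphere 0 1) := by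
      intro x hx
      exact (((contDiffOn_inversion.contDiffAt (hopen.mem_nhds (hsub hx))).iteratedFDeriv_right
        (i := i) (m := 0) (by exact_mod_cast le_top)).continuousAt).continuousWithinAt
    obtain ⟨C, hC⟩ := (isCompact_sphere (0 : E m) 1).exists_bound_of_continuousOn hc
    refine ⟨max C 0, le_max_right _ _, fun y hy => ?_⟩
    have hy' : 0 < ‖y‖ := norm_pos_iff.2 hy
    have hy'' : 0 < ‖y‖⁻¹ := inv_pos.2 hy'
    have hmem : ‖y‖⁻¹ • y ∈ Metric.sphere (0 : E m) 1 := by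
      simp [norm_smul, hy'.ne']
    have e : (inversion : E m → E m) = ‖y‖⁻¹ • fun z => inversion (‖y‖⁻¹ • z) := by
      ext1 z
      simp only [Pi.smul_apply, inversion_smul, smul_smul]
      rw [mul_inv_cancel₀ hy''.ne', one_smul]
    have hcd : ContDiffAt ℝ i (fun z : E m => inversion (‖y‖⁻¹ • z)) y := by
      refine ContDiffAt.comp (g := inversion) y ?_ (contDiff_const_smul ‖y‖⁻¹).contDiffAt
      exact (contDiffOn_inversion.contDiffAt (hopen.mem_nhds (hsub hmem))).of_le
        (by exact_mod_cast le_top)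
    rw [e, iteratedFDeriv_const_smul_apply hcd, norm_smul, norm_inv, norm_norm]
    calc _ ≤ ‖y‖⁻¹ * (‖y‖⁻¹ ^ i * max C 0) := by
          gcongr
          refine (norm_iteratedFDeriv_comp_smul_le _ hy'' i y).trans ?_
          gcongr
          exact (hC _ hmem).trans (le_max_left _ _)
      _ = _ := by ring
  choose C hC hC' using key
  refine ⟨1 + ∑ i ∈ Finset.range (n + 1), C i,
    le_add_of_nonneg_right (Finset.sum_nonneg fun i _ => hC i), fun i hi y hy => ?_⟩
  refine (hC' i y hy).trans ?_
  gcongr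
  have := Finset.single_le_sum (f := C) (s := Finset.range (n + 1)) (fun i _ => hC i)
    (show i ∈ _ by simp; omega)
  linarith

/-- The derivatives of the pull back of a function along the inversion. -/
theorem exists_norm_iteratedFDeriv_pullInversion_le (m n : ℕ) :
    ∃ C : ℝ, 0 ≤ C ∧ ∀ a ≤ n, ∀ G : E m → ℂ, ContDiff ℝ ∞ G → ∀ y : E m, y ≠ 0 → ∀ B : ℝ,
      (∀ b ≤ a, ‖y‖⁻¹ ^ b * ‖iteratedFDeriv ℝ b G (inversion y)‖ ≤ B) →
      ‖iteratedFDeriv ℝ a (pullInversion G) y‖ ≤ C * ‖y‖⁻¹ ^ a * B := by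
  obtain ⟨C, hC1, hC⟩ := exists_norm_iteratedFDeriv_inversion_le m n
  have hopen : IsOpen ({0}ᶜ : Set (E m)) := isOpen_compl_singleton
  refine ⟨n.factorial * C ^ n, by positivity, fun a ha G hG y hy B hB => ?_⟩
  have hy' : 0 < ‖y‖ := norm_pos_iff.2 hy
  have hy'' : 0 < ‖y‖⁻¹ := inv_pos.2 hy'
  have hB0 : 0 ≤ B := le_trans (by positivity) (hB 0 (Nat.zero_le _))
  -- The point `y` is fixed, and the inversion is rescaled by `‖y‖`. The inner map then has
  -- derivatives of order `i ≥ 1` bounded by `(C * ‖y‖⁻¹) ^ i`, the geometric form that the estimate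
  -- for composed functions requires; the outer map carries the weights in the definition of `B`.
  have e : Set.EqOn (pullInversion G)
      ((fun z => G (‖y‖⁻¹ • z)) ∘ (‖y‖ • inversion)) {0}ᶜ := fun z hz => by
    rw [pullInversion_of_ne hz, Function.comp_apply, Pi.smul_apply, smul_smul,
      inv_mul_cancel₀ hy'.ne', one_smul]
  have hG' : ContDiff ℝ ∞ fun z : E m => G (‖y‖⁻¹ • z) := hG.comp (contDiff_const_smul _)
  rw [← iteratedFDerivWithin_of_isOpen a hopen hy, iteratedFDerivWithin_congr e hy]
  have hpt : ‖y‖⁻¹ • ((‖y‖ • inversion) y) = inversion y := by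
    rw [Pi.smul_apply, smul_smul, inv_mul_cancel₀ hy'.ne', one_smul]
  have := norm_iteratedFDerivWithin_comp_le (𝕜 := ℝ) (n := a) (N := ∞) (t := Set.univ)
    (s := {0}ᶜ) (x := y) (C := B) (D := C * ‖y‖⁻¹) hG'.contDiffOn
    (contDiffOn_inversion.const_smul ‖y‖) (by exact_mod_cast le_top) uniqueDiffOn_univ
    hopen.uniqueDiffOn (Set.mapsTo_univ _ _) hy ?_ ?_
  · refine this.trans ?_
    rw [mul_pow]
    have h1 : (a.factorial : ℝ) ≤ n.factorial := by exact_mod_cast Nat.factorial_le ha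
    have h2 : C ^ a ≤ C ^ n := pow_le_pow_right₀ hC1 ha
    calc _ = a.factorial * C ^ a * ‖y‖⁻¹ ^ a * B := by ring
      _ ≤ _ := by gcongr
  · intro i hi
    rw [iteratedFDerivWithin_univ]
    refine (norm_iteratedFDeriv_comp_smul_le _ hy'' i _).trans ?_
    exact (congrArg (fun z => ‖y‖⁻¹ ^ i * ‖iteratedFDeriv ℝ i G z‖) hpt).le.trans (hB i hi)
  · intro i hi1 hi
    rw [iteratedFDerivWithin_of_isOpen i hopen hy, iteratedFDeriv_const_smul_apply'
      ((contDiffOn_inversion.contDiffAt (hopen.mem_nhds hy)).of_le (by exact_mod_cast le_top)),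
      norm_smul, norm_norm]
    calc _ ≤ ‖y‖ * (C * ‖y‖⁻¹ ^ (i + 1)) := by
          gcongr
          exact hC i (hi.trans ha) y hy
      _ = C * ‖y‖⁻¹ ^ i := by
          rw [pow_succ]
          field_simp
      _ ≤ C ^ i * ‖y‖⁻¹ ^ i := by
          gcongr
          exact le_self_pow₀ hC1 (by omega)
      _ = _ := (mul_pow _ _ _).symm

theorem flatSmooth_pullInversion (g : 𝓢(E m, ℂ)) : FlatSmooth (pullInversion g) := by
  refine FlatSmooth.of_norm_le (if_pos rfl) (contDiffOn_pullInversion (g.smooth ⊤)) fun i => ?_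
  obtain ⟨C, hC0, hC⟩ := exists_norm_iteratedFDeriv_pullInversion_le m i
  -- Of these powers of decay, at most `i` compensate the factor `‖x‖⁻¹ ^ b`, another `i` the factor
  -- `‖x‖⁻¹ ^ i` from the chain rule, and two remain.
  choose S hS using fun b => g.decay (2 * i + 2) b
  set T := ∑ b ∈ Finset.range (i + 1), S b with hT
  refine ⟨C * T, fun x hx hx1 => ?_⟩
  have hx' : 0 < ‖x‖ := norm_pos_iff.2 hx
  have := hC i le_rfl g (g.smooth ⊤) x hx (T * ‖x‖ ^ (i + 2)) fun b hb => ?_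
  · refine this.trans (le_of_eq ?_)
    rw [pow_add, inv_pow]
    field_simp
  · have h1 := (hS b).2 (inversion x)
    rw [norm_inversion, inv_pow, inv_mul_le_iff₀ (by positivity)] at h1
    have hTb : S b ≤ T := Finset.single_le_sum (f := S) (fun b _ => (hS b).1.le)
      (by simp; omega)
    calc _ ≤ ‖x‖⁻¹ ^ b * (‖x‖ ^ (2 * i + 2) * T) := by
          gcongr
          exact h1.trans (by gcongr)
      _ = T * ‖x‖ ^ (i + 2 + (i - b)) := by
          rw [show 2 * i + 2 = b + (i + 2 + (i - b)) by omega, pow_add ‖x‖ b, inv_pow]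
          field_simp
      _ ≤ _ := by
          gcongr ?_ * ?_
          · exact Finset.sum_nonneg fun b _ => (hS b).1.le
          · exact pow_le_pow_of_le_one hx'.le hx1 (by omega)

/-- Near the origin the pull back is bounded by smoothness; far away, the bound by `‖x‖ ^ k` near
the origin becomes decay of order `k` under the inversion. -/
theorem exists_decay_pullInversion {g : E m → ℂ} (hg : FlatSmooth g) (hρ : FlatSmooth (pullInversion g))
    (k n : ℕ) : ∃ C, ∀ y, ‖y‖ ^ k * ‖iteratedFDeriv ℝ n (pullInversion g) y‖ ≤ C := by
  obtain ⟨C, hC0, hC⟩ := exists_norm_iteratedFDeriv_pullInversion_le m n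
  obtain ⟨A, hA0, hA⟩ := hg.exists_norm_le 1 n k
  obtain ⟨D, hD0, hD⟩ := hρ.exists_norm_le 1 n 0
  refine ⟨D + C * A, fun y => ?_⟩
  rcases le_total ‖y‖ 1 with hy | hy
  · have := hD n le_rfl y hy
    rw [pow_zero, mul_one] at this
    calc _ ≤ 1 * D := by
          gcongr
          exact pow_le_one₀ (norm_nonneg _) hy
      _ ≤ _ := by linarith [mul_nonneg hC0 hA0]
  · have hy' : 0 < ‖y‖ := by linarith
    have hi1 : ‖y‖⁻¹ ≤ 1 := inv_le_one_of_one_le₀ hy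
    have := hC n le_rfl g hg.smooth y (norm_pos_iff.1 hy') (A * ‖y‖⁻¹ ^ k) fun b hb => ?_
    · calc _ ≤ ‖y‖ ^ k * (C * ‖y‖⁻¹ ^ n * (A * ‖y‖⁻¹ ^ k)) := by gcongr
        _ ≤ ‖y‖ ^ k * (C * 1 * (A * ‖y‖⁻¹ ^ k)) := by
            gcongr
            exact pow_le_one₀ (by positivity) hi1
        _ = C * A := by
          rw [inv_pow]
          field_simp
        _ ≤ _ := by linarith
    · have h1 := hA b hb (inversion y) (by rw [norm_inversion]; exact hi1)
      rw [norm_inversion] at h1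
      calc _ ≤ 1 * (A * ‖y‖⁻¹ ^ k) := by
            gcongr
            exact pow_le_one₀ (by positivity) hi1
        _ = _ := one_mul _

/-- The pull back of a flat Schwartz function along the inversion, as a Schwartz function. -/
def schwartzInversion (g : FlatSchwartz m) : 𝓢(E m, ℂ) where
  toFun := pullInversion (g : 𝓢(E m, ℂ))
  smooth' := (flatSmooth_pullInversion _).smooth
  decay' := exists_decay_pullInversion (FlatSmooth.of_flatSchwartz g) (flatSmooth_pullInversion _)

theorem coe_schwartzInversion (g : FlatSchwartz m) :
    (schwartzInversion g : E m → ℂ) = pullInversion (g : 𝓢(E m, ℂ)) := rfl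

/-- Weighted bounds at the origin become weighted bounds at infinity. -/
theorem exists_weighted_pullInversion_le (m n k : ℕ) {R : ℝ} (hR : 0 < R) :
    ∃ C : ℝ, 0 ≤ C ∧ ∀ g : E m → ℂ, FlatSmooth g → (∀ x, R < ‖x‖ → g x = 0) → ∀ A : ℝ, 0 ≤ A →
      (∀ a ≤ n, ∀ x, ‖iteratedFDeriv ℝ a g x‖ ≤ A * ‖x‖ ^ k) →
      ∀ a ≤ n, ∀ y, (1 + ‖y‖) ^ (k + n + a) * ‖iteratedFDeriv ℝ a (pullInversion g) y‖ ≤ C * A := by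
  obtain ⟨C, hC0, hC⟩ := exists_norm_iteratedFDeriv_pullInversion_le m n
  refine ⟨C * (1 + R) ^ (k + n + n), by positivity, fun g hg hs A hA hb a ha y => ?_⟩
  -- The support condition makes the pull back vanish near the origin. On the rest `1 + ‖y‖` is
  -- comparable to `‖y‖`.
  rcases lt_or_ge ‖y‖ R⁻¹ with hy | hy
  · have : pullInversion g =ᶠ[nhds y] fun _ => 0 := by
      filter_upwards [(isOpen_lt continuous_norm continuous_const).mem_nhds hy] with z hz
      by_cases hz0 : z = 0
      · exact if_pos hz0
      · rw [pullInversion_of_ne hz0]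
        refine hs _ ?_
        rw [norm_inversion]
        exact (lt_inv_comm₀ (norm_pos_iff.2 hz0) hR).1 hz
    rw [(this.iteratedFDeriv ℝ a).self_of_nhds]
    have : iteratedFDeriv ℝ a (fun _ : E m => (0 : ℂ)) y = 0 := by
      simp
    rw [this, norm_zero, mul_zero]
    positivity
  · have hy' : 0 < ‖y‖ := (inv_pos.2 hR).trans_le hy
    have h1R : 1 + ‖y‖ ≤ (1 + R) * ‖y‖ := by
      have : 1 ≤ R * ‖y‖ := by
        rw [inv_le_iff_one_le_mul₀ hR] at hy
        linarith
      linarith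
    have := hC a ha g hg.smooth y (norm_pos_iff.1 hy') (A * ‖y‖⁻¹ ^ (k + n)) fun b hb' => ?_
    · calc _ ≤ ((1 + R) * ‖y‖) ^ (k + n + a) * (C * ‖y‖⁻¹ ^ a * (A * ‖y‖⁻¹ ^ (k + n))) := by gcongr
        _ = (1 + R) ^ (k + n + a) * C * A := by
            rw [mul_pow, pow_add ‖y‖ (k + n) a, inv_pow, inv_pow]
            field_simp
        _ ≤ (1 + R) ^ (k + n + n) * C * A := by
            gcongr
            linarith
        _ = _ := by ring
    · have h1 := hg.norm_iteratedFDeriv_le (R := ‖inversion y‖) hA (n := n) (k := k)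
        (fun x _ => hb n le_rfl x) (hb'.trans ha) le_rfl
      rw [norm_inversion] at h1
      calc _ ≤ ‖y‖⁻¹ ^ b * (A * ‖y‖⁻¹ ^ (k + (n - b))) := by gcongr
        _ = _ := by
          rw [show k + n = b + (k + (n - b)) by omega, pow_add _ b]
          ring

/-- Weighted bounds at infinity become weighted bounds at the origin. -/
theorem exists_pullInversion_weighted_le (m n k : ℕ) :
    ∃ C : ℝ, 0 ≤ C ∧ ∀ F : E m → ℂ, ContDiff ℝ ∞ F → ∀ A : ℝ, 0 ≤ A →
      (∀ a ≤ n, ∀ y, (1 + ‖y‖) ^ (k + n + a) * ‖iteratedFDeriv ℝ a F y‖ ≤ A) →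
      ∀ a ≤ n, ∀ x ≠ 0,
        ‖iteratedFDeriv ℝ a (pullInversion F) x‖ ≤ C * A * ‖x‖ ^ (k + (n - a)) := by
  obtain ⟨C, hC0, hC⟩ := exists_norm_iteratedFDeriv_pullInversion_le m n
  refine ⟨C, hC0, fun F hF A hA hb a ha x hx => ?_⟩
  have hx' : 0 < ‖x‖ := norm_pos_iff.2 hx
  have := hC a ha F hF x hx (A * ‖x‖ ^ (k + n)) fun b hb' => ?_
  · refine this.trans (le_of_eq ?_)
    rw [show k + n = a + (k + (n - a)) by omega, pow_add _ a, inv_pow]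
    field_simp
  · have h1 := hb b (hb'.trans ha) (inversion x)
    rw [norm_inversion] at h1
    have h2 : ‖x‖⁻¹ ^ (k + n + b) * ‖iteratedFDeriv ℝ b F (inversion x)‖ ≤ A :=
      le_trans (by gcongr; linarith) h1
    rw [inv_pow, inv_mul_le_iff₀ (by positivity)] at h2
    calc _ ≤ ‖x‖⁻¹ ^ b * (‖x‖ ^ (k + n + b) * A) := by gcongr
      _ = _ := by
        rw [pow_add _ (k + n), inv_pow]
        field_simp

end Inversion

/-! ### Convolution with dilated Schwartz kernels in weighted norms -/

section Convolution

open MeasureTheory LineDeriv FourierTransform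

variable {m : ℕ}

/-- The convolution of Schwartz functions on `ℝ^m`. -/
abbrev conv (k g : 𝓢(E m, ℂ)) : 𝓢(E m, ℂ) :=
  SchwartzMap.convolution (ContinuousLinearMap.mul ℂ ℂ) k g

theorem conv_apply (k g : 𝓢(E m, ℂ)) (x : E m) : conv k g x = ∫ z, k z * g (x - z) := by
  rw [conv, SchwartzMap.convolution_apply, MeasureTheory.convolution_def]
  rfl

theorem conv_smul_left (c : ℂ) (k g : 𝓢(E m, ℂ)) : conv (c • k) g = c • conv k g := by
  rw [conv, LinearMap.map_smul]
  rfl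

theorem fourier_conv (k g : 𝓢(E m, ℂ)) (ξ : E m) : 𝓕 (conv k g) ξ = 𝓕 k ξ * 𝓕 g ξ := by
  rw [conv, SchwartzMap.fourier_convolution, SchwartzMap.pairing_apply_apply]
  rfl

theorem schwartz_fourier_injective {f g : 𝓢(E m, ℂ)} (h : ∀ ξ, 𝓕 f ξ = 𝓕 g ξ) : f = g := by
  have : 𝓕 f = 𝓕 g := SchwartzMap.ext h
  rw [← FourierTransform.fourierInv_fourier_eq (F := 𝓢(E m, ℂ)) f, this,
    FourierTransform.fourierInv_fourier_eq]

theorem fourier_lineDeriv_apply (f : 𝓢(E m, ℂ)) (v ξ : E m) :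
    𝓕 (∂_{v} f) ξ = (2 * Real.pi * Complex.I) * ((inner ℝ ξ v : ℝ) * 𝓕 f ξ) := by
  have h : (fun x : E m => inner ℝ x v).HasTemperateGrowth := ((innerSL ℝ).flip v).hasTemperateGrowth
  rw [SchwartzMap.fourier_lineDerivOp_eq]
  change (2 * Real.pi * Complex.I) • (SchwartzMap.smulLeftCLM ℂ (inner ℝ · v) (𝓕 f)) ξ = _
  rw [SchwartzMap.smulLeftCLM_apply_apply h]
  simp

/-- Under the Fourier transform both operations become multiplications, which commute. The same
reason lets the derivative fall on the left factor. -/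
theorem lineDeriv_conv_right (k g : 𝓢(E m, ℂ)) (v : E m) : ∂_{v} (conv k g) = conv k (∂_{v} g) := by
  refine schwartz_fourier_injective fun ξ => ?_
  rw [fourier_lineDeriv_apply, fourier_conv, fourier_conv, fourier_lineDeriv_apply]
  ring

theorem lineDeriv_conv_left (k g : 𝓢(E m, ℂ)) (v : E m) : ∂_{v} (conv k g) = conv (∂_{v} k) g := by
  refine schwartz_fourier_injective fun ξ => ?_
  rw [fourier_lineDeriv_apply, fourier_conv, fourier_conv, fourier_lineDeriv_apply]
  ring

theorem iteratedLineDeriv_conv_right (k g : 𝓢(E m, ℂ)) {n : ℕ} (w : Fin n → E m) :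
    ∂^{w} (conv k g) = conv k (∂^{w} g) := by
  induction n with
  | zero => rfl
  | succ n ih =>
    rw [iteratedLineDerivOp_succ_left, ih, lineDeriv_conv_right, ← iteratedLineDerivOp_succ_left]

theorem iteratedLineDeriv_conv (k g : 𝓢(E m, ℂ)) {n i : ℕ} (w : Fin (n + i) → E m) :
    ∂^{w} (conv k g) = conv (∂^{w ∘ Fin.natAdd n} k) (∂^{w ∘ Fin.castAdd i} g) := by
  induction i generalizing k with
  | zero => exact iteratedLineDeriv_conv_right k g w
  | succ i ih =>
    rw [iteratedLineDerivOp_succ_right (n := n + i), lineDeriv_conv_left, ih,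
      iteratedLineDerivOp_succ_right (w ∘ Fin.natAdd n)]
    rfl

theorem norm_iteratedFDeriv_lineDeriv_le (g : 𝓢(E m, ℂ)) (v : E m) (l : ℕ) (y : E m) :
    ‖iteratedFDeriv ℝ l (∂_{v} g : 𝓢(E m, ℂ)) y‖ ≤ ‖v‖ * ‖iteratedFDeriv ℝ (l + 1) g y‖ := by
  have e : ((∂_{v} g : 𝓢(E m, ℂ)) : E m → ℂ) = fun y => fderiv ℝ g y v := by
    ext y
    exact SchwartzMap.lineDerivOp_apply_eq_fderiv v g y
  rw [e, ← norm_iteratedFDeriv_fderiv]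
  exact norm_iteratedFDeriv_clm_apply_const (N := ∞)
    ((g.smooth ⊤).fderiv_right (m := ∞) (by exact_mod_cast le_top)).contDiffAt
    (by exact_mod_cast le_top)

theorem norm_iteratedFDeriv_iteratedLineDeriv_le (g : 𝓢(E m, ℂ)) {a : ℕ} (c : Fin a → Fin m)
    (l : ℕ) (y : E m) :
    ‖iteratedFDeriv ℝ l (∂^{basisWord c} g : 𝓢(E m, ℂ)) y‖ ≤ ‖iteratedFDeriv ℝ (l + a) g y‖ := by
  induction a generalizing l with
  | zero => exact le_rfl
  | succ a ih =>
    rw [iteratedLineDerivOp_succ_left]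
    refine (norm_iteratedFDeriv_lineDeriv_le _ _ _ _).trans ?_
    simp only [PiLp.norm_single, norm_one, one_mul]
    refine (ih (Fin.tail c) (l + 1)).trans (le_of_eq ?_)
    rw [add_assoc, add_comm 1 a]

/-- The weighted `L¹` norms of the derivatives of a Schwartz function. -/
def weightedIntegral (k : 𝓢(E m, ℂ)) (q i : ℕ) : ℝ :=
  ∫ z, (1 + ‖z‖) ^ q * ‖iteratedFDeriv ℝ i k z‖

theorem integrable_weighted (k : 𝓢(E m, ℂ)) (q i : ℕ) :
    Integrable fun z : E m => (1 + ‖z‖) ^ q * ‖iteratedFDeriv ℝ i k z‖ := by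
  have : (fun z : E m => (1 + ‖z‖) ^ q * ‖iteratedFDeriv ℝ i k z‖) = fun z =>
      ∑ j ∈ Finset.range (q + 1), (q.choose j : ℝ) * (‖z‖ ^ j * ‖iteratedFDeriv ℝ i k z‖) := by
    ext z
    rw [add_comm, add_pow, Finset.sum_mul]
    refine Finset.sum_congr rfl fun j _ => ?_
    rw [one_pow]
    ring
  rw [this]
  exact integrable_finsetSum _ fun j _ => (k.integrable_pow_mul_iteratedFDeriv volume j i).const_mul _

theorem weightedIntegral_nonneg (k : 𝓢(E m, ℂ)) (q i : ℕ) : 0 ≤ weightedIntegral k q i :=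
  integral_nonneg fun z => by positivity

/-- The `L¹`-normalized dilation `t^m k(t x)` of a Schwartz function. -/
def dilatedKernel (k : 𝓢(E m, ℂ)) {t : ℝ} (ht : 0 < t) : 𝓢(E m, ℂ) :=
  ((t ^ m : ℝ) : ℂ) • SchwartzMap.compCLMOfContinuousLinearEquiv ℂ (dilationEquiv m ht.ne') k

theorem dilatedKernel_apply (k : 𝓢(E m, ℂ)) {t : ℝ} (ht : 0 < t) (x : E m) :
    dilatedKernel k ht x = ((t ^ m : ℝ) : ℂ) * k (t • x) := rfl

theorem iteratedLineDeriv_dilatedKernel (k : 𝓢(E m, ℂ)) {t : ℝ} (ht : 0 < t) {i : ℕ}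
    (w : Fin i → E m) :
    ∂^{w} (dilatedKernel k ht) = ((t ^ i : ℝ) : ℂ) • dilatedKernel (∂^{w} k) ht := by
  induction i with
  | zero => simp
  | succ i ih =>
    rw [iteratedLineDerivOp_succ_left, ih, iteratedLineDerivOp_succ_left]
    rw [lineDerivOp_smul, dilatedKernel, dilatedKernel, lineDerivOp_smul,
      SchwartzMap.lineDerivOp_compCLMOfContinuousLinearEquiv, dilationEquiv_apply,
      lineDerivOp_left_smul]
    ext x
    change ((t ^ i : ℝ) : ℂ) * (((t ^ m : ℝ) : ℂ) * (t • (∂_{w 0} (∂^{Fin.tail w} k) :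
      𝓢(E m, ℂ)) _)) = ((t ^ (i + 1) : ℝ) : ℂ) * (((t ^ m : ℝ) : ℂ) * _)
    rw [Complex.real_smul]
    push_cast
    rw [pow_succ]
    ring_nf
    rfl

theorem integral_dilated {V : Type*} [NormedAddCommGroup V] [NormedSpace ℝ V] (G : E m → V) {t : ℝ}
    (ht : 0 < t) : t ^ m • ∫ z, G (t • z) = ∫ z, G z := by
  rw [MeasureTheory.Measure.integral_comp_smul_of_nonneg volume G t (hR := ht.le), smul_smul]
  simp [ht.ne']

/-- The weight is submultiplicative. Under a convolution it is therefore shared between the kernel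
and the function. -/
theorem one_add_norm_pow_le (q : ℕ) (x z : E m) :
    (1 + ‖x‖) ^ q ≤ (1 + ‖z‖) ^ q * (1 + ‖x - z‖) ^ q := by
  rw [← mul_pow]
  refine pow_le_pow_left₀ (by positivity) ?_ q
  have : ‖x‖ ≤ ‖z‖ + ‖x - z‖ := by
    simpa using norm_add_le z (x - z)
  nlinarith [mul_nonneg (norm_nonneg z) (norm_nonneg (x - z))]

/-- Weighted bound for the convolution with a dilated kernel. -/
theorem weighted_norm_conv_le (k g : 𝓢(E m, ℂ)) {t : ℝ} (ht : 1 ≤ t) {q : ℕ} {A : ℝ}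
    (hg : ∀ y, (1 + ‖y‖) ^ q * ‖g y‖ ≤ A) (x : E m) :
    (1 + ‖x‖) ^ q * ‖conv (dilatedKernel k (one_pos.trans_le ht)) g x‖
      ≤ (∫ z, (1 + ‖z‖) ^ q * ‖k z‖) * A := by
  have ht0 := one_pos.trans_le ht
  have hA : 0 ≤ A := le_trans (by positivity) (hg 0)
  have hint : Integrable fun z : E m => (1 + ‖z‖) ^ q * ‖k z‖ := by
    simpa using integrable_weighted k q 0
  have hint' : Integrable fun z : E m => (1 + ‖t • z‖) ^ q * ‖k (t • z)‖ :=
    hint.comp_smul ht0.ne'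
  rw [conv_apply]
  calc _ ≤ (1 + ‖x‖) ^ q * ∫ z, ((1 + ‖x‖) ^ q)⁻¹ *
        (t ^ m * ((1 + ‖t • z‖) ^ q * ‖k (t • z)‖) * A) := by
        gcongr
        refine norm_integral_le_of_norm_le (((hint'.const_mul _).mul_const _).const_mul _)
          (Filter.Eventually.of_forall fun z => ?_)
        rw [dilatedKernel_apply, norm_mul, norm_mul, Complex.norm_real, Real.norm_eq_abs,
          abs_of_pos (pow_pos ht0 m), inv_mul_eq_div, le_div_iff₀ (by positivity)]
        have h1 := one_add_norm_pow_le q x z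
        -- Here `1 ≤ t` is essential: the weight is absorbed by the undilated kernel, with a
        -- constant independent of `t`.
        have h2 : (1 + ‖z‖) ^ q ≤ (1 + ‖t • z‖) ^ q := by
          gcongr
          rw [norm_smul, Real.norm_eq_abs, abs_of_pos ht0]
          exact le_mul_of_one_le_left (norm_nonneg _) ht
        calc _ ≤ t ^ m * ‖k (t • z)‖ * ‖g (x - z)‖ * ((1 + ‖z‖) ^ q * (1 + ‖x - z‖) ^ q) := by gcongr
          _ = t ^ m * ((1 + ‖z‖) ^ q * ‖k (t • z)‖) * ((1 + ‖x - z‖) ^ q * ‖g (x - z)‖) := by ring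
          _ ≤ _ := by
            gcongr
            exact hg _
    _ = _ := by
        rw [integral_const_mul, integral_mul_const, integral_const_mul,
          ← integral_dilated (fun z => (1 + ‖z‖) ^ q * ‖k z‖) ht0, smul_eq_mul]
        field_simp

/-- Derivatives may be gained at the cost of powers of the smoothing parameter. -/
theorem exists_weighted_conv_le (k : 𝓢(E m, ℂ)) (n l p : ℕ) :
    ∃ C : ℝ, 0 ≤ C ∧ ∀ t : ℝ, ∀ ht : 1 ≤ t, ∀ h : 𝓢(E m, ℂ), ∀ A : ℝ, 0 ≤ A →
      (∀ a ≤ n, ∀ y, (1 + ‖y‖) ^ (p + 2 * l + a) * ‖iteratedFDeriv ℝ a h y‖ ≤ A) →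
      ∀ a ≤ n + l, ∀ y, (1 + ‖y‖) ^ (p + l + a) *
        ‖iteratedFDeriv ℝ a (conv (dilatedKernel k (one_pos.trans_le ht)) h) y‖ ≤ C * t ^ l * A := by
  set J : ℝ := ∑ q ∈ Finset.range (p + 2 * l + n + 1), ∑ i ∈ Finset.range (l + 1),
    weightedIntegral k q i with hJ
  have hJ0 : 0 ≤ J := Finset.sum_nonneg fun _ _ => Finset.sum_nonneg fun _ _ =>
    weightedIntegral_nonneg _ _ _
  have hJle : ∀ q ≤ p + 2 * l + n, ∀ i ≤ l, weightedIntegral k q i ≤ J := by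
    intro q hq i hi
    refine (Finset.single_le_sum (f := fun i => weightedIntegral k q i)
      (fun _ _ => weightedIntegral_nonneg _ _ _) (show i ∈ Finset.range (l + 1) by simp; omega)).trans
      (Finset.single_le_sum (f := fun q => ∑ i ∈ Finset.range (l + 1), weightedIntegral k q i)
        (fun _ _ => Finset.sum_nonneg fun _ _ => weightedIntegral_nonneg _ _ _) (by simp; omega))
  refine ⟨(m + 1) ^ (n + l) * J, by positivity, fun t ht h A hA hh a ha y => ?_⟩
  -- As many derivatives as allowed, at most `n`, fall on `h`; the remaining `i ≤ l` fall on the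
  -- kernel and cost `t ^ i`.
  obtain ⟨n', i, rfl, hn', hi⟩ : ∃ n' i, a = n' + i ∧ n' ≤ n ∧ i ≤ l :=
    ⟨min a n, a - min a n, by omega, by omega, by omega⟩
  have ht0 := one_pos.trans_le ht
  have key : ∀ c : Fin (n' + i) → Fin m, ‖iteratedFDeriv ℝ (n' + i)
      (conv (dilatedKernel k ht0) h) y (basisWord c)‖ ≤
      ((1 + ‖y‖) ^ (p + l + (n' + i)))⁻¹ * (J * t ^ l * A) := by
    intro c
    rw [← SchwartzMap.iteratedLineDerivOp_eq_iteratedFDeriv, iteratedLineDeriv_conv,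
      iteratedLineDeriv_dilatedKernel, conv_smul_left]
    change ‖((t ^ i : ℝ) : ℂ) * conv _ _ y‖ ≤ _
    rw [norm_mul, Complex.norm_real, Real.norm_eq_abs, abs_of_pos (pow_pos ht0 i),
      inv_mul_eq_div, le_div_iff₀ (by positivity)]
    have h1 := weighted_norm_conv_le (∂^{basisWord c ∘ Fin.natAdd n'} k)
      (∂^{basisWord c ∘ Fin.castAdd i} h) ht (q := p + 2 * l + n') (A := A) (fun z => by
        rw [SchwartzMap.iteratedLineDerivOp_eq_iteratedFDeriv]
        refine le_trans ?_ (hh n' hn' z)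
        gcongr
        exact norm_multilinear_basis_le _ (c ∘ Fin.castAdd i)) y
    have h2 : (∫ z, (1 + ‖z‖) ^ (p + 2 * l + n') *
        ‖(∂^{basisWord c ∘ Fin.natAdd n'} k : 𝓢(E m, ℂ)) z‖) ≤ J := by
      refine le_trans (integral_mono ?_ (integrable_weighted k (p + 2 * l + n') i) fun z => ?_)
        (hJle (p + 2 * l + n') (by omega) i hi)
      · simpa using integrable_weighted (∂^{basisWord c ∘ Fin.natAdd n'} k : 𝓢(E m, ℂ))
          (p + 2 * l + n') 0
      · dsimp only
        gcongr
        rw [SchwartzMap.iteratedLineDerivOp_eq_iteratedFDeriv]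
        exact norm_multilinear_basis_le _ (c ∘ Fin.natAdd n')
    have h3 : t ^ i ≤ t ^ l := pow_le_pow_right₀ ht hi
    -- The `i` derivatives on the kernel bring no weight from `h`; the surplus `l` of its weight
    -- pays for them.
    have h4 : (1 + ‖y‖) ^ (p + l + (n' + i)) ≤ (1 + ‖y‖) ^ (p + 2 * l + n') :=
      pow_le_pow_right₀ (by linarith [norm_nonneg y]) (by omega)
    calc _ ≤ t ^ l * ‖conv (dilatedKernel (∂^{basisWord c ∘ Fin.natAdd n'} k) ht0)
          (∂^{basisWord c ∘ Fin.castAdd i} h) y‖ * (1 + ‖y‖) ^ (p + 2 * l + n') := by gcongr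
      _ = t ^ l * ((1 + ‖y‖) ^ (p + 2 * l + n') *
          ‖conv (dilatedKernel (∂^{basisWord c ∘ Fin.natAdd n'} k) ht0)
          (∂^{basisWord c ∘ Fin.castAdd i} h) y‖) := by ring
      _ ≤ t ^ l * (J * A) := mul_le_mul_of_nonneg_left
          (h1.trans (mul_le_mul_of_nonneg_right h2 hA)) (pow_nonneg ht0.le l)
      _ = _ := by ring
  have := norm_multilinear_le_of_basis _ (by positivity) key
  have hm : (m : ℝ) ^ (n' + i) ≤ (m + 1) ^ (n + l) :=
    (pow_le_pow_left₀ (by positivity) (by linarith) _).trans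
      (pow_le_pow_right₀ (by linarith [(Nat.cast_nonneg m : (0 : ℝ) ≤ m)]) (by omega))
  calc _ ≤ (1 + ‖y‖) ^ (p + l + (n' + i)) * ((m : ℝ) ^ (n' + i) *
        (((1 + ‖y‖) ^ (p + l + (n' + i)))⁻¹ * (J * t ^ l * A))) := by gcongr
    _ = (m : ℝ) ^ (n' + i) * (J * t ^ l * A) := by field_simp
    _ ≤ (m + 1) ^ (n + l) * (J * t ^ l * A) := by gcongr
    _ = _ := by ring

end Convolution

/-! ### Vanishing moments and the rate of approximation -/

section Moments

open MeasureTheory LineDeriv FourierTransform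

variable {m : ℕ}

theorem fourier_zero_eq_integral (f : 𝓢(E m, ℂ)) : 𝓕 f 0 = ∫ z, f z := by
  rw [SchwartzMap.fourier_coe, Real.fourier_eq']
  simp

/-- A Schwartz function multiplied with a product of linear forms is a Schwartz function, whose
Fourier transform is a derivative of the original one. -/
theorem exists_schwartz_moment (k : 𝓢(E m, ℂ)) {n : ℕ} (c : Fin n → E m) :
    ∃ L : 𝓢(E m, ℂ), (∀ z, L z =
      (-(2 * Real.pi * Complex.I)) ^ n * (∏ q, ((inner ℝ z (c q) : ℝ) : ℂ)) * k z) ∧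
      𝓕 L = ∂^{c} (𝓕 k) := by
  induction n with
  | zero => exact ⟨k, by simp, rfl⟩
  | succ n ih =>
    obtain ⟨L, hL, hL'⟩ := ih (Fin.tail c)
    have h : (fun x : E m => inner ℝ x (c 0)).HasTemperateGrowth :=
      ((innerSL ℝ).flip (c 0)).hasTemperateGrowth
    refine ⟨-(2 * Real.pi * Complex.I) • SchwartzMap.smulLeftCLM ℂ (inner ℝ · (c 0)) L, fun z => ?_, ?_⟩
    · change -(2 * Real.pi * Complex.I) • (SchwartzMap.smulLeftCLM ℂ (inner ℝ · (c 0)) L) z = _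
      rw [SchwartzMap.smulLeftCLM_apply_apply h, hL, Fin.prod_univ_succ, smul_eq_mul,
        Complex.real_smul, pow_succ]
      simp only [Fin.tail]
      ring
    · rw [iteratedLineDerivOp_succ_left, ← hL', SchwartzMap.lineDerivOp_fourier_eq]

/-- Kernels of total mass one with vanishing moments. -/
structure HasVanishingMoments (k : 𝓢(E m, ℂ)) : Prop where
  integral_eq_one : ∫ z, k z = 1
  integrable : ∀ {i : ℕ} (L : (E m) [×i]→L[ℝ] ℂ), Integrable fun z => k z * L fun _ => z
  integral_eq_zero : ∀ {i : ℕ} (L : (E m) [×i]→L[ℝ] ℂ), i ≠ 0 → ∫ z, k z * L (fun _ => z) = 0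

/-- Up to nonzero constants, moments of `k` are derivatives of its Fourier transform at `0`, and a
function constant near `0` has no derivatives of positive order there. -/
theorem HasVanishingMoments.of_fourier {k : 𝓢(E m, ℂ)} 
    (hk : ((𝓕 k : 𝓢(E m, ℂ)) : E m → ℂ) =ᶠ[nhds 0] fun _ => (1 : ℂ)) :
    HasVanishingMoments k := by
  have key : ∀ {i : ℕ} (c : Fin i → Fin m),
      Integrable (fun z : E m => (∏ q, ((z.ofLp (c q) : ℝ) : ℂ)) * k z) ∧
      (i ≠ 0 → ∫ z : E m, (∏ q, ((z.ofLp (c q) : ℝ) : ℂ)) * k z = 0) := by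
    intro i c
    obtain ⟨L, hL, hL'⟩ := exists_schwartz_moment k (basisWord c)
    have h2 : (-(2 * Real.pi * Complex.I)) ^ i ≠ 0 := by simp
    have e : (fun z : E m => (∏ q, ((z.ofLp (c q) : ℝ) : ℂ)) * k z) =
        fun z => ((-(2 * Real.pi * Complex.I)) ^ i)⁻¹ * L z := by
      ext z
      rw [hL, ← mul_assoc, ← mul_assoc, inv_mul_cancel₀ h2, one_mul]
      simp [EuclideanSpace.inner_single_right]
    rw [e]
    refine ⟨L.integrable.const_mul _, fun hi => ?_⟩
    rw [integral_const_mul, ← fourier_zero_eq_integral, hL',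
      SchwartzMap.iteratedLineDerivOp_eq_iteratedFDeriv, (hk.iteratedFDeriv ℝ i).self_of_nhds]
    simp [iteratedFDeriv_const_of_ne hi]
  have e : ∀ {i : ℕ} (L : (E m) [×i]→L[ℝ] ℂ), (fun z : E m => k z * L fun _ => z) = fun z =>
      ∑ c : Fin i → Fin m, L (basisWord c) * ((∏ q, ((z.ofLp (c q) : ℝ) : ℂ)) * k z) := by
    intro i L
    ext z
    rw [multilinear_apply_eq_sum, Finset.mul_sum]
    refine Finset.sum_congr rfl fun c _ => ?_
    rw [Complex.real_smul]
    push_cast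
    ring
  refine ⟨?_, fun L => ?_, fun L hi => ?_⟩
  · rw [← fourier_zero_eq_integral, hk.self_of_nhds]
  · rw [e]
    exact integrable_finsetSum _ fun c _ => (key c).1.const_mul _
  · rw [e, integral_finsetSum _ fun c _ => (key c).1.const_mul _]
    refine Finset.sum_eq_zero fun c _ => ?_
    rw [integral_const_mul, (key c).2 hi, mul_zero]

/-- The substitution `w = t z` preserves the mass and multiplies a moment of degree `i` by `t⁻¹ ^
i`. -/
theorem HasVanishingMoments.dilatedKernel {k : 𝓢(E m, ℂ)} (hk : HasVanishingMoments k) {t : ℝ}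
    (ht : 0 < t) : HasVanishingMoments (dilatedKernel k ht) := by
  have e : ∀ {i : ℕ} (L : (E m) [×i]→L[ℝ] ℂ),
      (fun z : E m => FlatSmoothing.dilatedKernel k ht z * L fun _ => z) = fun z =>
      t ^ m • (fun w : E m => ((t⁻¹ ^ i : ℝ) : ℂ) * (k w * L fun _ => w)) (t • z) := by
    intro i L
    ext z
    have := L.map_smul_univ (fun _ => t) (fun _ => z)
    dsimp only
    rw [this, dilatedKernel_apply, Finset.prod_const, Finset.card_univ, Fintype.card_fin,
      Complex.real_smul, Complex.real_smul, inv_pow]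
    have h0 : ((t ^ i : ℝ) : ℂ) ≠ 0 := by exact_mod_cast (pow_pos ht i).ne'
    push_cast at h0 ⊢
    field_simp
  refine ⟨?_, fun L => ?_, fun L hi => ?_⟩
  · have : (fun z => FlatSmoothing.dilatedKernel k ht z) = fun z => t ^ m • k (t • z) := by
      ext z
      rw [dilatedKernel_apply, Complex.real_smul]
    rw [this, integral_smul, integral_dilated _ ht, hk.integral_eq_one]
  · rw [e]
    exact (((hk.integrable L).const_mul ((t⁻¹ ^ _ : ℝ) : ℂ)).comp_smul ht.ne').smul (t ^ m)
  · rw [e, integral_smul, integral_dilated (fun w : E m =>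
      ((t⁻¹ ^ _ : ℝ) : ℂ) * (k w * L fun _ => w)) ht, integral_const_mul, hk.integral_eq_zero L hi,
      mul_zero]

/-- The Taylor remainder at `y` with increment `-z`. -/
def taylorRemainder (l : ℕ) (u : E m → ℂ) (y z : E m) : ℂ :=
  u (y - z) - ∑ k ∈ Finset.range l, (k.factorial : ℝ)⁻¹ • iteratedFDeriv ℝ k u y fun _ => -z

/-- Integral form of the remainder. Along the segment from `y` to `y - z` the weight at `y` exceeds
the weight at the intermediate point by at most `(1 + ‖z‖) ^ q`. For `l = 0` nothing is subtracted.
-/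
theorem norm_taylorRemainder_le {u : E m → ℂ} (hu : ContDiff ℝ ∞ u) {l q : ℕ} {A : ℝ}
    (h : ∀ y, (1 + ‖y‖) ^ q * ‖iteratedFDeriv ℝ l u y‖ ≤ A) (y z : E m) :
    (1 + ‖y‖) ^ q * ‖taylorRemainder l u y z‖ ≤ A * (1 + ‖z‖) ^ q * ‖z‖ ^ l := by
  have hA : 0 ≤ A := le_trans (by positivity) (h 0)
  cases l with
  | zero =>
    have h1 := h (y - z)
    rw [norm_iteratedFDeriv_zero] at h1
    have h2 := one_add_norm_pow_le q y z
    simp only [taylorRemainder, Finset.range_zero, Finset.sum_empty, sub_zero, pow_zero, mul_one]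
    calc _ ≤ ((1 + ‖z‖) ^ q * (1 + ‖y - z‖) ^ q) * ‖u (y - z)‖ := by gcongr
      _ = (1 + ‖z‖) ^ q * ((1 + ‖y - z‖) ^ q * ‖u (y - z)‖) := by ring
      _ ≤ (1 + ‖z‖) ^ q * A := by gcongr
      _ = _ := mul_comm _ _
  | succ n =>
    have := map_add_eq_sum_add_integral_iteratedFDeriv (f := u) (x := y) (y := -z) (n := n)
      fun t _ => hu.contDiffAt.of_le (by exact_mod_cast le_top)
    rw [taylorRemainder, sub_eq_add_neg y z, this, add_sub_cancel_left, norm_smul, norm_inv,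
      Real.norm_natCast]
    have hb : ‖∫ t in (0 : ℝ)..1, (1 - t) ^ n • iteratedFDeriv ℝ (n + 1) u (y + t • -z) fun _ => -z‖
        ≤ (A * (1 + ‖z‖) ^ q * ‖z‖ ^ (n + 1) / (1 + ‖y‖) ^ q) * |1 - 0| := by
      refine intervalIntegral.norm_integral_le_of_norm_le_const fun t ht => ?_
      rw [Set.uIoc_of_le zero_le_one] at ht
      rw [norm_smul, norm_pow, Real.norm_eq_abs, abs_of_nonneg (by linarith [ht.2]),
        le_div_iff₀ (by positivity)]
      have h1 := (iteratedFDeriv ℝ (n + 1) u (y + t • -z)).le_opNorm fun _ => -z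
      simp only [norm_neg, Finset.prod_const, Finset.card_univ, Fintype.card_fin] at h1
      have h2 : (1 + ‖y‖) ^ q ≤ (1 + ‖z‖) ^ q * (1 + ‖y + t • -z‖) ^ q := by
        have h3 := one_add_norm_pow_le q y (t • z)
        rw [smul_neg, ← sub_eq_add_neg]
        refine h3.trans ?_
        gcongr
        rw [norm_smul, Real.norm_eq_abs, abs_of_pos ht.1]
        exact mul_le_of_le_one_left (norm_nonneg _) ht.2
      have h4 : (1 - t) ^ n ≤ 1 := pow_le_one₀ (by linarith [ht.2]) (by linarith [ht.1])
      calc _ ≤ 1 * (‖iteratedFDeriv ℝ (n + 1) u (y + t • -z)‖ * ‖z‖ ^ (n + 1)) *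
            ((1 + ‖z‖) ^ q * (1 + ‖y + t • -z‖) ^ q) := by gcongr
        _ = ((1 + ‖y + t • -z‖) ^ q * ‖iteratedFDeriv ℝ (n + 1) u (y + t • -z)‖) *
            (1 + ‖z‖) ^ q * ‖z‖ ^ (n + 1) := by ring
        _ ≤ _ := by
          gcongr
          exact h _
    have hf : ((n.factorial : ℝ))⁻¹ ≤ 1 :=
      inv_le_one_of_one_le₀ (by exact_mod_cast n.factorial_pos)
    rw [sub_zero, abs_one, mul_one, le_div_iff₀ (by positivity)] at hb
    calc _ ≤ (1 + ‖y‖) ^ q * (1 * ‖∫ t in (0 : ℝ)..1, (1 - t) ^ n •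
          iteratedFDeriv ℝ (n + 1) u (y + t • -z) fun _ => -z‖) := by gcongr
      _ ≤ _ := by linarith

/-- Integrated against `k`, the Taylor polynomial leaves only its constant term `u y`, by the moment
conditions. The hypothesis `l ≠ 0` ensures that this term is present. -/
theorem conv_sub_eq_integral {k : 𝓢(E m, ℂ)} (hk : HasVanishingMoments k) (u : 𝓢(E m, ℂ))
    {l : ℕ} (hl : l ≠ 0) (y : E m) :
    conv k u y - u y = ∫ z, k z * taylorRemainder l u y z := by
  have h1 : Integrable fun z => k z * u (y - z) := by
    refine Integrable.mul_bdd (c := SchwartzMap.seminorm ℝ 0 0 u) k.integrable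
      (by fun_prop) (Filter.Eventually.of_forall fun z => SchwartzMap.norm_le_seminorm ℝ u _)
  have e : ∀ (i : ℕ) (z : E m), k z * ((i.factorial : ℝ)⁻¹ • iteratedFDeriv ℝ i u y fun _ => -z) =
      (((i.factorial : ℝ)⁻¹ * (-1) ^ i : ℝ) : ℂ) * (k z * iteratedFDeriv ℝ i u y fun _ => z) := by
    intro i z
    have := (iteratedFDeriv ℝ i u y).map_smul_univ (fun _ => (-1 : ℝ)) (fun _ => z)
    simp only [neg_smul, one_smul, Finset.prod_const, Finset.card_univ, Fintype.card_fin] at this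
    rw [this, Complex.real_smul, Complex.real_smul]
    push_cast
    ring
  have h2 : ∀ i, Integrable fun z : E m =>
      k z * ((i.factorial : ℝ)⁻¹ • iteratedFDeriv ℝ i u y fun _ => -z) := by
    intro i
    simp_rw [e]
    exact (hk.integrable _).const_mul _
  simp_rw [taylorRemainder, mul_sub, Finset.mul_sum]
  rw [integral_sub h1 (integrable_finsetSum _ fun i _ => h2 i), conv_apply,
    integral_finsetSum _ fun i _ => h2 i]
  congr 1
  obtain ⟨n, rfl⟩ := Nat.exists_eq_succ_of_ne_zero hl
  rw [Finset.sum_range_succ', Finset.sum_eq_zero fun i _ => ?_]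
  · simp only [Nat.factorial_zero, Nat.cast_one, inv_one, one_smul, iteratedFDeriv_zero_apply,
      zero_add]
    rw [integral_mul_const, hk.integral_eq_one, one_mul]
  · simp_rw [e]
    rw [integral_const_mul, hk.integral_eq_zero _ (Nat.succ_ne_zero i), mul_zero]

/-- The rate of approximation by convolutions with dilated kernels. -/
theorem exists_weighted_conv_sub_le {k : 𝓢(E m, ℂ)} (hk : HasVanishingMoments k) (q l : ℕ) :
    ∃ C : ℝ, 0 ≤ C ∧ ∀ t : ℝ, ∀ ht : 1 ≤ t, ∀ u : 𝓢(E m, ℂ), ∀ A : ℝ,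
      (∀ y, (1 + ‖y‖) ^ q * ‖iteratedFDeriv ℝ l u y‖ ≤ A) →
      ∀ y, (1 + ‖y‖) ^ q * ‖conv (dilatedKernel k (one_pos.trans_le ht)) u y - u y‖ ≤
        C * (t ^ l)⁻¹ * A := by
  refine ⟨1 + weightedIntegral k (q + l) 0, add_nonneg zero_le_one (weightedIntegral_nonneg _ _ _),
    fun t ht u A h y => ?_⟩
  have ht0 := one_pos.trans_le ht
  have hA : 0 ≤ A := le_trans (by positivity) (h 0)
  -- For `l = 0` no rate is claimed, and bounding both terms separately suffices; this accounts for
  -- the summand `1` in the constant.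
  rcases eq_or_ne l 0 with rfl | hl
  · simp only [norm_iteratedFDeriv_zero] at h
    have h1 := weighted_norm_conv_le k u ht h y
    have h2 : weightedIntegral k (q + 0) 0 = ∫ z, (1 + ‖z‖) ^ q * ‖k z‖ := by
      simp [weightedIntegral]
    rw [h2]
    calc _ ≤ (1 + ‖y‖) ^ q * (‖conv (dilatedKernel k ht0) u y‖ + ‖u y‖) := by
          gcongr
          exact norm_sub_le _ _
      _ ≤ _ := by
          rw [mul_add]
          simp only [pow_zero, inv_one]
          linarith [h y]
  · rw [conv_sub_eq_integral (hk.dilatedKernel ht0) u hl]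
    have hint' : Integrable fun z : E m =>
        (1 + ‖t • z‖) ^ (q + l) * ‖iteratedFDeriv ℝ 0 k (t • z)‖ :=
      (integrable_weighted k (q + l) 0).comp_smul ht0.ne'
    calc _ ≤ (1 + ‖y‖) ^ q * ∫ z, ((1 + ‖y‖) ^ q)⁻¹ * ((t ^ l)⁻¹ *
          (t ^ m * ((1 + ‖t • z‖) ^ (q + l) * ‖iteratedFDeriv ℝ 0 k (t • z)‖) * A)) := by
          gcongr
          refine norm_integral_le_of_norm_le
            ((((hint'.const_mul _).mul_const _).const_mul _).const_mul _)
            (Filter.Eventually.of_forall fun z => ?_)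
          rw [dilatedKernel_apply, norm_mul, norm_mul, Complex.norm_real, Real.norm_eq_abs,
            abs_of_pos (pow_pos ht0 m), inv_mul_eq_div, le_div_iff₀ (by positivity),
            norm_iteratedFDeriv_zero]
          have h1 := norm_taylorRemainder_le (u.smooth ⊤) h y z
          have h2 : ‖z‖ ≤ ‖t • z‖ := by
            rw [norm_smul, Real.norm_eq_abs, abs_of_pos ht0]
            exact le_mul_of_one_le_left (norm_nonneg _) ht
          -- The gain `t ^ (-l)`: the kernel lives at scale `1 / t`, where the remainder of order
          -- `l` is small.
          have h3 : ‖z‖ ^ l ≤ (t ^ l)⁻¹ * (1 + ‖t • z‖) ^ l := by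
            rw [inv_mul_eq_div, le_div_iff₀ (by positivity), ← mul_pow]
            gcongr
            rw [norm_smul, Real.norm_eq_abs, abs_of_pos ht0]
            linarith [mul_comm t ‖z‖]
          calc _ = t ^ m * ‖k (t • z)‖ * ((1 + ‖y‖) ^ q * ‖taylorRemainder l u y z‖) := by ring
            _ ≤ t ^ m * ‖k (t • z)‖ * (A * (1 + ‖t • z‖) ^ q * ((t ^ l)⁻¹ * (1 + ‖t • z‖) ^ l)) := by
                refine mul_le_mul_of_nonneg_left (h1.trans ?_) (by positivity)
                gcongr
            _ = _ := by rw [pow_add]; ring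
      _ = weightedIntegral k (q + l) 0 * (t ^ l)⁻¹ * A := by
          rw [integral_const_mul, integral_const_mul, integral_mul_const, integral_const_mul,
            weightedIntegral, ← integral_dilated (fun z => (1 + ‖z‖) ^ (q + l) *
              ‖iteratedFDeriv ℝ 0 k z‖) ht0, smul_eq_mul]
          field_simp
      _ ≤ _ := by
          gcongr
          linarith

/-- The rate of approximation, for derivatives. -/
theorem exists_weighted_iteratedFDeriv_conv_sub_le {k : 𝓢(E m, ℂ)} (hk : HasVanishingMoments k)
    (n l p : ℕ) :
    ∃ C : ℝ, 0 ≤ C ∧ ∀ t : ℝ, ∀ ht : 1 ≤ t, ∀ h : 𝓢(E m, ℂ), ∀ A : ℝ, 0 ≤ A →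
      (∀ a ≤ n + l, ∀ y, (1 + ‖y‖) ^ (p + l + a) * ‖iteratedFDeriv ℝ a h y‖ ≤ A) →
      ∀ a ≤ n, ∀ y, (1 + ‖y‖) ^ (p + 2 * l + a) *
        ‖iteratedFDeriv ℝ a (conv (dilatedKernel k (one_pos.trans_le ht)) h - h) y‖ ≤
          C * (t ^ l)⁻¹ * A := by
  choose C hC0 hC using fun a => exists_weighted_conv_sub_le hk (p + 2 * l + a) l
  refine ⟨(m + 1) ^ n * ∑ a ∈ Finset.range (n + 1), C a,
    mul_nonneg (by positivity) (Finset.sum_nonneg fun a _ => hC0 a), fun t ht h A hA hh a ha y => ?_⟩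
  have ht0 := one_pos.trans_le ht
  have key : ∀ c : Fin a → Fin m, ‖iteratedFDeriv ℝ a
      (conv (dilatedKernel k ht0) h - h : 𝓢(E m, ℂ)) y (basisWord c)‖ ≤
      ((1 + ‖y‖) ^ (p + 2 * l + a))⁻¹ * (C a * (t ^ l)⁻¹ * A) := by
    intro c
    rw [← SchwartzMap.iteratedLineDerivOp_eq_iteratedFDeriv, sub_eq_add_neg, iteratedLineDerivOp_add,
      iteratedLineDerivOp_neg, iteratedLineDeriv_conv_right, ← sub_eq_add_neg,
      inv_mul_eq_div, le_div_iff₀ (by positivity), mul_comm]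
    refine hC a t ht (∂^{basisWord c} h) A (fun z => ?_) y
    refine le_trans ?_ (hh (l + a) (by omega) z)
    have := norm_iteratedFDeriv_iteratedLineDeriv_le h c l z
    -- The weight belonging to the derivative of order `l + a` in the hypothesis is exactly the one
    -- wanted for order `a` in the conclusion, so none is lost.
    have h4 : (1 + ‖z‖) ^ (p + 2 * l + a) = (1 + ‖z‖) ^ (p + l + (l + a)) := by
      congr 1
      ring
    rw [h4]
    gcongr
  have hC0a := hC0 a
  have := norm_multilinear_le_of_basis _ (by positivity) key
  have hm : (m : ℝ) ^ a ≤ (m + 1) ^ n :=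
    (pow_le_pow_left₀ (by positivity) (by linarith) _).trans
      (pow_le_pow_right₀ (by linarith [(Nat.cast_nonneg m : (0 : ℝ) ≤ m)]) ha)
  have hCa : C a ≤ ∑ a ∈ Finset.range (n + 1), C a :=
    Finset.single_le_sum (f := C) (fun a _ => hC0 a) (by simp; omega)
  change (1 + ‖y‖) ^ (p + 2 * l + a) * ‖iteratedFDeriv ℝ a
      (conv (dilatedKernel k ht0) h - h : 𝓢(E m, ℂ)) y‖ ≤ _
  calc _ ≤ (1 + ‖y‖) ^ (p + 2 * l + a) * ((m : ℝ) ^ a *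
        (((1 + ‖y‖) ^ (p + 2 * l + a))⁻¹ * (C a * (t ^ l)⁻¹ * A))) := by gcongr
    _ = (m : ℝ) ^ a * (C a * (t ^ l)⁻¹ * A) := by field_simp
    _ ≤ (m + 1) ^ n * ((∑ a ∈ Finset.range (n + 1), C a) * (t ^ l)⁻¹ * A) := by gcongr
    _ = _ := by ring

end Moments

/-! ### Nash's kernel is a real Schwartz function with vanishing moments -/

section NashKernel

open MeasureTheory FourierTransform

variable {m : ℕ} {χ : ℝ → ℝ}

/-- For each `u`, one of `u` and `-u` is at most `0`, where `χ` is `1`. This form shows smoothness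
despite the absolute value. -/
theorem IsNashCutoff.apply_abs (hχ : IsNashCutoff χ) (u : ℝ) : χ |u| = χ u * χ (-u) := by
  rcases le_total 0 u with h | h
  · rw [abs_of_nonneg h, hχ.eq_one (-u) (by linarith), mul_one]
  · rw [abs_of_nonpos h, hχ.eq_one u (by linarith), one_mul]

/-- The Fourier transform of Nash's kernel, for the Fourier transform with kernel `e^{-2πi⟨x,ξ⟩}`. -/
def nashProfile (m : ℕ) (χ : ℝ → ℝ) (η : E m) : ℂ := ((∏ i, χ |2 * Real.pi * η i| : ℝ) : ℂ)

theorem IsNashCutoff.contDiff_nashProfile (hχ : IsNashCutoff χ) :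
    ContDiff ℝ ∞ (nashProfile m χ) := by
  have hs := hχ.smooth
  have h : ∀ i : Fin m, ContDiff ℝ ∞ fun η : E m => χ |2 * Real.pi * η i| := by
    intro i
    simp_rw [hχ.apply_abs]
    have h : ContDiff ℝ ∞ fun η : E m => 2 * Real.pi * η i := by fun_prop
    exact (hs.comp h).mul (hs.comp h.neg)
  have h' : ContDiff ℝ ∞ fun η : E m => ∏ i, χ |2 * Real.pi * η i| := contDiff_prod fun i _ => h i
  exact Complex.ofRealCLM.contDiff.comp h'

theorem IsNashCutoff.hasCompactSupport_nashProfile (hχ : IsNashCutoff χ) :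
    HasCompactSupport (nashProfile m χ) := by
  -- If some coordinate exceeds `1` in absolute value, then `2 * π * |η i| ≥ 2` and its factor
  -- vanishes; the cube that remains lies in the ball of radius `√m`.
  refine HasCompactSupport.intro (isCompact_closedBall (0 : E m) (Real.sqrt m)) fun η hη => ?_
  by_contra hne
  refine hη ?_
  have h : ∀ i, ‖η i‖ ^ 2 ≤ 1 := by
    intro i
    by_contra h1
    refine hne ?_
    rw [nashProfile, Finset.prod_eq_zero (Finset.mem_univ i), Complex.ofReal_zero]
    refine hχ.eq_zero _ ?_
    rw [abs_mul, abs_of_pos Real.two_pi_pos]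
    have h2 : 1 < |η i| := by
      rw [Real.norm_eq_abs] at h1
      by_contra h3
      exact h1 (pow_le_one₀ (abs_nonneg _) (not_lt.1 h3))
    nlinarith [Real.pi_gt_three]
  rw [mem_closedBall_zero_iff, EuclideanSpace.norm_eq]
  refine Real.sqrt_le_sqrt ((Finset.sum_le_sum fun i _ => h i).trans ?_)
  simp

/-- Nash's kernel as a Schwartz function. -/
def nashSchwartz (m : ℕ) (hχ : IsNashCutoff χ) : 𝓢(E m, ℂ) :=
  𝓕⁻ (hχ.hasCompactSupport_nashProfile.toSchwartzMap hχ.contDiff_nashProfile : 𝓢(E m, ℂ))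

/-- The substitution `ξ = 2 π η` converts between the two normalizations; its Jacobian `(2 π) ^ m`
cancels the two factors `(2 π) ^ (-m / 2)`. -/
theorem nashSchwartz_apply (hχ : IsNashCutoff χ) (x : E m) :
    nashSchwartz m hχ x = nashKernel m χ x := by
  rw [nashSchwartz, SchwartzMap.fourierInv_coe, Real.fourierInv_eq', nashKernel,
    ← integral_dilated (fun ξ : E m => nashSymbol m χ ξ *
      Complex.exp (Complex.I * ((inner ℝ x ξ : ℝ) : ℂ))) Real.two_pi_pos]
  rw [Complex.real_smul, ← mul_assoc, ← integral_const_mul]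
  refine integral_congr_ae (Filter.Eventually.of_forall fun η => ?_)
  have h1 : ((1 / Real.sqrt (2 * Real.pi)) ^ m : ℝ) * ((2 * Real.pi) ^ m : ℝ) *
      (1 / Real.sqrt (2 * Real.pi)) ^ m = 1 := by
    rw [← mul_pow, ← mul_pow]
    have : 1 / Real.sqrt (2 * Real.pi) * (2 * Real.pi) * (1 / Real.sqrt (2 * Real.pi)) = 1 := by
      have h2 := Real.mul_self_sqrt Real.two_pi_pos.le
      have h3 : Real.sqrt (2 * Real.pi) ≠ 0 := (Real.sqrt_pos.2 Real.two_pi_pos).ne'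
      rw [one_div, mul_comm, ← mul_assoc, ← mul_inv, h2, inv_mul_cancel₀ Real.two_pi_pos.ne']
    rw [this, one_pow]
  have h1' := congrArg (fun a : ℝ => (a : ℂ)) h1
  simp only [Complex.ofReal_mul, Complex.ofReal_one] at h1'
  have h4 : Complex.I * ((inner ℝ x ((2 * Real.pi) • η) : ℝ) : ℂ) =
      ((2 * Real.pi * inner ℝ η x : ℝ) : ℂ) * Complex.I := by
    rw [inner_smul_right, real_inner_comm, mul_comm]
  have h5 : ∀ i, ((2 * Real.pi) • η) i = 2 * Real.pi * η i := fun i => rfl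
  dsimp only
  rw [h4, HasCompactSupport.toSchwartzMap_toFun, nashSymbol, nashProfile, smul_eq_mul]
  simp_rw [h5]
  rw [Complex.ofReal_mul ((1 / Real.sqrt (2 * Real.pi)) ^ m)]
  simp only [← mul_assoc]
  rw [h1', one_mul, mul_comm]

theorem hasVanishingMoments_nashSchwartz (hχ : IsNashCutoff χ) :
    HasVanishingMoments (nashSchwartz m hχ) := by
  refine HasVanishingMoments.of_fourier ?_
  rw [nashSchwartz, FourierTransform.fourier_fourierInv_eq]
  filter_upwards [Metric.ball_mem_nhds (0 : E m) (show (0 : ℝ) < 1 / (2 * Real.pi) by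
    have := Real.two_pi_pos
    positivity)] with η hη
  rw [HasCompactSupport.toSchwartzMap_toFun, nashProfile, Finset.prod_eq_one, Complex.ofReal_one]
  intro i _
  refine hχ.eq_one _ ?_
  rw [abs_mul, abs_of_pos Real.two_pi_pos]
  have h1 : |η i| ≤ ‖η‖ := PiLp.norm_apply_le η i
  rw [mem_ball_zero_iff, lt_div_iff₀ Real.two_pi_pos] at hη
  nlinarith [Real.two_pi_pos]

/-- The symbol is real and even, so conjugating the integral is the same as substituting `-ξ`. -/
theorem nashKernel_im (x : E m) : (nashKernel m χ x).im = 0 := by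
  rw [← Complex.conj_eq_iff_im, nashKernel, map_mul, Complex.conj_ofReal, ← integral_conj]
  congr 1
  rw [← integral_neg_eq_self]
  refine integral_congr_ae (Filter.Eventually.of_forall fun ξ => ?_)
  have h5 : ∀ i, (-ξ) i = -(ξ i) := fun i => rfl
  dsimp only
  rw [map_mul, ← Complex.exp_conj, map_mul, Complex.conj_I, Complex.conj_ofReal, nashSymbol,
    nashSymbol, Complex.conj_ofReal, inner_neg_right]
  simp [h5]

theorem nashSmoothing_eq_conv (hχ : IsNashCutoff χ) {t : ℝ} (ht : 0 < t) (h : 𝓢(E m, ℂ)) :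
    nashSmoothing m χ t h = conv (dilatedKernel (nashSchwartz m hχ) ht) h := by
  ext x
  rw [conv_apply, nashSmoothing, ← integral_sub_left_eq_self _ _ x]
  refine integral_congr_ae (Filter.Eventually.of_forall fun z => ?_)
  dsimp only
  rw [sub_sub_cancel, dilatedKernel_apply, nashSchwartz_apply]

theorem nashSmoothing_im {t : ℝ} {h : E m → ℂ} (hh : ∀ x, (h x).im = 0) (x : E m) :
    (nashSmoothing m χ t h x).im = 0 := by
  rw [← Complex.conj_eq_iff_im, nashSmoothing, ← integral_conj]
  refine integral_congr_ae (Filter.Eventually.of_forall fun y => ?_)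
  dsimp only
  rw [map_mul, map_mul, Complex.conj_ofReal, Complex.conj_eq_iff_im.2 (nashKernel_im _),
    Complex.conj_eq_iff_im.2 (hh y)]

end NashKernel

/-! ### Seeley's coefficients from Euler's `q`-exponential series -/

section SeeleySequence

/-- Coefficients of Euler's `q`-exponential series, for `q = 2`. -/
def eulerCoeff (j : ℕ) : ℝ := ∏ d ∈ Finset.range j, -(2 ^ (d + 1) - 1 : ℝ)⁻¹

theorem one_le_two_pow_succ_sub_one (j : ℕ) : (1 : ℝ) ≤ 2 ^ (j + 1) - 1 := by
  have : (1 : ℝ) ≤ 2 ^ j := one_le_pow₀ (by norm_num)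
  rw [pow_succ]
  linarith

theorem eulerCoeff_succ (j : ℕ) : eulerCoeff (j + 1) * (2 ^ (j + 1) - 1) = -eulerCoeff j := by
  have := one_le_two_pow_succ_sub_one j
  rw [eulerCoeff, Finset.prod_range_succ, ← eulerCoeff]
  field_simp

theorem eulerCoeff_ne_zero (j : ℕ) : eulerCoeff j ≠ 0 := by
  refine Finset.prod_ne_zero_iff.2 fun d _ => ?_
  have := one_le_two_pow_succ_sub_one d
  exact neg_ne_zero.2 (inv_ne_zero (by linarith))

theorem abs_eulerCoeff_le (j : ℕ) : |eulerCoeff j| ≤ 1 := by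
  rw [eulerCoeff, Finset.abs_prod]
  refine Finset.prod_le_one (fun _ _ => abs_nonneg _) fun d _ => ?_
  have := one_le_two_pow_succ_sub_one d
  rw [abs_neg, abs_of_pos (by positivity)]
  exact inv_le_one_of_one_le₀ this

theorem summable_eulerCoeff (z : ℝ) : Summable fun j => eulerCoeff j * z ^ j := by
  rcases eq_or_ne z 0 with rfl | hz
  · exact summable_of_ne_finset_zero (s := {0}) fun j hj => by
      rw [zero_pow (by simpa using hj), mul_zero]
  refine summable_of_ratio_test_tendsto_lt_one (l := 0) one_pos
    (Filter.Eventually.of_forall fun j => mul_ne_zero (eulerCoeff_ne_zero j) (pow_ne_zero j hz)) ?_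
  have e : (fun j => ‖eulerCoeff (j + 1) * z ^ (j + 1)‖ / ‖eulerCoeff j * z ^ j‖) =
      fun j => |z| / (2 ^ (j + 1) - 1) := by
    ext j
    have h1 := one_le_two_pow_succ_sub_one j
    have h2 := abs_pos.2 (eulerCoeff_ne_zero j)
    have h3 := congrArg abs (eulerCoeff_succ j)
    rw [abs_mul, abs_neg, abs_of_pos (show (0 : ℝ) < 2 ^ (j + 1) - 1 by linarith)] at h3
    simp only [norm_mul, norm_pow, Real.norm_eq_abs]
    rw [← h3] at h2 ⊢
    have h4 : 0 < |eulerCoeff (j + 1)| := abs_pos.2 (eulerCoeff_ne_zero _)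
    have h5 : 0 < |z| := abs_pos.2 hz
    rw [div_eq_div_iff (by positivity) (by linarith), pow_succ]
    ring
  rw [e]
  refine Filter.Tendsto.div_atTop tendsto_const_nhds ?_
  refine Filter.tendsto_atTop_add_const_right _ _ ?_
  exact (tendsto_pow_atTop_atTop_of_one_lt (by norm_num : (1 : ℝ) < 2)).comp
    (Filter.tendsto_add_atTop_nat 1)

/-- Euler's `q`-exponential series, for `q = 2`. -/
def eulerSeries (z : ℝ) : ℝ := ∑' j, eulerCoeff j * z ^ j

/-- The recursion `eulerCoeff_succ` is the comparison of coefficients in `E(2z) - E(z) = -z E(z)`.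
-/
theorem eulerSeries_two_mul (z : ℝ) : eulerSeries (2 * z) = (1 - z) * eulerSeries z := by
  have h1 := summable_eulerCoeff (2 * z)
  have h2 := summable_eulerCoeff z
  have h3 : eulerSeries (2 * z) - eulerSeries z = -z * eulerSeries z := by
    rw [eulerSeries, eulerSeries, ← h1.tsum_sub h2, (h1.sub h2).tsum_eq_zero_add, ← tsum_mul_left]
    simp only [pow_zero, sub_self, zero_add]
    refine tsum_congr fun j => ?_
    rw [mul_pow]
    linear_combination z ^ (j + 1) * eulerCoeff_succ j
  linarith

/-- Two applications of the functional equation reduce `1` to `1 / 4`, where the terms after the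
leading `1` are dominated by a geometric series of sum `1 / 3`. -/
theorem eulerSeries_one_ne_zero : eulerSeries 1 ≠ 0 := by
  have h1 : eulerSeries 1 = (1 - 1 / 2) * ((1 - 1 / 4) * eulerSeries (1 / 4)) := by
    rw [← eulerSeries_two_mul, ← show (2 : ℝ) * (1 / 4) = 1 / 2 by norm_num, ← eulerSeries_two_mul]
    norm_num
  have h2 : |eulerSeries (1 / 4) - 1| ≤ 1 / 3 := by
    have hs := summable_eulerCoeff (1 / 4)
    rw [eulerSeries, hs.tsum_eq_zero_add]
    simp only [eulerCoeff, Finset.range_zero, Finset.prod_empty, pow_zero, mul_one,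
      add_sub_cancel_left]
    have hg : HasSum (fun j : ℕ => (1 / 4 : ℝ) * (1 / 4) ^ j) (1 / 4 * (1 - 1 / 4)⁻¹) :=
      (hasSum_geometric_of_lt_one (by norm_num) (by norm_num)).mul_left _
    refine (tsum_of_norm_bounded (E := ℝ) hg fun j => ?_).trans (by norm_num)
    rw [← eulerCoeff, norm_mul, Real.norm_eq_abs, norm_pow, pow_succ]
    have := abs_eulerCoeff_le (j + 1)
    calc _ ≤ 1 * (‖(1 / 4 : ℝ)‖ ^ j * ‖(1 / 4 : ℝ)‖) := by gcongr
      _ = _ := by norm_num; ring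
  have h3 := (abs_le.1 h2).1
  rw [h1]
  have : 0 < eulerSeries (1 / 4) := by linarith
  positivity

/-- The factor `1 - z` vanishes at `z = 1`, giving the zero at `2`; the functional equation
propagates it by doubling. -/
theorem eulerSeries_two_pow {p : ℕ} (hp : p ≠ 0) : eulerSeries (2 ^ p) = 0 := by
  obtain ⟨p, rfl⟩ := Nat.exists_eq_succ_of_ne_zero hp
  induction p with
  | zero => simpa using eulerSeries_two_mul 1
  | succ p ih =>
    rw [pow_succ', eulerSeries_two_mul, ih (Nat.succ_ne_zero p), mul_zero]

/-- Sequences with prescribed moments at the powers of two, as in Seeley's extension theorem. -/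
structure IsSeeley (a : ℕ → ℝ) : Prop where
  summable : ∀ p : ℕ, Summable fun j => |a j * (2 ^ j) ^ p|
  moment : ∀ p : ℕ, ∑' j, a j * (2 ^ j) ^ p = if p = 0 then 1 else 0

/-- Because `(2 ^ j) ^ p = (2 ^ p) ^ j`, the moments are the values of the series at `2 ^ p`, here
normalized by the value at `1`. -/
theorem exists_isSeeley : ∃ a, IsSeeley a := by
  refine ⟨fun j => (eulerSeries 1)⁻¹ * eulerCoeff j, ⟨fun p => ?_, fun p => ?_⟩⟩
  · refine Summable.abs ?_
    simp_rw [mul_assoc]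
    refine ((summable_eulerCoeff (2 ^ p)).mul_left (eulerSeries 1)⁻¹).congr fun j => ?_
    rw [← pow_mul, ← pow_mul, mul_comm p]
  · have : ∀ j : ℕ, (eulerSeries 1)⁻¹ * eulerCoeff j * (2 ^ j) ^ p =
        (eulerSeries 1)⁻¹ * (eulerCoeff j * (2 ^ p) ^ j) := by
      intro j
      rw [← pow_mul, ← pow_mul, mul_comm p, mul_assoc]
    simp_rw [this]
    rw [tsum_mul_left, ← eulerSeries]
    split_ifs with hp
    · rw [hp, pow_zero, inv_mul_cancel₀ eulerSeries_one_ne_zero]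
    · rw [eulerSeries_two_pow hp, mul_zero]

end SeeleySequence

/-! ### Differentiating a series term by term at one point -/

section TermwiseDerivative

variable {X V : Type*} [NormedAddCommGroup X] [NormedSpace ℝ X] [NormedAddCommGroup V]
  [NormedSpace ℝ V] [CompleteSpace V]

/-- Termwise differentiation at a point of series with a summable Lipschitz bound. -/
theorem hasFDerivWithinAt_tsum_of_lipschitz {g : ℕ → X → V} {g' : ℕ → X →L[ℝ] V} {s : Set X}
    {x₀ : X} {B : ℕ → ℝ} (hB : Summable B) (hg : ∀ j, HasFDerivWithinAt (g j) (g' j) s x₀)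
    (hl : ∀ᶠ x in nhdsWithin x₀ s, ∀ j, ‖g j x - g j x₀‖ ≤ B j * ‖x - x₀‖)
    (hg' : ∀ j, ‖g' j‖ ≤ B j) (hs : ∀ x ∈ s, Summable fun j => g j x) (hx₀ : x₀ ∈ s) :
    HasFDerivWithinAt (fun x => ∑' j, g j x) (∑' j, g' j) s x₀ := by
  have hsum' : Summable g' := Summable.of_norm_bounded hB hg'
  have hB0 : ∀ j, 0 ≤ B j := fun j => (norm_nonneg _).trans (hg' j)
  have hterm : ∀ j x, ‖g j x - g j x₀‖ ≤ B j * ‖x - x₀‖ →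
      ‖x - x₀‖⁻¹ * ‖g j x - g j x₀ - g' j (x - x₀)‖ ≤ 2 * B j := by
    intro j x h
    rcases eq_or_ne ‖x - x₀‖ 0 with h0 | h0
    · rw [h0, inv_zero, zero_mul]
      linarith [hB0 j]
    · have h1 : 0 < ‖x - x₀‖ := lt_of_le_of_ne (norm_nonneg _) h0.symm
      rw [inv_mul_le_iff₀ h1]
      have h2 := (g' j).le_of_opNorm_le (hg' j) (x - x₀)
      have h3 := norm_sub_le (g j x - g j x₀) (g' j (x - x₀))
      linarith
  rw [hasFDerivWithinAt_iff_tendsto]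
  -- Each normalized remainder tends to zero and is dominated by `2 * B j`, so dominated convergence
  -- for sums applies.
  have hlim : Filter.Tendsto
      (fun x => ∑' j, ‖x - x₀‖⁻¹ * ‖g j x - g j x₀ - g' j (x - x₀)‖) (nhdsWithin x₀ s)
      (nhds (∑' _ : ℕ, (0 : ℝ))) := by
    refine tendsto_tsum_of_dominated_convergence (hB.mul_left 2)
      (fun j => hasFDerivWithinAt_iff_tendsto.1 (hg j)) ?_
    filter_upwards [hl] with x hx j
    rw [Real.norm_of_nonneg (by positivity)]
    exact hterm j x (hx j)
  rw [tsum_zero] at hlim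
  refine squeeze_zero' (Filter.Eventually.of_forall fun x => by positivity) ?_ hlim
  filter_upwards [hl, self_mem_nhdsWithin] with x hx hxs
  have hsum : Summable fun j => ‖x - x₀‖⁻¹ * ‖g j x - g j x₀ - g' j (x - x₀)‖ :=
    Summable.of_nonneg_of_le (fun j => by positivity) (fun j => hterm j x (hx j)) (hB.mul_left 2)
  have e : ∑' j, g j x - ∑' j, g j x₀ - (∑' j, g' j) (x - x₀) =
      ∑' j, (g j x - g j x₀ - g' j (x - x₀)) := by
    have h1 : (∑' j, g' j) (x - x₀) = ∑' j, g' j (x - x₀) :=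
      (ContinuousLinearMap.apply ℝ V (x - x₀)).map_tsum hsum'
    have h2 : Summable fun j => g' j (x - x₀) :=
      (ContinuousLinearMap.apply ℝ V (x - x₀)).summable hsum'
    rw [h1, ← (hs x hxs).tsum_sub (hs x₀ hx₀), ← ((hs x hxs).sub (hs x₀ hx₀)).tsum_sub h2]
  rw [e]
  rcases eq_or_ne ‖x - x₀‖ 0 with h0 | h0
  · simp [h0]
  · have h4 : 0 < ‖x - x₀‖ := lt_of_le_of_ne (norm_nonneg _) h0.symm
    rw [tsum_mul_left]
    gcongr
    have h5 : Summable fun j => ‖g j x - g j x₀ - g' j (x - x₀)‖ := by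
      refine (hsum.mul_left ‖x - x₀‖).congr fun j => ?_
      rw [mul_inv_cancel_left₀ h0]
    exact norm_tsum_le_tsum_norm h5

end TermwiseDerivative

/-! ### Reflections of the exterior into the ball, stopped at the origin -/

section Reflection

variable {m : ℕ}

/-- The vector field `(|x|^2 - 1) x`, which vanishes on the unit sphere. -/
def sphereField (m : ℕ) (x : E m) : E m := (‖x‖ ^ 2 - 1) • x

theorem contDiff_sphereField : ContDiff ℝ ∞ (sphereField m) :=
  ((contDiff_norm_sq ℝ).sub contDiff_const).smul contDiff_id

/-- The scaling factor of `reflection`. -/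
def reflectionFactor (μ : ℝ) (x : E m) : ℝ := max 0 (1 - μ * (‖x‖ ^ 2 - 1))

/-- A family of maps from the exterior of the unit ball to the unit ball, fixing the sphere. -/
def reflection (μ : ℝ) (x : E m) : E m := reflectionFactor μ x • x

theorem reflectionFactor_nonneg (μ : ℝ) (x : E m) : 0 ≤ reflectionFactor μ x := le_max_left _ _

theorem reflectionFactor_le_one {μ : ℝ} (hμ : 1 ≤ μ) {x : E m} (hx : 1 ≤ ‖x‖) :
    reflectionFactor μ x ≤ 1 := by
  have : 0 ≤ μ * (‖x‖ ^ 2 - 1) := mul_nonneg (by linarith) (by nlinarith)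
  exact max_le zero_le_one (by linarith)

theorem norm_reflection_le_one {μ : ℝ} (hμ : 1 ≤ μ) {x : E m} (hx : 1 ≤ ‖x‖) :
    ‖reflection μ x‖ ≤ 1 := by
  rw [reflection, norm_smul, Real.norm_eq_abs, abs_of_nonneg (reflectionFactor_nonneg μ x)]
  have h1 : 0 ≤ ‖x‖ ^ 2 - 1 := by nlinarith
  rcases le_total (1 - μ * (‖x‖ ^ 2 - 1)) 0 with h | h
  · rw [reflectionFactor, max_eq_left h, zero_mul]
    exact zero_le_one
  · rw [reflectionFactor, max_eq_right h]
    -- With `ρ = ‖x‖` the extreme case is `μ = 1`, where `1 - (2 - ρ ^ 2) * ρ = (ρ - 1) * (ρ ^ 2 + ρ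
    -- - 1) ≥ 0`.
    nlinarith [mul_nonneg (mul_nonneg (sub_nonneg.2 hμ) h1) (norm_nonneg x),
      mul_nonneg (sub_nonneg.2 hx) (show 0 ≤ ‖x‖ ^ 2 + ‖x‖ - 1 by nlinarith)]

theorem reflection_of_norm_eq_one {μ : ℝ} {x : E m} (hx : ‖x‖ = 1) : reflection μ x = x := by
  simp [reflection, reflectionFactor, hx]

theorem reflection_eq_zero {μ : ℝ} (hμ : 1 ≤ μ) {x : E m} (hx : 2 ≤ ‖x‖) : reflection μ x = 0 := by
  rw [reflection, reflectionFactor, max_eq_left, zero_smul]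
  have : 1 ≤ ‖x‖ ^ 2 - 1 := by nlinarith
  nlinarith

theorem norm_reflection_sub_le {μ : ℝ} (hμ : 1 ≤ μ) {x x₀ : E m} (hx : 1 ≤ ‖x‖)
    (hxx : ‖x - x₀‖ ≤ 1) :
    ‖reflection μ x - reflection μ x₀‖ ≤ μ * ((1 + (2 * ‖x₀‖ + 1) * ‖x₀‖) * ‖x - x₀‖) := by
  have h1 : reflection μ x - reflection μ x₀ = reflectionFactor μ x • (x - x₀) +
      (reflectionFactor μ x - reflectionFactor μ x₀) • x₀ := by
    rw [reflection, reflection, smul_sub, sub_smul]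
    abel
  have h2 : |reflectionFactor μ x - reflectionFactor μ x₀| ≤
      μ * ((2 * ‖x₀‖ + 1) * ‖x - x₀‖) := by
    refine (abs_max_sub_max_le_max _ _ _ _).trans ?_
    rw [sub_self, abs_zero, max_eq_right (abs_nonneg _)]
    have e : 1 - μ * (‖x‖ ^ 2 - 1) - (1 - μ * (‖x₀‖ ^ 2 - 1)) =
        -(μ * ((‖x‖ + ‖x₀‖) * (‖x‖ - ‖x₀‖))) := by ring
    rw [e, abs_neg, abs_mul, abs_mul, abs_of_nonneg (show 0 ≤ μ by linarith),
      abs_of_nonneg (by positivity : 0 ≤ ‖x‖ + ‖x₀‖)]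
    have h3 : ‖x‖ ≤ ‖x₀‖ + 1 := by
      have := norm_add_le x₀ (x - x₀)
      rw [add_sub_cancel] at this
      linarith
    have h4 : ‖x‖ + ‖x₀‖ ≤ 2 * ‖x₀‖ + 1 := by linarith
    have h5 := abs_norm_sub_norm_le x x₀
    gcongr
  rw [h1]
  refine (norm_add_le _ _).trans ?_
  rw [norm_smul, norm_smul, Real.norm_eq_abs, Real.norm_eq_abs,
    abs_of_nonneg (reflectionFactor_nonneg μ x)]
  calc _ ≤ μ * ‖x - x₀‖ + μ * ((2 * ‖x₀‖ + 1) * ‖x - x₀‖) * ‖x₀‖ := by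
        gcongr
        exact (reflectionFactor_le_one hμ hx).trans hμ
    _ = _ := by ring

/-- The closed exterior of the unit ball. -/
abbrev exterior (m : ℕ) : Set (E m) := {x | 1 ≤ ‖x‖}

theorem mem_unitBall {x : E m} : x ∈ cball m unitRadius ↔ ‖x‖ ≤ 1 := mem_closedBall_zero_iff

/-- Vector valued smooth functions on the unit ball, flat at the origin. -/
structure FlatOnBall {V : Type} [NormedAddCommGroup V] [NormedSpace ℝ V] (f : E m → V) :
    Prop where
  smooth : ContDiffOn ℝ ∞ f (cball m unitRadius)
  flat : ∀ i, iteratedFDerivWithin ℝ i f (cball m unitRadius) 0 = 0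

variable {V : Type} [NormedAddCommGroup V] [NormedSpace ℝ V] {f : E m → V}

/-- The derivative within the unit ball. -/
abbrev ballDeriv (f : E m → V) : E m → E m →L[ℝ] V := fderivWithin ℝ f (cball m unitRadius)

theorem norm_iteratedFDerivWithin_ballDeriv (f : E m → V) (i : ℕ) {x : E m}
    (hx : x ∈ cball m unitRadius) :
    ‖iteratedFDerivWithin ℝ i (ballDeriv f) (cball m unitRadius) x‖ =
      ‖iteratedFDerivWithin ℝ (i + 1) f (cball m unitRadius) x‖ :=
  norm_iteratedFDerivWithin_fderivWithin (uniqueDiffOn_cball m unitRadius) hx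

theorem FlatOnBall.ballDeriv (hf : FlatOnBall f) : FlatOnBall (ballDeriv f) := by
  refine ⟨hf.smooth.fderivWithin (uniqueDiffOn_cball m unitRadius) (by exact_mod_cast le_top),
    fun i => ?_⟩
  have := norm_iteratedFDerivWithin_ballDeriv f i (zero_mem_cball m unitRadius)
  rw [hf.flat, norm_zero] at this
  exact norm_eq_zero.1 this

theorem FlatOnBall.apply_zero (hf : FlatOnBall f) : f 0 = 0 := by
  have := norm_iteratedFDerivWithin_zero (𝕜 := ℝ) (f := f) (s := cball m unitRadius) (x := 0)
  rw [hf.flat, norm_zero] at this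
  exact norm_eq_zero.1 this.symm

theorem FlatOnBall.hasFDerivWithinAt (hf : FlatOnBall f) {x : E m} (hx : x ∈ cball m unitRadius) :
    HasFDerivWithinAt f (FlatSmoothing.ballDeriv f x) (cball m unitRadius) x :=
  ((hf.smooth.differentiableOn (by simp)) x hx).hasFDerivWithinAt

theorem FlatOnBall.exists_bound (hf : FlatOnBall f) :
    ∃ M, 0 ≤ M ∧ ∀ x ∈ cball m unitRadius, ‖f x‖ ≤ M := by
  obtain ⟨M, hM⟩ := (isCompact_closedBall (0 : E m) (unitRadius : ℝ)).exists_bound_of_continuousOn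
    hf.smooth.continuousOn
  exact ⟨max M 0, le_max_right _ _, fun x hx => (hM x hx).trans (le_max_left _ _)⟩

/-- While the factor is positive, the reflection is locally `x - μ (|x|² - 1) x` and this is the
chain rule. Once it has stopped, it is merely Lipschitz, but `f` and its derivative vanish at the
origin. So the composite is `o(x - x₀)`, and the formula holds with both sides zero. -/
theorem FlatOnBall.hasFDerivWithinAt_comp_reflection (hf : FlatOnBall f) {μ : ℝ} (hμ : 1 ≤ μ)
    {x₀ : E m} (hx₀ : 1 ≤ ‖x₀‖) :
    HasFDerivWithinAt (fun x => f (reflection μ x))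
      ((FlatSmoothing.ballDeriv f (reflection μ x₀)).comp
        (ContinuousLinearMap.id ℝ (E m) - μ • fderiv ℝ (sphereField m) x₀)) (exterior m) x₀ := by
  have hmaps : Set.MapsTo (reflection (m := m) μ) (exterior m) (cball m unitRadius) :=
    fun x hx => mem_unitBall.2 (norm_reflection_le_one hμ hx)
  rcases lt_or_ge 0 (1 - μ * (‖x₀‖ ^ 2 - 1)) with h | h
  · have hr : HasFDerivAt (fun x => x - μ • sphereField m x)
        (ContinuousLinearMap.id ℝ (E m) - μ • fderiv ℝ (sphereField m) x₀) x₀ :=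
      (hasFDerivAt_id x₀).sub
        (((contDiff_sphereField.differentiable (by simp)) x₀).hasFDerivAt.const_smul μ)
    have he : reflection μ =ᶠ[nhds x₀] fun x => x - μ • sphereField m x := by
      have hc : Continuous fun x : E m => 1 - μ * (‖x‖ ^ 2 - 1) := by fun_prop
      filter_upwards [(isOpen_lt continuous_const hc).mem_nhds h] with x hx
      rw [reflection, reflectionFactor, max_eq_right (le_of_lt hx), sphereField, sub_smul, one_smul,
        smul_smul]
    exact (hf.hasFDerivWithinAt (hmaps hx₀)).comp x₀
      (hr.congr_of_eventuallyEq he).hasFDerivWithinAt hmaps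
  · have h0 : reflection μ x₀ = 0 := by
      rw [reflection, reflectionFactor, max_eq_left h, zero_smul]
    have hz := hf.hasFDerivWithinAt (zero_mem_cball m unitRadius)
    rw [h0]
    rw [hf.ballDeriv.apply_zero] at hz ⊢
    rw [ContinuousLinearMap.zero_comp]
    have hO : (fun x => reflection μ x - 0) =O[nhdsWithin x₀ (exterior m)] fun x => x - x₀ := by
      refine Asymptotics.IsBigO.of_bound (μ * (1 + (2 * ‖x₀‖ + 1) * ‖x₀‖)) ?_
      filter_upwards [self_mem_nhdsWithin,
        mem_nhdsWithin_of_mem_nhds (Metric.closedBall_mem_nhds x₀ one_pos)] with x hx hx'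
      have := norm_reflection_sub_le hμ hx (by rwa [← dist_eq_norm])
      rw [h0] at this
      linarith
    have ht : Filter.Tendsto (reflection μ) (nhdsWithin x₀ (exterior m))
        (nhdsWithin 0 (cball m unitRadius)) := by
      refine tendsto_nhdsWithin_iff.2 ⟨?_, ?_⟩
      · have h1 : Filter.Tendsto (fun x : E m => x - x₀) (nhdsWithin x₀ (exterior m)) (nhds 0) := by
          have : Filter.Tendsto (fun x : E m => x - x₀) (nhds x₀) (nhds (x₀ - x₀)) :=
            (continuous_id.sub continuous_const).tendsto x₀
          rw [sub_self] at this
          exact this.mono_left nhdsWithin_le_nhds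
        have := hO.trans_tendsto h1
        simpa using this
      · filter_upwards [self_mem_nhdsWithin] with x hx using hmaps hx
    rw [hasFDerivWithinAt_iff_isLittleO] at hz ⊢
    have := (hz.comp_tendsto ht).trans_isBigO hO
    simpa [Function.comp_def, h0] using this

end Reflection

/-! ### The Seeley continuation and its derivatives -/

section Glue

variable {m : ℕ} {V : Type} [NormedAddCommGroup V] [NormedSpace ℝ V]

/-- The Seeley series, with weights `(2^j)^p`. -/
def seeleySeries (a : ℕ → ℝ) (f : E m → V) (p : ℕ) (x : E m) : V :=
  ∑' j : ℕ, (a j * (2 ^ j) ^ p) • f (reflection (2 ^ j) x)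

open Classical in
/-- The function on the ball (for `p = 0`, and zero for `p > 0`), continued by the Seeley series. -/
def glue (a : ℕ → ℝ) (f : E m → V) (p : ℕ) (x : E m) : V :=
  if ‖x‖ ≤ 1 then (if p = 0 then f x else 0) else seeleySeries a f p x

theorem one_le_two_pow_real (j : ℕ) : (1 : ℝ) ≤ 2 ^ j := one_le_pow₀ (by norm_num)

variable {a : ℕ → ℝ} {f : E m → V}

theorem glue_of_norm_le {p : ℕ} {x : E m} (hx : ‖x‖ ≤ 1) :
    glue a f p x = if p = 0 then f x else 0 := if_pos hx

theorem summable_seeley [CompleteSpace V] (ha : IsSeeley a) (p : ℕ) {M : ℝ} {v : ℕ → V} (hv : ∀ j, ‖v j‖ ≤ M) :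
    Summable fun j => (a j * (2 ^ j) ^ p) • v j := by
  refine Summable.of_norm_bounded ((ha.summable p).mul_right M) fun j => ?_
  rw [norm_smul, Real.norm_eq_abs]
  gcongr
  exact hv j

theorem norm_tsum_seeley_le (ha : IsSeeley a) (p : ℕ) {M : ℝ} {v : ℕ → V} (hv : ∀ j, ‖v j‖ ≤ M) :
    ‖∑' j, (a j * (2 ^ j) ^ p) • v j‖ ≤ (∑' j, |a j * (2 ^ j) ^ p|) * M := by
  refine tsum_of_norm_bounded ((ha.summable p).hasSum.mul_right M) fun j => ?_
  rw [norm_smul, Real.norm_eq_abs]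
  gcongr
  exact hv j

/-- On the sphere all reflections fix `x` and the series collapses to a moment of the coefficients.
So the two definitions agree there, which also explains the value zero inside the ball for `p > 0`.
-/
theorem glue_of_le_norm (ha : IsSeeley a) {p : ℕ} {x : E m} (hx : 1 ≤ ‖x‖) :
    glue a f p x = seeleySeries a f p x := by
  rcases hx.eq_or_lt with h | h
  · rw [glue_of_norm_le h.symm.le, seeleySeries]
    simp_rw [reflection_of_norm_eq_one h.symm]
    rw [(ha.summable p).of_abs.tsum_smul_const, ha.moment]
    split_ifs <;> simp
  · exact if_neg (not_le.2 h)

theorem glue_eq_zero (ha : IsSeeley a) (hf : FlatOnBall f) {p : ℕ} {x : E m} (hx : 2 ≤ ‖x‖) :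
    glue a f p x = 0 := by
  rw [glue_of_le_norm ha (by linarith), seeleySeries]
  simp_rw [reflection_eq_zero (one_le_two_pow_real _) hx, hf.apply_zero, smul_zero]
  exact tsum_zero

theorem norm_glue_le (ha : IsSeeley a) (p : ℕ) {M : ℝ} (hM : ∀ x ∈ cball m unitRadius, ‖f x‖ ≤ M)
    (x : E m) : ‖glue a f p x‖ ≤ (1 + ∑' j, |a j * (2 ^ j) ^ p|) * M := by
  have hM0 : 0 ≤ M := (norm_nonneg _).trans (hM 0 (zero_mem_cball m unitRadius))
  have hs : 0 ≤ ∑' j, |a j * (2 ^ j) ^ p| := tsum_nonneg fun _ => abs_nonneg _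
  rw [add_mul, one_mul]
  rcases le_total ‖x‖ 1 with hx | hx
  · rw [glue_of_norm_le hx]
    split_ifs
    · exact (hM x (mem_unitBall.2 hx)).trans (le_add_of_nonneg_right (by positivity))
    · rw [norm_zero]
      positivity
  · rw [glue_of_le_norm ha hx]
    refine (norm_tsum_seeley_le ha p fun j => hM _ (mem_unitBall.2
      (norm_reflection_le_one (one_le_two_pow_real j) hx))).trans (le_add_of_nonneg_left hM0)

/-- The derivative of `glue`. -/
def glueDeriv (a : ℕ → ℝ) (f : E m → V) (p : ℕ) (x : E m) : E m →L[ℝ] V :=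
  glue a (ballDeriv f) p x - (glue a (ballDeriv f) (p + 1) x).comp (fderiv ℝ (sphereField m) x)

variable [CompleteSpace V]

/-- The derivative of the reflection with parameter `2 ^ j` is affine in `2 ^ j`. Differentiating
therefore stays within the family, with weights `p` and `p + 1` and with `f` replaced by its
derivative. -/
theorem FlatOnBall.hasFDerivWithinAt_seeleySeries (ha : IsSeeley a) (hf : FlatOnBall f) (p : ℕ)
    {x₀ : E m} (hx₀ : 1 ≤ ‖x₀‖) :
    HasFDerivWithinAt (seeleySeries a f p) (glueDeriv a f p x₀) (exterior m) x₀ := by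
  obtain ⟨M₀, hM₀, hb₀⟩ := hf.exists_bound
  obtain ⟨M, hM, hb⟩ := hf.ballDeriv.exists_bound
  have hmem : ∀ j : ℕ, ∀ x : E m, 1 ≤ ‖x‖ → reflection (2 ^ j) x ∈ cball m unitRadius :=
    fun j x hx => mem_unitBall.2 (norm_reflection_le_one (one_le_two_pow_real j) hx)
  set W := ‖fderiv ℝ (sphereField m) x₀‖
  set D := 1 + (2 * ‖x₀‖ + 1) * ‖x₀‖
  have hD : 1 ≤ D := le_add_of_nonneg_right (by positivity)
  have hW : 0 ≤ W := norm_nonneg _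
  -- The Lipschitz constants of the reflections grow like `2 ^ j`, so the dominating series uses the
  -- weight `p + 1`.
  set B : ℕ → ℝ := fun j => |a j * (2 ^ j) ^ (p + 1)| * (M * (D + W))
  have hB : Summable B := (ha.summable (p + 1)).mul_right _
  have hpow : ∀ j : ℕ, |a j * (2 ^ j) ^ (p + 1)| = |a j * (2 ^ j) ^ p| * 2 ^ j := by
    intro j
    rw [pow_succ, ← mul_assoc, abs_mul, abs_of_pos (pow_pos (by norm_num : (0 : ℝ) < 2) j)]
  have key := hasFDerivWithinAt_tsum_of_lipschitz
    (g := fun j x => (a j * (2 ^ j) ^ p) • f (reflection (2 ^ j) x))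
    (g' := fun j => (a j * (2 ^ j) ^ p) • (FlatSmoothing.ballDeriv f (reflection (2 ^ j) x₀)).comp
      (ContinuousLinearMap.id ℝ (E m) - (2 : ℝ) ^ j • fderiv ℝ (sphereField m) x₀))
    (s := exterior m) (x₀ := x₀) (B := B) hB
    (fun j => (hf.hasFDerivWithinAt_comp_reflection (one_le_two_pow_real j) hx₀).const_smul _)
    ?_ ?_ (fun x hx => summable_seeley ha p fun j => hb₀ _ (hmem j x hx)) hx₀
  · have e : glueDeriv a f p x₀ = ∑' j, (a j * (2 ^ j) ^ p) •
        (FlatSmoothing.ballDeriv f (reflection (2 ^ j) x₀)).comp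
          (ContinuousLinearMap.id ℝ (E m) - (2 : ℝ) ^ j • fderiv ℝ (sphereField m) x₀) := ?_
    · rw [e]
      exact key
    rw [glueDeriv, glue_of_le_norm ha hx₀, glue_of_le_norm ha hx₀, seeleySeries, seeleySeries]
    have h1 : Summable fun j => (a j * (2 ^ j) ^ p) •
        FlatSmoothing.ballDeriv f (reflection (2 ^ j) x₀) :=
      summable_seeley ha p fun j => hb _ (hmem j x₀ hx₀)
    have h2 : Summable fun j => (a j * (2 ^ j) ^ (p + 1)) •
        FlatSmoothing.ballDeriv f (reflection (2 ^ j) x₀) :=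
      summable_seeley ha (p + 1) fun j => hb _ (hmem j x₀ hx₀)
    set T := (ContinuousLinearMap.compL ℝ (E m) (E m) V).flip (fderiv ℝ (sphereField m) x₀) with hT
    have hT' : ∀ L, T L = L.comp (fderiv ℝ (sphereField m) x₀) := fun L => rfl
    rw [← hT', T.map_tsum h2, ← h1.tsum_sub (T.summable h2)]
    refine tsum_congr fun j => ?_
    rw [hT', ContinuousLinearMap.smul_comp, ContinuousLinearMap.comp_sub, ContinuousLinearMap.comp_id,
      ContinuousLinearMap.comp_smul, smul_sub, smul_smul, pow_succ, mul_assoc]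
  · have hL : ∀ j : ℕ, ∀ x : E m, 1 ≤ ‖x‖ → ‖x - x₀‖ ≤ 1 →
        ‖f (reflection (2 ^ j) x) - f (reflection (2 ^ j) x₀)‖ ≤ M * (2 ^ j * (D * ‖x - x₀‖)) := by
      intro j x hx hxx
      refine ((convex_closedBall (0 : E m) (unitRadius : ℝ)).norm_image_sub_le_of_norm_fderivWithin_le
        (𝕜 := ℝ) (hf.smooth.differentiableOn (by simp)) hb (hmem j x₀ hx₀) (hmem j x hx)).trans ?_
      gcongr
      exact norm_reflection_sub_le (one_le_two_pow_real j) hx hxx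
    filter_upwards [self_mem_nhdsWithin,
      mem_nhdsWithin_of_mem_nhds (Metric.closedBall_mem_nhds x₀ one_pos)] with x hx hx' j
    rw [← smul_sub, norm_smul, Real.norm_eq_abs]
    have h3 := hL j x hx (by rwa [← dist_eq_norm])
    calc _ ≤ |a j * (2 ^ j) ^ p| * (M * (2 ^ j * (D * ‖x - x₀‖))) := by gcongr
      _ = |a j * (2 ^ j) ^ (p + 1)| * (M * D) * ‖x - x₀‖ := by rw [hpow]; ring
      _ ≤ |a j * (2 ^ j) ^ (p + 1)| * (M * (D + W)) * ‖x - x₀‖ := by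
          gcongr
          linarith
  · intro j
    rw [norm_smul, Real.norm_eq_abs]
    have h4 : ‖ContinuousLinearMap.id ℝ (E m) - (2 : ℝ) ^ j • fderiv ℝ (sphereField m) x₀‖ ≤
        2 ^ j * (D + W) := by
      refine (norm_sub_le _ _).trans ?_
      rw [norm_smul, norm_pow, Real.norm_ofNat, mul_add]
      gcongr
      refine ContinuousLinearMap.norm_id_le.trans ?_
      nlinarith [one_le_two_pow_real j]
    calc _ ≤ |a j * (2 ^ j) ^ p| * (M * (2 ^ j * (D + W))) := by
          gcongr
          refine (ContinuousLinearMap.opNorm_comp_le _ _).trans ?_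
          gcongr
          exact hb _ (hmem j x₀ hx₀)
      _ = _ := by
          simp only [B]
          rw [hpow]
          ring

/-- At a point of the sphere, `glueDeriv` is a derivative both within the ball and within the
exterior, which together cover the space. -/
theorem FlatOnBall.hasFDerivAt_glue (ha : IsSeeley a) (hf : FlatOnBall f) (p : ℕ) (x : E m) :
    HasFDerivAt (glue a f p) (glueDeriv a f p x) x := by
  have h1 : ‖x‖ ≤ 1 → HasFDerivWithinAt (glue a f p) (glueDeriv a f p x) (cball m unitRadius) x := by
    intro hx
    have hx' : x ∈ cball m unitRadius := mem_unitBall.2 hx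
    have e : glueDeriv a f p x = if p = 0 then FlatSmoothing.ballDeriv f x else 0 := by
      rw [glueDeriv, glue_of_norm_le hx, glue_of_norm_le hx, if_neg (Nat.succ_ne_zero p),
        ContinuousLinearMap.zero_comp, sub_zero]
    rw [e]
    have hc : ∀ y ∈ cball m unitRadius, glue a f p y = if p = 0 then f y else 0 :=
      fun y hy => glue_of_norm_le (mem_unitBall.1 hy)
    split_ifs with hp
    · simp only [hp, if_true] at hc ⊢
      exact (hf.hasFDerivWithinAt hx').congr hc (hc x hx')
    · simp only [hp, if_false] at hc
      exact (hasFDerivWithinAt_const (0 : V) x _).congr hc (hc x hx')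
  have h2 : 1 ≤ ‖x‖ → HasFDerivWithinAt (glue a f p) (glueDeriv a f p x) (exterior m) x := fun hx =>
    (hf.hasFDerivWithinAt_seeleySeries ha p hx).congr (fun y hy => glue_of_le_norm ha hy)
      (glue_of_le_norm ha hx)
  rcases lt_trichotomy ‖x‖ 1 with h | h | h
  · refine (h1 h.le).hasFDerivAt ?_
    filter_upwards [(isOpen_lt continuous_norm continuous_const).mem_nhds h] with y hy
    exact mem_unitBall.2 (le_of_lt hy)
  · have := (h1 h.le).union (h2 h.ge)
    have hu : cball m unitRadius ∪ exterior m = Set.univ := by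
      ext y
      simp only [Set.mem_union, mem_unitBall, Set.mem_ofPred_eq, Set.mem_univ, iff_true]
      exact le_total _ _
    rwa [hu, hasFDerivWithinAt_univ] at this
  · refine (h2 h.le).hasFDerivAt ?_
    filter_upwards [(isOpen_lt continuous_const continuous_norm).mem_nhds h] with y hy
    exact le_of_lt hy

/-- Since `glueDeriv` is built from `glue` applied to the derivative of `f`, induction on the order
works once `f`, its target space and `p` all vary. -/
theorem contDiff_glue_nat (ha : IsSeeley a) (n : ℕ) : ∀ {V : Type} [NormedAddCommGroup V]
    [NormedSpace ℝ V] [CompleteSpace V] {f : E m → V}, FlatOnBall f → ∀ p,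
      ContDiff ℝ n (glue a f p) := by
  induction n with
  | zero =>
    intro V _ _ _ f hf p
    refine contDiff_zero.2 (continuous_iff_continuousAt.2 fun x => ?_)
    exact (hf.hasFDerivAt_glue ha p x).continuousAt
  | succ n ih =>
    intro V _ _ _ f hf p
    refine contDiff_succ_iff_hasFDerivAt.2 ⟨glueDeriv a f p, ?_, hf.hasFDerivAt_glue ha p⟩
    exact (ih hf.ballDeriv p).sub ((ih hf.ballDeriv (p + 1)).clm_comp
      (contDiff_sphereField.fderiv_right (m := n) (by exact_mod_cast le_top)))

theorem contDiff_glue (ha : IsSeeley a) (hf : FlatOnBall f) (p : ℕ) : ContDiff ℝ ∞ (glue a f p) :=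
  contDiff_infty.2 fun n => contDiff_glue_nat ha n hf p

/-- The derivatives of the extension are bounded by those of the function on the ball. -/
theorem exists_norm_iteratedFDeriv_glue_le (ha : IsSeeley a) (n : ℕ) : ∀ p, ∃ C : ℝ, 0 ≤ C ∧
    ∀ {V : Type} [NormedAddCommGroup V] [NormedSpace ℝ V] [CompleteSpace V] {f : E m → V},
      FlatOnBall f → ∀ M : ℝ, (∀ i ≤ n, ∀ x ∈ cball m unitRadius,
        ‖iteratedFDerivWithin ℝ i f (cball m unitRadius) x‖ ≤ M) →
      ∀ i ≤ n, ∀ x : E m, ‖x‖ ≤ 2 → ‖iteratedFDeriv ℝ i (glue a f p) x‖ ≤ C * M := by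
  have base : ∀ p, 0 ≤ 1 + ∑' j, |a j * (2 ^ j) ^ p| := fun p =>
    add_nonneg zero_le_one (tsum_nonneg fun _ => abs_nonneg _)
  induction n with
  | zero =>
    intro p
    refine ⟨_, base p, fun {V} _ _ _ {f} hf M hM i hi x _ => ?_⟩
    rw [Nat.le_zero.1 hi, norm_iteratedFDeriv_zero]
    refine norm_glue_le ha p (fun y hy => ?_) x
    simpa using hM 0 le_rfl y hy
  | succ n ih =>
    intro p
    -- The derivative involves the weights `p` and `p + 1` and operator-valued functions, so the
    -- constant is chosen before the target space and the function.
    obtain ⟨C₀, hC₀, h₀⟩ := ih p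
    obtain ⟨C₁, hC₁, h₁⟩ := ih (p + 1)
    have hw : ContDiff ℝ ∞ (fderiv ℝ (sphereField m)) :=
      contDiff_sphereField.fderiv_right (by exact_mod_cast le_top)
    have hW : ∃ W : ℝ, 0 ≤ W ∧ ∀ i ≤ n, ∀ x : E m, ‖x‖ ≤ 2 →
        ‖iteratedFDeriv ℝ i (fderiv ℝ (sphereField m)) x‖ ≤ W := by
      have : ∀ i, ∃ W : ℝ, ∀ x ∈ Metric.closedBall (0 : E m) 2,
          ‖iteratedFDeriv ℝ i (fderiv ℝ (sphereField m)) x‖ ≤ W := fun i =>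
        (isCompact_closedBall _ _).exists_bound_of_continuousOn
          (hw.continuous_iteratedFDeriv (by exact_mod_cast le_top)).continuousOn
      choose W hW using this
      have hW0 : ∀ i, 0 ≤ W i := fun i =>
        (norm_nonneg _).trans (hW i 0 (Metric.mem_closedBall_self (by norm_num)))
      refine ⟨∑ i ∈ Finset.range (n + 1), W i, Finset.sum_nonneg fun i _ => hW0 i,
        fun i hi x hx => ?_⟩
      exact (hW i x (mem_closedBall_zero_iff.2 hx)).trans
        (Finset.single_le_sum (f := W) (fun i _ => hW0 i) (by simp; omega))
    obtain ⟨W, hW0, hW⟩ := hW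
    refine ⟨(1 + ∑' j, |a j * (2 ^ j) ^ p|) + (C₀ + 2 ^ n * (C₁ * W)),
      add_nonneg (base p) (by positivity), fun {V} _ _ _ {f} hf M hM i hi x hx => ?_⟩
    have hM0 : 0 ≤ M := (norm_nonneg _).trans (hM 0 (Nat.zero_le _) 0 (zero_mem_cball m unitRadius))
    rw [add_mul]
    cases i with
    | zero =>
      rw [norm_iteratedFDeriv_zero]
      refine (norm_glue_le ha p (fun y hy => ?_) x).trans (le_add_of_nonneg_right (by positivity))
      simpa using hM 0 (Nat.zero_le _) y hy
    | succ i =>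
      have hi' : i ≤ n := Nat.le_of_succ_le_succ hi
      refine le_trans ?_ (le_add_of_nonneg_left (mul_nonneg (base p) hM0))
      have hM' : ∀ i ≤ n, ∀ x ∈ cball m unitRadius,
          ‖iteratedFDerivWithin ℝ i (ballDeriv f) (cball m unitRadius) x‖ ≤ M := fun i hi x hx => by
        rw [norm_iteratedFDerivWithin_ballDeriv f i hx]
        exact hM (i + 1) (Nat.succ_le_succ hi) x hx
      have e : fderiv ℝ (glue a f p) = glue a (ballDeriv f) p -
          fun x => ContinuousLinearMap.compL ℝ (E m) (E m) V (glue a (ballDeriv f) (p + 1) x)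
            (fderiv ℝ (sphereField m) x) := by
        ext1 y
        exact (hf.hasFDerivAt_glue ha p y).fderiv
      have hs0 := contDiff_glue ha hf.ballDeriv p
      have hs1 := contDiff_glue ha hf.ballDeriv (p + 1)
      have hs2 : ContDiff ℝ ∞ fun x => ContinuousLinearMap.compL ℝ (E m) (E m) V
          (glue a (ballDeriv f) (p + 1) x) (fderiv ℝ (sphereField m) x) := hs1.clm_comp hw
      rw [← norm_iteratedFDeriv_fderiv, e, iteratedFDeriv_sub_apply
        (hs0.contDiffAt.of_le (by exact_mod_cast le_top))
        (hs2.contDiffAt.of_le (by exact_mod_cast le_top))]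
      refine (norm_sub_le _ _).trans ?_
      rw [add_mul]
      refine add_le_add (h₀ hf.ballDeriv M hM' i hi' x hx) ?_
      have hbil := ContinuousLinearMap.norm_iteratedFDeriv_le_of_bilinear_of_le_one
        (ContinuousLinearMap.compL ℝ (E m) (E m) V) hs1 hw x (n := i)
        (by exact_mod_cast le_top) (ContinuousLinearMap.norm_compL_le ℝ (E m) (E m) V)
      refine hbil.trans ?_
      calc _ ≤ ∑ q ∈ Finset.range (i + 1), (i.choose q : ℝ) * (C₁ * M * W) := by
            refine Finset.sum_le_sum fun q hq => ?_
            have hq' : q ≤ n := by simp at hq; omega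
            rw [mul_assoc]
            gcongr
            · exact h₁ hf.ballDeriv M hM' q hq' x hx
            · exact hW _ (by omega) x hx
        _ = 2 ^ i * (C₁ * M * W) := by
            rw [← Finset.sum_mul]
            congr 1
            exact_mod_cast Nat.sum_range_choose i
        _ ≤ 2 ^ n * (C₁ * M * W) := by
            gcongr
            norm_num
        _ = _ := by ring

end Glue

/-! ### Seeley's extension operator -/

section Extension

variable {m : ℕ} {a : ℕ → ℝ}

theorem flatOnBall_of_flatFun (f : FlatFun m unitRadius) : FlatOnBall (f : E m → ℂ) :=
  ⟨f.2.1, fun i => multilinear_eq_zero_of_basis _ fun v => f.2.2.1 i v⟩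

theorem hasCompactSupport_glue (ha : IsSeeley a) (f : FlatFun m unitRadius) :
    HasCompactSupport (glue a (f : E m → ℂ) 0) :=
  HasCompactSupport.intro (isCompact_closedBall (0 : E m) 2) fun x hx =>
    glue_eq_zero ha (flatOnBall_of_flatFun f)
      (le_of_lt (by simpa only [mem_closedBall_zero_iff, not_le] using hx))

theorem iteratedFDeriv_glue_eq (ha : IsSeeley a) (f : FlatFun m unitRadius) (i : ℕ) {x : E m}
    (hx : x ∈ cball m unitRadius) : iteratedFDeriv ℝ i (glue a (f : E m → ℂ) 0) x =
      iteratedFDerivWithin ℝ i (f : E m → ℂ) (cball m unitRadius) x := by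
  refine (iteratedFDerivWithin_eq_of_eqOn (contDiff_glue ha (flatOnBall_of_flatFun f) 0)
    (fun y hy => ?_) hx i).symm
  rw [glue_of_norm_le (mem_unitBall.1 hy), if_pos rfl]

theorem summable_seeley_flatFun (ha : IsSeeley a) (f : FlatFun m unitRadius) {x : E m}
    (hx : 1 ≤ ‖x‖) :
    Summable fun j : ℕ => (a j * (2 ^ j) ^ 0) • (f : E m → ℂ) (reflection (2 ^ j) x) := by
  obtain ⟨M, _, hM⟩ := (flatOnBall_of_flatFun f).exists_bound
  exact summable_seeley ha 0 fun j => hM _ (mem_unitBall.2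
    (norm_reflection_le_one (one_le_two_pow_real j) hx))

/-- Seeley's extension operator for flat functions on the unit ball. -/
def seeleyExtension (ha : IsSeeley a) : FlatFun m unitRadius →ₗ[ℂ] FlatSchwartz m where
  toFun f := ⟨(hasCompactSupport_glue ha f).toSchwartzMap
    (contDiff_glue ha (flatOnBall_of_flatFun f) 0), fun i v => by
      change pderiv Set.univ (glue a (f : E m → ℂ) 0) v 0 = 0
      rw [pderiv, iteratedFDerivWithin_univ, iteratedFDeriv_glue_eq ha f i (zero_mem_cball m _)]
      exact f.2.2.1 i v⟩
  map_add' f g := by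
    refine Subtype.ext (SchwartzMap.ext fun x => ?_)
    change glue a ((f : E m → ℂ) + (g : E m → ℂ)) 0 x = glue a (f : E m → ℂ) 0 x + glue a (g : E m → ℂ) 0 x
    rcases le_total ‖x‖ 1 with hx | hx
    · simp [glue_of_norm_le hx]
    · simp only [glue_of_le_norm ha hx, seeleySeries]
      rw [← (summable_seeley_flatFun ha f hx).tsum_add (summable_seeley_flatFun ha g hx)]
      simp
  map_smul' c f := by
    refine Subtype.ext (SchwartzMap.ext fun x => ?_)
    change glue a (c • (f : E m → ℂ)) 0 x = c • glue a (f : E m → ℂ) 0 x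
    rcases le_total ‖x‖ 1 with hx | hx
    · simp [glue_of_norm_le hx]
    · simp only [glue_of_le_norm ha hx, seeleySeries]
      rw [← (summable_seeley_flatFun ha f hx).tsum_const_smul]
      refine tsum_congr fun j => ?_
      rw [Pi.smul_apply, smul_comm]

theorem coe_seeleyExtension (ha : IsSeeley a) (f : FlatFun m unitRadius) :
    ((seeleyExtension ha f : 𝓢(E m, ℂ)) : E m → ℂ) = glue a (f : E m → ℂ) 0 := rfl

theorem isFlatExtension_seeleyExtension (ha : IsSeeley a) :
    IsFlatExtension (seeleyExtension (m := m) ha) where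
  extends_ball f x hx := by
    rw [coe_seeleyExtension, glue_of_norm_le (mem_unitBall.1 hx), if_pos rfl]
  supported := ⟨2, fun f x hx => glue_eq_zero ha (flatOnBall_of_flatFun f) hx.le⟩
  bounded n k := by
    obtain ⟨C, hC0, hC⟩ := exists_norm_iteratedFDeriv_glue_le (m := m) ha n 0
    refine ⟨(1 + C) * (m + 1) ^ n, fun f => ?_⟩
    -- Finiteness of the norm is deduced from this extension later and cannot be used here. An
    -- infinite norm makes the claim trivial because the constant is positive.
    rcases eq_or_ne (flatNorm n k unitRadius (f : E m → ℂ)) ⊤ with h | h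
    · rw [h, ENNReal.mul_top]
      · exact le_top
      · exact (ENNReal.ofReal_pos.2 (by positivity)).ne'
    set A := (flatNorm n k unitRadius (f : E m → ℂ)).toReal
    have hA : 0 ≤ A := ENNReal.toReal_nonneg
    have hfA : flatNorm n k unitRadius (f : E m → ℂ) = ENNReal.ofReal A :=
      (ENNReal.ofReal_toReal h).symm
    rw [hfA, ← ENNReal.ofReal_mul (by positivity), coe_seeleyExtension]
    have hfo := flatOnBall_of_flatFun f
    have hm : ∀ i ≤ n, (m : ℝ) ^ i ≤ (m + 1) ^ n := fun i hi =>
      (pow_le_pow_left₀ (by positivity) (by linarith) _).trans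
        (pow_le_pow_right₀ (by linarith [(Nat.cast_nonneg m : (0 : ℝ) ≤ m)]) hi)
    have h1 : ∀ i ≤ n, ∀ x ∈ cball m unitRadius, x ≠ 0 →
        ‖iteratedFDerivWithin ℝ i (f : E m → ℂ) (cball m unitRadius) x‖ ≤
          (m + 1) ^ n * A * ‖x‖ ^ k := by
      intro i hi x hx hx0
      refine (norm_iteratedFDerivWithin_le_of_flatNorm_le hA hfA.le hx hx0 hi).trans ?_
      rw [mul_assoc]
      gcongr
      exact hm i hi
    have h2 : ∀ i ≤ n, ∀ x ∈ cball m unitRadius,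
        ‖iteratedFDerivWithin ℝ i (f : E m → ℂ) (cball m unitRadius) x‖ ≤ (m + 1) ^ n * A := by
      intro i hi x hx
      rcases eq_or_ne x 0 with rfl | hx0
      · rw [hfo.flat, norm_zero]
        positivity
      · refine (h1 i hi x hx hx0).trans (mul_le_of_le_one_right (by positivity) ?_)
        exact pow_le_one₀ (norm_nonneg _) (mem_unitBall.1 hx)
    refine globalFlatNorm_le_ofReal fun x hx0 i hi l hl => ?_
    -- Inside the ball the highest weight `k` dominates all `l ≤ k`. Outside, the factor `‖x‖ ^ l`
    -- is at least `1` and unweighted bounds suffice.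
    rcases le_or_gt ‖x‖ 1 with hx | hx
    · have hx' : x ∈ cball m unitRadius := mem_unitBall.2 hx
      rw [iteratedFDeriv_glue_eq ha f i hx']
      calc _ ≤ 1 * (m + 1) ^ n * A * ‖x‖ ^ k := by
            rw [one_mul]
            exact h1 i hi x hx' hx0
        _ ≤ _ := by
            gcongr ?_ * _ * _ * ?_
            · linarith
            · exact pow_le_pow_of_le_one (norm_nonneg _) hx hl
    · have hx1 : 1 ≤ ‖x‖ ^ l := one_le_pow₀ hx.le
      rcases le_or_gt ‖x‖ 2 with hx2 | hx2
      · calc _ ≤ C * ((m + 1) ^ n * A) := hC hfo _ h2 i hi x hx2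
          _ ≤ (1 + C) * ((m + 1) ^ n * A) * 1 := by
              rw [mul_one]
              gcongr
              linarith
          _ ≤ (1 + C) * ((m + 1) ^ n * A) * ‖x‖ ^ l := by gcongr
          _ = _ := by ring
      · have : glue a (f : E m → ℂ) 0 =ᶠ[nhds x] fun _ => 0 := by
          filter_upwards [(isOpen_lt continuous_const continuous_norm).mem_nhds hx2] with y hy
          exact glue_eq_zero ha hfo (le_of_lt hy)
        rw [(this.iteratedFDeriv ℝ i).self_of_nhds]
        simp only [iteratedFDeriv_fun_zero, norm_zero, Pi.zero_apply]
        positivity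
  real_valued f hf x := by
    rw [coe_seeleyExtension]
    rcases le_total ‖x‖ 1 with hx | hx
    · rw [glue_of_norm_le hx, if_pos rfl, hf]
    · rw [glue_of_le_norm ha hx, seeleySeries, ← Complex.conj_eq_iff_im, Complex.conj_tsum]
      refine tsum_congr fun j => ?_
      rw [Complex.real_smul, map_mul, Complex.conj_ofReal, Complex.conj_eq_iff_im.2 (hf _)]

end Extension

/-! ### Cutoff functions and the weighted Leibniz rule -/

section Cutoffs

variable {m : ℕ}

theorem exists_isNashCutoff : ∃ χ, IsNashCutoff χ := by
  refine ⟨fun u => Real.smoothTransition (2 - u), ?_, fun u hu => ?_, fun u _ v _ huv => ?_,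
    fun u hu => ?_⟩
  · exact Real.smoothTransition.contDiff.comp (contDiff_const.sub contDiff_id)
  · exact Real.smoothTransition.one_of_one_le (by linarith)
  · exact Real.smoothTransition.monotone (by linarith)
  · exact Real.smoothTransition.zero_of_nonpos (by linarith)

theorem exists_isWeightCutoff : ∃ ψ, IsWeightCutoff ψ := by
  refine ⟨fun u => Real.smoothTransition (u - 1), ?_, fun u hu => ?_, fun u hu => ?_⟩
  · exact Real.smoothTransition.contDiff.comp (contDiff_id.sub contDiff_const)
  · exact Real.smoothTransition.zero_of_nonpos (by linarith)
  · exact Real.smoothTransition.one_of_one_le (by linarith)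

variable {ψ : ℝ → ℝ}

/-- The radial cutoff function `ψ(|x|)`. -/
def radialCutoff (m : ℕ) (ψ : ℝ → ℝ) (x : E m) : ℂ := (ψ ‖x‖ : ℂ)

theorem IsWeightCutoff.contDiff_radialCutoff (hψ : IsWeightCutoff ψ) :
    ContDiff ℝ ∞ (radialCutoff m ψ) := by
  refine contDiff_iff_contDiffAt.2 fun x => ?_
  rcases eq_or_ne x 0 with rfl | hx
  · refine (contDiffAt_const (c := (0 : ℂ))).congr_of_eventuallyEq ?_
    filter_upwards [Metric.closedBall_mem_nhds (0 : E m) one_pos] with y hy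
    rw [radialCutoff, hψ.eq_zero _ (mem_closedBall_zero_iff.1 hy), Complex.ofReal_zero]
  · exact Complex.ofRealCLM.contDiff.contDiffAt.comp x
      (hψ.smooth.contDiffAt.comp x (contDiffAt_norm ℝ hx))

theorem IsWeightCutoff.hasCompactSupport_one_sub (hψ : IsWeightCutoff ψ) :
    HasCompactSupport fun x : E m => 1 - radialCutoff m ψ x :=
  HasCompactSupport.intro (isCompact_closedBall (0 : E m) 2) fun x hx => by
    rw [radialCutoff, hψ.eq_one _ (le_of_lt (by simpa using hx)), Complex.ofReal_one, sub_self]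

/-- The function is smooth with compact support. Pairing `‖x‖ ^ c` with the derivative of order `c`
makes the bound scale invariant, hence usable for all `s` at once. -/
theorem IsWeightCutoff.exists_decay (hψ : IsWeightCutoff ψ) (m n j : ℕ) :
    ∃ B : ℝ, 0 ≤ B ∧ ∀ c ≤ n, ∀ x : E m,
      ‖x‖ ^ c * ‖iteratedFDeriv ℝ c (fun x : E m => 1 - radialCutoff m ψ x) x‖ * ‖x‖ ^ j ≤ B := by
  choose S hS using fun c => (hψ.hasCompactSupport_one_sub (m := m).toSchwartzMap
    (contDiff_const.sub hψ.contDiff_radialCutoff)).decay (c + j) c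
  refine ⟨∑ c ∈ Finset.range (n + 1), S c, Finset.sum_nonneg fun c _ => (hS c).1.le,
    fun c hc x => ?_⟩
  refine le_trans ?_ (Finset.single_le_sum (f := S) (fun c _ => (hS c).1.le)
    (show c ∈ Finset.range (n + 1) by simp; omega))
  refine le_trans (le_of_eq ?_) ((hS c).2 x)
  rw [pow_add, mul_right_comm]
  rfl

/-- For `‖x‖ < 1` the cutoff vanishes locally, and elsewhere `‖x‖ ^ j ≥ 1`. Hence any power `j` may
be inserted, which is the source of `s ^ j`. -/
theorem IsWeightCutoff.exists_growth (hψ : IsWeightCutoff ψ) (m n j : ℕ) :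
    ∃ B : ℝ, 0 ≤ B ∧ ∀ c ≤ n, ∀ x : E m,
      ‖x‖ ^ c * ‖iteratedFDeriv ℝ c (radialCutoff m ψ) x‖ ≤ B * ‖x‖ ^ j := by
  obtain ⟨B, hB0, hB⟩ := hψ.exists_decay m n 0
  refine ⟨1 + B, by positivity, fun c hc x => ?_⟩
  rcases lt_or_ge ‖x‖ 1 with hx | hx
  · have : radialCutoff m ψ =ᶠ[nhds x] fun _ => 0 := by
      filter_upwards [(isOpen_lt continuous_norm continuous_const).mem_nhds hx] with y hy
      rw [radialCutoff, hψ.eq_zero _ (le_of_lt hy), Complex.ofReal_zero]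
    rw [(this.iteratedFDeriv ℝ c).self_of_nhds]
    simp only [iteratedFDeriv_fun_zero, norm_zero, Pi.zero_apply, mul_zero]
    positivity
  · have h1 : radialCutoff m ψ = (fun _ => (1 : ℂ)) - fun x => 1 - radialCutoff m ψ x := by
      ext y
      simp
    have h2 : ContDiff ℝ ∞ fun x : E m => 1 - radialCutoff m ψ x :=
      contDiff_const.sub hψ.contDiff_radialCutoff
    have h3 : ‖x‖ ^ c * ‖iteratedFDeriv ℝ c (fun _ : E m => (1 : ℂ)) x‖ ≤ 1 := by
      rcases eq_or_ne c 0 with rfl | h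
      · simp
      · rw [iteratedFDeriv_const_of_ne h]
        simp
    have h4 := hB c hc x
    rw [pow_zero, mul_one] at h4
    have h5 : ‖x‖ ^ c * ‖iteratedFDeriv ℝ c (radialCutoff m ψ) x‖ ≤ 1 + B := by
      rw [h1, iteratedFDeriv_sub_apply contDiffAt_const
        (h2.contDiffAt.of_le (by exact_mod_cast le_top))]
      calc _ ≤ ‖x‖ ^ c * (‖iteratedFDeriv ℝ c (fun _ : E m => (1 : ℂ)) x‖ +
            ‖iteratedFDeriv ℝ c (fun x : E m => 1 - radialCutoff m ψ x) x‖) := by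
            gcongr
            exact norm_sub_le _ _
        _ ≤ _ := by
            rw [mul_add]
            exact add_le_add h3 h4
    exact h5.trans (le_mul_of_one_le_right (by positivity) (one_le_pow₀ hx))

theorem pow_mul_norm_iteratedFDeriv_comp_smul_le {θ : E m → ℂ} {s : ℝ} (hs : 0 < s) (c : ℕ)
    (x : E m) : ‖x‖ ^ c * ‖iteratedFDeriv ℝ c (fun z => θ (s • z)) x‖ ≤
      ‖s • x‖ ^ c * ‖iteratedFDeriv ℝ c θ (s • x)‖ := by
  rw [norm_smul, Real.norm_eq_abs, abs_of_pos hs, mul_pow]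
  calc _ ≤ ‖x‖ ^ c * (s ^ c * ‖iteratedFDeriv ℝ c θ (s • x)‖) := by
        gcongr
        exact norm_iteratedFDeriv_comp_smul_le θ hs c x
    _ = _ := by ring

/-- The Leibniz rule with weights at the origin. -/
theorem norm_iteratedFDeriv_mul_weighted_le {θ G : E m → ℂ} (hθ : ContDiff ℝ ∞ θ)
    (hG : ContDiff ℝ ∞ G) {x : E m} (hx : x ≠ 0) (hx1 : ‖x‖ ≤ 1) {n k : ℕ} {b A : ℝ}
    (hb : ∀ c ≤ n, ‖x‖ ^ c * ‖iteratedFDeriv ℝ c θ x‖ ≤ b)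
    (hA : ∀ a ≤ n, ‖iteratedFDeriv ℝ a G x‖ ≤ A * ‖x‖ ^ (k + (n - a))) {a : ℕ} (ha : a ≤ n) :
    ‖iteratedFDeriv ℝ a (fun x => θ x * G x) x‖ ≤ 2 ^ n * b * A * ‖x‖ ^ k := by
  have hx' : 0 < ‖x‖ := norm_pos_iff.2 hx
  have hb0 : 0 ≤ b := le_trans (by positivity) (hb 0 (Nat.zero_le _))
  have hA0 : 0 ≤ A := by
    have := (norm_nonneg _).trans (hA 0 (Nat.zero_le _))
    exact nonneg_of_mul_nonneg_left this (by positivity)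
  refine (norm_iteratedFDeriv_mul_le hθ hG x (n := a) (by exact_mod_cast le_top)).trans ?_
  calc _ ≤ ∑ c ∈ Finset.range (a + 1), (a.choose c : ℝ) * (b * A * ‖x‖ ^ k) := by
        refine Finset.sum_le_sum fun c hc => ?_
        have hc' : c ≤ a := by simp at hc; omega
        rw [mul_assoc]
        refine mul_le_mul_of_nonneg_left ?_ (by positivity)
        have h1 := hb c (hc'.trans ha)
        have h2 := hA (a - c) (by omega)
        -- Each of the `c` derivatives falling on `θ` costs a factor `‖x‖⁻¹`; the lower derivatives
        -- of `G` vanish to correspondingly higher order.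
        have h3 : ‖x‖ ^ (k + (n - (a - c))) ≤ ‖x‖ ^ (k + c) :=
          pow_le_pow_of_le_one hx'.le hx1 (by omega)
        calc _ ≤ ‖iteratedFDeriv ℝ c θ x‖ * (A * ‖x‖ ^ (k + c)) :=
              mul_le_mul_of_nonneg_left (h2.trans (mul_le_mul_of_nonneg_left h3 hA0))
                (norm_nonneg _)
          _ = (‖x‖ ^ c * ‖iteratedFDeriv ℝ c θ x‖) * A * ‖x‖ ^ k := by rw [pow_add]; ring
          _ ≤ b * A * ‖x‖ ^ k := mul_le_mul_of_nonneg_right (mul_le_mul_of_nonneg_right h1 hA0)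
              (by positivity)
    _ = 2 ^ a * (b * A * ‖x‖ ^ k) := by
        rw [← Finset.sum_mul]
        congr 1
        exact_mod_cast Nat.sum_range_choose a
    _ ≤ 2 ^ n * (b * A * ‖x‖ ^ k) := by
        gcongr
        norm_num
    _ = _ := by ring

theorem FlatSmooth.mul_left {θ G : E m → ℂ} (hG : FlatSmooth G) (hθ : ContDiff ℝ ∞ θ) :
    FlatSmooth fun x => θ x * G x := by
  refine ⟨hθ.mul hG.smooth, fun i => norm_le_zero_iff.1 ?_⟩
  refine (norm_iteratedFDeriv_mul_le hθ hG.smooth 0 (n := i) (by exact_mod_cast le_top)).trans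
    (le_of_eq (Finset.sum_eq_zero fun c _ => ?_))
  rw [hG.flat, norm_zero, mul_zero]

end Cutoffs

/-! ### The estimates on the unit ball -/

section UnitBall

variable {m : ℕ} {ε : FlatFun m unitRadius →ₗ[ℂ] FlatSchwartz m} {χ ψ : ℝ → ℝ}

theorem IsFlatExtension.exists_norm_le (hε : IsFlatExtension ε) (n k : ℕ) :
    ∃ C : ℝ, 0 ≤ C ∧ ∀ (f : FlatFun m unitRadius) (A : ℝ), 0 ≤ A →
      flatNorm n k unitRadius (f : E m → ℂ) ≤ ENNReal.ofReal A → ∀ a ≤ n, ∀ x,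
      ‖iteratedFDeriv ℝ a (ε f : 𝓢(E m, ℂ)) x‖ ≤ C * A * ‖x‖ ^ k := by
  obtain ⟨C, hC⟩ := hε.bounded n k
  refine ⟨(m + 1) ^ n * max C 0, by positivity, fun f A hA hf a ha x => ?_⟩
  rcases eq_or_ne x 0 with rfl | hx
  · rw [(FlatSmooth.of_flatSchwartz (ε f)).flat, norm_zero]
    positivity
  have h1 : globalFlatNorm n k (ε f : 𝓢(E m, ℂ)) ≤ ENNReal.ofReal (max C 0 * A) := by
    rw [ENNReal.ofReal_mul (le_max_right _ _)]
    exact (hC f).trans (mul_le_mul' (ENNReal.ofReal_le_ofReal (le_max_left _ _)) hf)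
  have h2 : (m : ℝ) ^ a ≤ (m + 1) ^ n :=
    (pow_le_pow_left₀ (by positivity) (by linarith) _).trans
      (pow_le_pow_right₀ (by linarith [(Nat.cast_nonneg m : (0 : ℝ) ≤ m)]) ha)
  calc _ ≤ (m : ℝ) ^ a * (max C 0 * A * ‖x‖ ^ k) :=
        norm_iteratedFDeriv_le_of_globalFlatNorm_le (by positivity) h1 hx ha le_rfl
    _ ≤ (m + 1) ^ n * (max C 0 * A * ‖x‖ ^ k) := mul_le_mul_of_nonneg_right h2 (by positivity)
    _ = _ := by ring

/-- Bounds at the origin for `f` give bounds at infinity for the pull back of its extension along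
the inversion. -/
theorem IsFlatExtension.exists_weighted_schwartzInversion_le (hε : IsFlatExtension ε) (n k : ℕ) :
    ∃ C : ℝ, 0 ≤ C ∧ ∀ (f : FlatFun m unitRadius) (A : ℝ), 0 ≤ A →
      flatNorm n k unitRadius (f : E m → ℂ) ≤ ENNReal.ofReal A → ∀ a ≤ n, ∀ y,
      (1 + ‖y‖) ^ (k + n + a) * ‖iteratedFDeriv ℝ a (schwartzInversion (ε f)) y‖ ≤ C * A := by
  obtain ⟨C, hC0, hC⟩ := hε.exists_norm_le n k
  obtain ⟨R, hR⟩ := hε.supported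
  obtain ⟨D, hD0, hD⟩ := exists_weighted_pullInversion_le m n k
    (lt_of_lt_of_le one_pos (le_max_right R 1))
  refine ⟨D * C, by positivity, fun f A hA hf => ?_⟩
  rw [mul_assoc]
  exact hD _ (FlatSmooth.of_flatSchwartz (ε f))
    (fun x hx => hR f x ((le_max_left _ _).trans_lt hx)) _ (by positivity) (hC f A hA hf)

theorem pullInversion_add (g h : E m → ℂ) :
    pullInversion (g + h) = pullInversion g + pullInversion h := by
  ext x
  by_cases hx : x = 0 <;> simp [pullInversion, hx]

theorem pullInversion_sub (g h : E m → ℂ) :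
    pullInversion (g - h) = pullInversion g - pullInversion h := by
  ext x
  by_cases hx : x = 0 <;> simp [pullInversion, hx]

theorem pullInversion_smul (c : ℂ) (g : E m → ℂ) :
    pullInversion (c • g) = c • pullInversion g := by
  ext x
  by_cases hx : x = 0 <;> simp [pullInversion, hx]

theorem pullInversion_im {g : E m → ℂ} (hg : ∀ x, (g x).im = 0) (x : E m) :
    (pullInversion g x).im = 0 := by
  by_cases hx : x = 0 <;> simp [pullInversion, hx, hg]

theorem schwartzInversion_add (g h : FlatSchwartz m) :
    schwartzInversion (g + h) = schwartzInversion g + schwartzInversion h :=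
  DFunLike.coe_injective (pullInversion_add _ _)

theorem schwartzInversion_smul (c : ℂ) (g : FlatSchwartz m) :
    schwartzInversion (c • g) = c • schwartzInversion g :=
  DFunLike.coe_injective (pullInversion_smul c _)

/-- Nash's smoothing of the pull back of `f` along the inversion. -/
def invertedSmoothing (ε : FlatFun m unitRadius →ₗ[ℂ] FlatSchwartz m) (hχ : IsNashCutoff χ) {t : ℝ}
    (ht : 0 < t) (f : FlatFun m unitRadius) : 𝓢(E m, ℂ) :=
  conv (dilatedKernel (nashSchwartz m hχ) ht) (schwartzInversion (ε f))

theorem derivSmoothingUnit_eq (hχ : IsNashCutoff χ) {t : ℝ} (ht : 0 < t)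
    (f : FlatFun m unitRadius) : derivSmoothingUnit ε χ t f =
      (cball m unitRadius).indicator (pullInversion (invertedSmoothing ε hχ ht f)) := by
  rw [derivSmoothingUnit, ← coe_schwartzInversion, nashSmoothing_eq_conv hχ ht, invertedSmoothing]

theorem IsWeightCutoff.contDiff_radialCutoff_smul (hψ : IsWeightCutoff ψ) (s : ℝ) :
    ContDiff ℝ ∞ fun x : E m => radialCutoff m ψ (s • x) :=
  hψ.contDiff_radialCutoff.comp (contDiff_const_smul s)

/-- The combined smoothing on the unit ball. -/
def unitSmoothing (ε : FlatFun m unitRadius →ₗ[ℂ] FlatSchwartz m) (hχ : IsNashCutoff χ)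
    (hψ : IsWeightCutoff ψ) {t : ℝ} (ht : 0 < t) (s : ℝ) :
    FlatFun m unitRadius →ₗ[ℂ] FlatFun m unitRadius where
  toFun f := ⟨(cball m unitRadius).indicator fun x =>
      radialCutoff m ψ (s • x) * pullInversion (invertedSmoothing ε hχ ht f) x,
    ((flatSmooth_pullInversion _).mul_left (hψ.contDiff_radialCutoff_smul s)).indicator_mem _⟩
  map_add' f g := by
    refine Subtype.ext ?_
    change _ = Set.indicator _ _ + Set.indicator _ _
    rw [← Set.indicator_add']
    change Set.indicator _ _ = _
    congr 1
    ext x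
    have : (invertedSmoothing ε hχ ht (f + g) : E m → ℂ) =
        invertedSmoothing ε hχ ht f + invertedSmoothing ε hχ ht g := by
      rw [invertedSmoothing, map_add, schwartzInversion_add, conv, map_add]
      rfl
    rw [this, pullInversion_add, Pi.add_apply, Pi.add_apply, mul_add]
  map_smul' c f := by
    refine Subtype.ext ?_
    refine Eq.trans ?_ (Set.indicator_const_smul (cball m unitRadius) c _)
    change Set.indicator _ _ = _
    congr 1
    ext x
    have : (invertedSmoothing ε hχ ht (c • f) : E m → ℂ) =
        c • (invertedSmoothing ε hχ ht f : E m → ℂ) := by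
      rw [invertedSmoothing, map_smul, schwartzInversion_smul, conv, map_smul]
      rfl
    rw [this, pullInversion_smul, Pi.smul_apply, smul_eq_mul, smul_eq_mul, mul_left_comm]

theorem coe_unitSmoothing (hχ : IsNashCutoff χ) (hψ : IsWeightCutoff ψ) {t : ℝ} (ht : 0 < t)
    (s : ℝ) (f : FlatFun m unitRadius) : (unitSmoothing ε hχ hψ ht s f : E m → ℂ) =
      (cball m unitRadius).indicator fun x =>
        radialCutoff m ψ (s • x) * pullInversion (invertedSmoothing ε hχ ht f) x := rfl

/-- The indices `n, k + 2 * l` of the source give at infinity the weights `k + n + 2 * l + a`, and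
the indices `n + l, k` need `k + n + l + a`. This is the exchange made by `exists_weighted_conv_le`;
the cutoff then supplies `(s * ‖x‖) ^ j`. -/
theorem IsFlatExtension.exists_flatNorm_unitSmoothing_le (hε : IsFlatExtension ε)
    (hχ : IsNashCutoff χ) (hψ : IsWeightCutoff ψ) (j k l n : ℕ) :
    ∃ C : ℝ, 0 ≤ C ∧ ∀ (t s : ℝ) (ht : 1 ≤ t), 0 < s → ∀ (f : FlatFun m unitRadius) (A : ℝ),
      0 ≤ A → flatNorm n (k + 2 * l) unitRadius (f : E m → ℂ) ≤ ENNReal.ofReal A →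
      flatNorm (n + l) (k + j) unitRadius
        (unitSmoothing ε hχ hψ (one_pos.trans_le ht) s f : E m → ℂ) ≤
          ENNReal.ofReal (C * s ^ j * t ^ l * A) := by
  obtain ⟨C₁, hC₁, h₁⟩ := hε.exists_weighted_schwartzInversion_le n (k + 2 * l)
  obtain ⟨C₂, hC₂, h₂⟩ := exists_weighted_conv_le (nashSchwartz m hχ) n l (k + n)
  obtain ⟨C₃, hC₃, h₃⟩ := exists_pullInversion_weighted_le m (n + l) k
  obtain ⟨B, hB, h₄⟩ := hψ.exists_growth m (n + l) j
  refine ⟨2 ^ (n + l) * B * C₃ * C₂ * C₁, by positivity, fun t s ht hs f A hA hf => ?_⟩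
  have ht0 := one_pos.trans_le ht
  refine flatNorm_le_ofReal fun x hx hx0 a ha => ?_
  have hsm := (flatSmooth_pullInversion (invertedSmoothing ε hχ ht0 f)).smooth
  rw [iteratedFDerivWithin_eq_of_eqOn ((hψ.contDiff_radialCutoff_smul s).mul hsm)
    (fun y hy => by rw [coe_unitSmoothing, Set.indicator_of_mem hy]) hx]
  have e₁ : ∀ a ≤ n + l, ∀ y, (1 + ‖y‖) ^ (k + (n + l) + a) *
      ‖iteratedFDeriv ℝ a (invertedSmoothing ε hχ ht0 f) y‖ ≤ C₂ * t ^ l * (C₁ * A) := by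
    intro a ha y
    rw [← add_assoc k n l]
    refine h₂ t ht _ _ (by positivity) (fun a ha y => ?_) a ha y
    rw [add_right_comm k n]
    exact h₁ f A hA hf a ha y
  refine (norm_iteratedFDeriv_mul_weighted_le (hψ.contDiff_radialCutoff_smul s) hsm hx0
    (mem_unitBall.1 hx) (b := B * ‖s • x‖ ^ j)
    (fun c hc => (pow_mul_norm_iteratedFDeriv_comp_smul_le hs c x).trans (h₄ c hc _))
    (fun a ha => h₃ _ ((invertedSmoothing ε hχ ht0 f).smooth ⊤) _ (by positivity) e₁ a ha x hx0)
    ha).trans (le_of_eq ?_)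
  rw [norm_smul, Real.norm_eq_abs, abs_of_pos hs]
  ring

theorem IsFlatExtension.exists_flatNorm_unitSmoothing_sub_le (hε : IsFlatExtension ε)
    (hχ : IsNashCutoff χ) (hψ : IsWeightCutoff ψ) (j k l n : ℕ) :
    ∃ C : ℝ, 0 ≤ C ∧ ∀ (t s : ℝ) (ht : 1 ≤ t), 0 < s → ∀ (f : FlatFun m unitRadius) (A A' : ℝ),
      0 ≤ A → flatNorm (n + l) k unitRadius (f : E m → ℂ) ≤ ENNReal.ofReal A →
      0 ≤ A' → flatNorm n (k + 2 * l + j) unitRadius (f : E m → ℂ) ≤ ENNReal.ofReal A' →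
      flatNorm n (k + 2 * l) unitRadius
        ((unitSmoothing ε hχ hψ (one_pos.trans_le ht) s f - f : FlatFun m unitRadius) :
          E m → ℂ) ≤ ENNReal.ofReal (C * ((t ^ l)⁻¹ * A + (s ^ j)⁻¹ * A')) := by
  obtain ⟨C₁, hC₁, h₁⟩ := hε.exists_weighted_schwartzInversion_le (n + l) k
  obtain ⟨C₂, hC₂, h₂⟩ := exists_weighted_iteratedFDeriv_conv_sub_le
    (hasVanishingMoments_nashSchwartz (m := m) hχ) n l (k + n)
  obtain ⟨C₃, hC₃, h₃⟩ := exists_pullInversion_weighted_le m n (k + 2 * l)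
  obtain ⟨B, hB, h₄⟩ := hψ.exists_growth m n 0
  obtain ⟨C₅, hC₅, h₅⟩ := hε.exists_norm_le n (k + 2 * l + j)
  obtain ⟨D, hD, h₆⟩ := hψ.exists_decay m n j
  refine ⟨2 ^ n * B * C₃ * C₂ * C₁ + 2 ^ n * D * C₅, by positivity,
    fun t s ht hs f A A' hA hf hA' hf' => ?_⟩
  have ht0 := one_pos.trans_le ht
  refine flatNorm_le_ofReal fun x hx hx0 a ha => ?_
  have hx' : 0 < ‖x‖ := norm_pos_iff.2 hx0
  set h := schwartzInversion (ε f)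
  set F : 𝓢(E m, ℂ) := invertedSmoothing ε hχ ht0 f - h
  set g : E m → ℂ := ((ε f : 𝓢(E m, ℂ)) : E m → ℂ)
  set θ : E m → ℂ := fun x => radialCutoff m ψ (s • x)
  have hθ : ContDiff ℝ ∞ θ := hψ.contDiff_radialCutoff_smul s
  have hθ' : ContDiff ℝ ∞ fun x => 1 - θ x := contDiff_const.sub hθ
  have hF : ContDiff ℝ ∞ (pullInversion F) := (flatSmooth_pullInversion F).smooth
  have hg : FlatSmooth g := FlatSmooth.of_flatSchwartz (ε f)
  -- The inversion is an involution off the origin, and at the origin both sides vanish. So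
  -- `pullInversion F` is the error of the derivative smoothing alone.
  have hFg : ∀ y, pullInversion F y = pullInversion (invertedSmoothing ε hχ ht0 f) y - g y := by
    intro y
    change pullInversion ((invertedSmoothing ε hχ ht0 f : E m → ℂ) - pullInversion g) y = _
    rw [pullInversion_sub, Pi.sub_apply]
    rcases eq_or_ne y 0 with rfl | hy
    · rw [norm_eq_zero.1 ((norm_iteratedFDeriv_zero (𝕜 := ℝ) (f := g) (x := 0)).symm.trans
        (by rw [hg.flat, norm_zero]))]
      simp [pullInversion]
    · rw [pullInversion_pullInversion hy]
  have hsm₁ : ContDiff ℝ ∞ fun x => θ x * pullInversion F x := hθ.mul hF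
  have hsm₂ : ContDiff ℝ ∞ fun x => (1 - θ x) * g x := hθ'.mul hg.smooth
  -- On the ball, `θ * S g - g = θ * (S g - g) - (1 - θ) * g`, where `S` is the derivative
  -- smoothing.
  rw [iteratedFDerivWithin_eq_of_eqOn (G := (fun x => θ x * pullInversion F x) -
      fun x => (1 - θ x) * g x) (hsm₁.sub hsm₂) (fun y hy => ?_) hx,
    iteratedFDeriv_sub_apply (hsm₁.contDiffAt.of_le (by exact_mod_cast le_top))
      (hsm₂.contDiffAt.of_le (by exact_mod_cast le_top))]
  swap
  · change (cball m unitRadius).indicator _ y - (f : E m → ℂ) y = _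
    rw [Set.indicator_of_mem hy, ← hε.extends_ball f y hy, Pi.sub_apply, hFg]
    ring
  have b₁ : ‖iteratedFDeriv ℝ a (fun x => θ x * pullInversion F x) x‖ ≤
      2 ^ n * B * C₃ * C₂ * C₁ * ((t ^ l)⁻¹ * A) * ‖x‖ ^ (k + 2 * l) := by
    have e₁ : ∀ a ≤ n, ∀ y, (1 + ‖y‖) ^ (k + 2 * l + n + a) * ‖iteratedFDeriv ℝ a F y‖ ≤
        C₂ * (t ^ l)⁻¹ * (C₁ * A) := by
      intro a ha y
      rw [add_right_comm k]
      refine h₂ t ht h _ (by positivity) (fun a ha y => ?_) a ha y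
      rw [add_assoc k n l]
      exact h₁ f A hA hf a ha y
    refine (norm_iteratedFDeriv_mul_weighted_le hθ hF hx0 (mem_unitBall.1 hx)
      (b := B * ‖s • x‖ ^ 0)
      (fun c hc => (pow_mul_norm_iteratedFDeriv_comp_smul_le hs c x).trans (h₄ c hc _))
      (fun a ha => h₃ F (F.smooth ⊤) _ (by positivity) e₁ a ha x hx0) ha).trans (le_of_eq ?_)
    ring
  have b₂ : ‖iteratedFDeriv ℝ a (fun x => (1 - θ x) * g x) x‖ ≤
      2 ^ n * D * C₅ * ((s ^ j)⁻¹ * A') * ‖x‖ ^ (k + 2 * l) := by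
    have hsx : 0 < ‖s • x‖ ^ j := pow_pos (norm_pos_iff.2 (smul_ne_zero hs.ne' hx0)) j
    -- Here `1 - θ` is large by the factor `(s * ‖x‖) ^ (-j)` only, and `j` additional weights on
    -- `g` absorb the power of `‖x‖`.
    refine (norm_iteratedFDeriv_mul_weighted_le hθ' hg.smooth hx0 (mem_unitBall.1 hx)
      (b := D / ‖s • x‖ ^ j) (A := C₅ * A') (k := k + 2 * l + j)
      (fun c hc => (pow_mul_norm_iteratedFDeriv_comp_smul_le
        (θ := fun x => 1 - radialCutoff m ψ x) hs c x).trans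
          ((le_div_iff₀ hsx).2 (h₆ c hc _)))
      (fun a ha => hg.norm_iteratedFDeriv_le (R := 1) (by positivity)
        (fun y _ => h₅ f A' hA' hf' n le_rfl y) ha (mem_unitBall.1 hx)) ha).trans (le_of_eq ?_)
    rw [norm_smul, Real.norm_eq_abs, abs_of_pos hs, pow_add]
    field_simp
    ring
  refine (norm_sub_le _ _).trans ((add_le_add b₁ b₂).trans ?_)
  rw [← add_mul]
  refine mul_le_mul_of_nonneg_right ?_ (by positivity)
  have p₁ : 0 ≤ 2 ^ n * B * C₃ * C₂ * C₁ * ((s ^ j)⁻¹ * A') := by positivity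
  have p₂ : 0 ≤ 2 ^ n * D * C₅ * ((t ^ l)⁻¹ * A) := by positivity
  linarith

theorem unitSmoothing_im (hε : IsFlatExtension ε) (hχ : IsNashCutoff χ) (hψ : IsWeightCutoff ψ)
    {t : ℝ} (ht : 0 < t) (s : ℝ) {f : FlatFun m unitRadius}
    (hf : ∀ x, ((f : E m → ℂ) x).im = 0) (x : E m) :
    ((unitSmoothing ε hχ hψ ht s f : E m → ℂ) x).im = 0 := by
  rw [coe_unitSmoothing, invertedSmoothing, ← nashSmoothing_eq_conv, coe_schwartzInversion]
  by_cases hx : x ∈ cball m unitRadius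
  · rw [Set.indicator_of_mem hx, radialCutoff, Complex.im_ofReal_mul,
      pullInversion_im (nashSmoothing_im (pullInversion_im (hε.real_valued f hf))), mul_zero]
  · rw [Set.indicator_of_notMem hx, Complex.zero_im]

end UnitBall

/-! ### Balls of arbitrary radius -/

section Ball

variable {m : ℕ} {ε : FlatFun m unitRadius →ₗ[ℂ] FlatSchwartz m} {χ ψ : ℝ → ℝ}

/-- Rescaling from the unit ball to the ball of radius `r`. -/
def ofUnitBall (m : ℕ) (r : Radius) : FlatFun m unitRadius →ₗ[ℂ] FlatFun m r :=
  dilate m (inv_pos.2 r.2) (inv_mul_cancel₀ (ne_of_gt r.2))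

/-- Rescaling to the unit ball from the ball of radius `r`, as a linear map. -/
def toUnitBallₗ (m : ℕ) (r : Radius) : FlatFun m r →ₗ[ℂ] FlatFun m unitRadius :=
  dilate m (r := r) (r' := unitRadius) r.2 (mul_one _)

theorem ofUnitBall_toUnitBall (r : Radius) (f : FlatFun m r) :
    ofUnitBall m r (toUnitBallₗ m r f) = f := by
  refine Subtype.ext (funext fun x => ?_)
  change (f : E m → ℂ) ((r : ℝ) • (r : ℝ)⁻¹ • x) = _
  rw [smul_inv_smul₀ (ne_of_gt r.2)]

theorem flatNorm_toUnitBall_le (r : Radius) (f : FlatFun m r) {n k : ℕ} {A : ℝ} (hA : 0 ≤ A)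
    (hf : flatNorm n k r (f : E m → ℂ) ≤ ENNReal.ofReal A) {N : ℕ} (hN : n + k ≤ N) :
    flatNorm n k unitRadius (toUnitBallₗ m r f : E m → ℂ) ≤
      ENNReal.ofReal (max 1 (r : ℝ) ^ N * A) := by
  refine (flatNorm_pullDilation_le r.2 (mul_one _) _ hA hf).trans (ENNReal.ofReal_le_ofReal ?_)
  exact mul_le_mul_of_nonneg_right (pow_le_pow_right₀ (le_max_left _ _) hN) hA

theorem flatNorm_ofUnitBall_le (r : Radius) (f : FlatFun m unitRadius) {n k : ℕ} {A : ℝ}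
    (hA : 0 ≤ A) (hf : flatNorm n k unitRadius (f : E m → ℂ) ≤ ENNReal.ofReal A) {N : ℕ}
    (hN : n + k ≤ N) : flatNorm n k r (ofUnitBall m r f : E m → ℂ) ≤
      ENNReal.ofReal (max 1 (r : ℝ)⁻¹ ^ N * A) := by
  refine (flatNorm_pullDilation_le (inv_pos.2 r.2) (inv_mul_cancel₀ (ne_of_gt r.2)) _ hA hf).trans
    (ENNReal.ofReal_le_ofReal ?_)
  exact mul_le_mul_of_nonneg_right (pow_le_pow_right₀ (le_max_left _ _) hN) hA

/-- On the ball `f` agrees with its Seeley extension, a globally smooth flat function, for which the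
Taylor type bound `FlatSmooth.exists_norm_le` is available. -/
theorem flatNorm_unit_lt_top (f : FlatFun m unitRadius) (n k : ℕ) :
    flatNorm n k unitRadius (f : E m → ℂ) < ⊤ := by
  obtain ⟨a, ha⟩ := exists_isSeeley
  have hg := FlatSmooth.of_flatSchwartz (seeleyExtension ha f)
  obtain ⟨A, _, h⟩ := hg.exists_norm_le 1 n k
  refine (flatNorm_le_ofReal (A := A) fun x hx _ i hi => ?_).trans_lt ENNReal.ofReal_lt_top
  rw [iteratedFDerivWithin_eq_of_eqOn hg.smooth
    (fun y hy => ((isFlatExtension_seeleyExtension ha).extends_ball f y hy).symm) hx]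
  exact h i hi x (mem_unitBall.1 hx)

theorem flatNorm_lt_top (r : Radius) (f : FlatFun m r) (n k : ℕ) :
    flatNorm n k r (f : E m → ℂ) < ⊤ := by
  have h := (ENNReal.ofReal_toReal (flatNorm_unit_lt_top (toUnitBallₗ m r f) n k).ne).ge
  rw [← ofUnitBall_toUnitBall r f]
  exact (flatNorm_ofUnitBall_le r _ ENNReal.toReal_nonneg h le_rfl).trans_lt
    ENNReal.ofReal_lt_top

/-- The combined smoothing on the ball of radius `r`, and zero for non-positive parameters. -/
def ballSmoothing (ε : FlatFun m unitRadius →ₗ[ℂ] FlatSchwartz m) (hχ : IsNashCutoff χ)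
    (hψ : IsWeightCutoff ψ) (t s : ℝ) (r : Radius) : FlatFun m r →ₗ[ℂ] FlatFun m r :=
  if ht : 0 < t then ofUnitBall m r ∘ₗ unitSmoothing ε hχ hψ ht s ∘ₗ toUnitBallₗ m r else 0

theorem ballSmoothing_apply (hχ : IsNashCutoff χ) (hψ : IsWeightCutoff ψ) {t : ℝ} (ht : 0 < t)
    (s : ℝ) (r : Radius) (f : FlatFun m r) : ballSmoothing ε hχ hψ t s r f =
      ofUnitBall m r (unitSmoothing ε hχ hψ ht s (toUnitBallₗ m r f)) := by
  rw [ballSmoothing, dif_pos ht]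
  rfl

theorem ballSmoothing_eq_combinedSmoothing (hχ : IsNashCutoff χ) (hψ : IsWeightCutoff ψ) {t s : ℝ}
    (ht : 0 < t) (hs : 0 < s) (r : Radius) (f : FlatFun m r) :
    (ballSmoothing ε hχ hψ t s r f : E m → ℂ) = combinedSmoothing ε χ ψ t s r f := by
  ext x
  have hU : toUnitBall r f = toUnitBallₗ m r f := rfl
  rw [ballSmoothing_apply hχ hψ ht, combinedSmoothing, weightSmoothing, derivSmoothing, hU,
    derivSmoothingUnit_eq hχ ht]
  change (unitSmoothing ε hχ hψ ht s (toUnitBallₗ m r f) : E m → ℂ) ((r : ℝ)⁻¹ • x) =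
    (ψ (s * ‖(r : ℝ)⁻¹ • x‖) : ℂ) * Set.indicator _ _ ((r : ℝ)⁻¹ • (r : ℝ) • (r : ℝ)⁻¹ • x)
  rw [inv_smul_smul₀ (ne_of_gt r.2), coe_unitSmoothing]
  set y := (r : ℝ)⁻¹ • x
  by_cases hy : y ∈ cball m unitRadius
  · rw [Set.indicator_of_mem hy, Set.indicator_of_mem hy, radialCutoff, norm_smul,
      Real.norm_eq_abs, abs_of_pos hs]
  · rw [Set.indicator_of_notMem hy, Set.indicator_of_notMem hy, mul_zero]

theorem ballSmoothing_im (hε : IsFlatExtension ε) (hχ : IsNashCutoff χ) (hψ : IsWeightCutoff ψ)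
    {t : ℝ} (ht : 0 < t) (s : ℝ) (r : Radius) {f : FlatFun m r}
    (hf : ∀ x, ((f : E m → ℂ) x).im = 0) (x : E m) :
    ((ballSmoothing ε hχ hψ t s r f : E m → ℂ) x).im = 0 := by
  rw [ballSmoothing_apply hχ hψ ht]
  exact unitSmoothing_im hε hχ hψ ht s (f := toUnitBallₗ m r f) (fun y => hf _) _

theorem IsFlatExtension.exists_flatNorm_ballSmoothing_le (hε : IsFlatExtension ε)
    (hχ : IsNashCutoff χ) (hψ : IsWeightCutoff ψ) (j k l n : ℕ) :
    ∃ C : Radius → ℝ, Continuous C ∧ (∀ r, 0 < C r) ∧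
      ∀ (t s : ℝ) (r : Radius) (f : FlatFun m r), 1 ≤ t → 0 < s →
        flatNorm (n + l) (k + j) r (ballSmoothing ε hχ hψ t s r f : E m → ℂ) ≤
          ENNReal.ofReal (C r * s ^ j * t ^ l) * flatNorm n (k + 2 * l) r (f : E m → ℂ) ∧
        flatNorm n (k + 2 * l) r ((ballSmoothing ε hχ hψ t s r f - f : FlatFun m r) : E m → ℂ) ≤
          ENNReal.ofReal (C r) *
            (ENNReal.ofReal ((t ^ l)⁻¹) * flatNorm (n + l) k r (f : E m → ℂ) +
              ENNReal.ofReal ((s ^ j)⁻¹) * flatNorm n (k + 2 * l + j) r (f : E m → ℂ)) := by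
  obtain ⟨C₁, hC₁, h₁⟩ := hε.exists_flatNorm_unitSmoothing_le hχ hψ j k l n
  obtain ⟨C₂, hC₂, h₂⟩ := hε.exists_flatNorm_unitSmoothing_sub_le hχ hψ j k l n
  -- This exponent dominates the sum of the two indices of every norm that occurs.
  set N := n + k + 2 * l + j with hN
  -- The two powers come from rescaling to the unit ball and back; both are continuous in `r`. The
  -- summand `1` makes the constant positive.
  refine ⟨fun r => (C₁ + C₂ + 1) * (max 1 (r : ℝ)⁻¹ ^ N * max 1 (r : ℝ) ^ N), ?_, fun r => ?_,
    fun t s r f ht hs => ?_⟩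
  · have : Continuous fun r : Radius => (r : ℝ)⁻¹ :=
      continuous_subtype_val.inv₀ fun r => ne_of_gt r.2
    fun_prop
  · positivity
  have ht0 := one_pos.trans_le ht
  have key : ∀ n' k', ∃ A : ℝ, 0 ≤ A ∧ flatNorm n' k' r (f : E m → ℂ) = ENNReal.ofReal A :=
    fun n' k' => ⟨_, ENNReal.toReal_nonneg,
      (ENNReal.ofReal_toReal (flatNorm_lt_top r f n' k').ne).symm⟩
  have hP : 0 ≤ max 1 (r : ℝ)⁻¹ ^ N := by positivity
  have hQ : 0 ≤ max 1 (r : ℝ) ^ N := by positivity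
  set P := max 1 (r : ℝ)⁻¹ ^ N
  set Q := max 1 (r : ℝ) ^ N
  constructor
  · obtain ⟨A, hA, e⟩ := key n (k + 2 * l)
    rw [ballSmoothing_apply hχ hψ ht0, e, ← ENNReal.ofReal_mul (by positivity)]
    refine (flatNorm_ofUnitBall_le r _ (by positivity) (h₁ t s ht hs _ _ (by positivity)
      (flatNorm_toUnitBall_le r f hA e.le (N := N) (by omega))) (N := N) (by omega)).trans
        (ENNReal.ofReal_le_ofReal ?_)
    have : 0 ≤ (C₂ + 1) * (P * Q) * s ^ j * t ^ l * A := by positivity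
    linarith
  · obtain ⟨A, hA, e⟩ := key (n + l) k
    obtain ⟨A', hA', e'⟩ := key n (k + 2 * l + j)
    have h3 : ballSmoothing ε hχ hψ t s r f - f = ofUnitBall m r
        (unitSmoothing ε hχ hψ ht0 s (toUnitBallₗ m r f) - toUnitBallₗ m r f) := by
      rw [map_sub, ofUnitBall_toUnitBall, ballSmoothing_apply hχ hψ ht0]
    rw [h3, e, e', ← ENNReal.ofReal_mul (by positivity), ← ENNReal.ofReal_mul (by positivity),
      ← ENNReal.ofReal_add (by positivity) (by positivity), ← ENNReal.ofReal_mul (by positivity)]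
    refine (flatNorm_ofUnitBall_le r _ (by positivity) (h₂ t s ht hs _ _ _ (by positivity)
      (flatNorm_toUnitBall_le r f hA e.le (N := N) (by omega)) (by positivity)
      (flatNorm_toUnitBall_le r f hA' e'.le (N := N) (by omega))) (N := N) (by omega)).trans
        (ENNReal.ofReal_le_ofReal ?_)
    have : 0 ≤ (C₁ + 1) * (P * Q) * ((t ^ l)⁻¹ * A + (s ^ j)⁻¹ * A') := by positivity
    linarith

end Ball

end FlatSmoothing

end

theorem mainTheorem4 (m : ℕ) :
    (∃ ε : FlatFun m unitRadius →ₗ[ℂ] FlatSchwartz m,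
      IsFlatExtension ε) ∧
    (∃ χ : ℝ → ℝ, IsNashCutoff χ) ∧
    (∃ ψ : ℝ → ℝ, IsWeightCutoff ψ) ∧
    (∀ (r : Radius) (f : FlatFun m r) (n k : ℕ),
      flatNorm n k r (f : E m → ℂ) < ⊤) ∧
    ∀ (ε : FlatFun m unitRadius →ₗ[ℂ] FlatSchwartz m)
      (χ ψ : ℝ → ℝ), IsFlatExtension ε → IsNashCutoff χ →
      IsWeightCutoff ψ →
      ∃ S : ∀ (_t _s : ℝ) (r : Radius),
          FlatFun m r →ₗ[ℂ] FlatFun m r,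
        (∀ (t s : ℝ) (r : Radius) (f : FlatFun m r), 0 < t → 0 < s →
          (S t s r f : E m → ℂ) =
            combinedSmoothing ε χ ψ t s r f) ∧
        (∀ (t s : ℝ) (r : Radius) (f : FlatFun m r), 0 < t → 0 < s →
          (∀ x, ((f : E m → ℂ) x).im = 0) →
          ∀ x, ((S t s r f : E m → ℂ) x).im = 0) ∧
        ∀ j k l n : ℕ, ∃ C : Radius → ℝ, Continuous C ∧ (∀ r, 0 < C r) ∧
          ∀ (t s : ℝ) (r : Radius) (f : FlatFun m r),
            1 ≤ t → 0 < s →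
            flatNorm (n + l) (k + j) r (S t s r f : E m → ℂ) ≤
              ENNReal.ofReal (C r * s ^ j * t ^ l) *
                flatNorm n (k + 2 * l) r (f : E m → ℂ) ∧
            flatNorm n (k + 2 * l) r
                ((S t s r f - f : FlatFun m r) : E m → ℂ) ≤
              ENNReal.ofReal (C r) *
                (ENNReal.ofReal ((t ^ l)⁻¹) *
                    flatNorm (n + l) k r (f : E m → ℂ) +
                  ENNReal.ofReal ((s ^ j)⁻¹) *
                    flatNorm n (k + 2 * l + j) r
                      (f : E m → ℂ)) := by
  refine ⟨?_, exists_isNashCutoff, exists_isWeightCutoff, flatNorm_lt_top,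
    fun ε χ ψ hε hχ hψ => ⟨ballSmoothing ε hχ hψ, ?_, ?_,
      hε.exists_flatNorm_ballSmoothing_le hχ hψ⟩⟩
  · obtain ⟨a, ha⟩ := exists_isSeeley
    exact ⟨seeleyExtension ha, isFlatExtension_seeleyExtension ha⟩
  · exact fun t s r f ht hs => ballSmoothing_eq_combinedSmoothing hχ hψ ht hs r f
  · exact fun t s r f ht _ hf => ballSmoothing_im hε hχ hψ ht s r hf
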